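/- Let $a<b$, $r\in\mathbb N$, $\mathcal H=L^2((a,b);\mathbb C^r)$. Let $\mathbf A\in W^{1,\infty}((a,b);\mathbb C^{r\times r})$ (identified with its continuous representative on $[a,b]$) satisfy $\mathbf A=\mathbf A^*$, let $\mathbf B\in L^\infty((a,b);\mathbb C^{r\times r})$, and assume that for some $\mu_0>0$ $$\mathbf B+\mathbf B^*+\mathbf A'\ \ge\ 2\mu_0\mathbf I\qquad\text{a.e. on }(a,b).$$ On $C_c^\infty((a,b);\mathbb C^r)$ define $T u=(\mathbf Au)'+\mathbf Bu$ and $\widetilde T u=-(\mathbf Au)'+(\mathbf B^*+\mathbf A')u$, as densely defined operators in $\mathcal H$. Then $(T,\widetilde T)$ is a joint pair of abstract Friedrichs operators: the common domain $\mathcal D$ is dense, $\langle T\varphi,\psi\rangle=\langle\varphi,\widetilde T\psi\rangle$ for $\varphi,\psi\in\mathcal D$, $T+\widetilde T$ is bounded on $\mathcal D$, and $\langle (T+\widetilde T)\varphi,\varphi\rangle\ge 2\mu\|\varphi\|^2$ on $\mathcal D$ for some $\mu>0$. Put $T_1=\widetilde T^*$, $\widetilde T_1=T^*$, let $\mathcal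 W=\operatorname{dom}T_1=\operatorname{dom}\widetilde T_1$ be the graph space, and $$[u\,|\,v]=\langle T_1u,v\rangle-\langle u,\widetilde T_1v\rangle,\qquad S^{[\perp]}=\{u\in\mathcal W:[u\,|\,v]=0\ \ \forall v\in S\}\qquad(u,v\in\mathcal W,\ S\subseteq\mathcal W).$$ For $x_0\in\{a,b\}$ and a nonzero eigenvalue $\lambda$ of $\mathbf A(x_0)$, let $\mathbf P_\lambda(x)$, for $x\in[a,b]$ near $x_0$, be the total projection of the $\lambda$-group, i.e. the sum of the eigenprojections of $\mathbf A(x)$ for those eigenvalues of $\mathbf A(x)$ that are closer to $\lambda$ than to any other eigenvalue of $\mathbf A(x_0)$. For every $u\in\mathcal W$ the function $\mathbf P_\lambda u$ has a continuous representative on a neighbourhood of $x_0$ in $[a,b]$, so that its value $(\mathbf P_\lambda u)(x_0)$ is well defined. Let $$\mathcal V=\{u\in\mathcal W:(\mathbf P_\lambda u)(a)=0\ \text{for all eigenvalues }\lambda>0\text{ of }\mathbf A(a),\ (\mathbf P_\lambda u)(b)=0\ \text{for all eigenvalues }\lambda<0\text{ of }\mathbf A(b)\},$$ $$\widetilde{\mathcal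 V}=\{u\in\mathcal W:(\mathbf P_\lambda u)(a)=0\ \text{for all eigenvalues }\lambda<0\text{ of }\mathbf A(a),\ (\mathbf P_\lambda u)(b)=0\ \text{for all eigenvalues }\lambda>0\text{ of }\mathbf A(b)\}.$$ Then $(\mathcal V,\widetilde{\mathcal V})$ satisfies the (V)-boundary conditions: (V1) $[u\,|\,u]\ge 0$ for all $u\in\mathcal V$, and $[v\,|\,v]\le 0$ for all $v\in\widetilde{\mathcal V}$; (V2) $\mathcal V=\widetilde{\mathcal V}^{[\perp]}$ and $\widetilde{\mathcal V}=\mathcal V^{[\perp]}$. Consequently $(T_1|_{\mathcal V},\widetilde T_1|_{\widetilde{\mathcal V}})$ is a pair of mutually adjoint bijective realisations relative to $(T,\widetilde T)$: $\overline T\subseteq T_1|_{\mathcal V}$ and $\overline{\widetilde T}\subseteq\widetilde T_1|_{\widetilde{\mathcal V}}$, the maps $T_1|_{\mathcal V}:\mathcal V\to\mathcal H$ and $\widetilde T_1|_{\widetilde{\mathcal V}}:\widetilde{\mathcal V}\to\mathcal H$ are bijective, $(T_1|_{\mathcal V})^*=\widetilde T_1|_{\widetilde{\mathcal V}}$ and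 $(\widetilde T_1|_{\widetilde{\mathcal V}})^*=T_1|_{\mathcal V}$. -/

import Mathlib

open MeasureTheory Set Filter Topology
open scoped ContDiff InnerProductSpace

noncomputable section

namespace Friedrichs

/-! ### Abstract Friedrichs operators

The scalar product of the source, linear in its first entry, is `⟨x, y⟩ = inner ℂ y x`. -/

section Abstract

variable {H : Type*} [NormedAddCommGroup H] [InnerProductSpace ℂ H]

open scoped ComplexOrder in
/-- `(T, T')` is a joint pair of abstract Friedrichs operators on `H`. -/
structure IsJointPair (T T' : H →ₗ.[ℂ] H) : Prop where
  domain_eq : T.domain = T'.domain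
  dense : Dense (T.domain : Set H)
  t1 : ∀ (φ : T.domain) (ψ : T'.domain),
    inner ℂ (ψ : H) (T φ) = inner ℂ (T' ψ) (φ : H)
  t2 : ∃ c : ℝ, 0 < c ∧ ∀ (φ : H) (h : φ ∈ T.domain) (h' : φ ∈ T'.domain),
    ‖T ⟨φ, h⟩ + T' ⟨φ, h'⟩‖ ≤ c * ‖φ‖
  t3 : ∃ μ₀ : ℝ, 0 < μ₀ ∧ ∀ (φ : H) (h : φ ∈ T.domain) (h' : φ ∈ T'.domain),
    ((2 * μ₀ * ‖φ‖ ^ 2 : ℝ) : ℂ) ≤ inner ℂ φ (T ⟨φ, h⟩ + T' ⟨φ, h'⟩)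

theorem IsJointPair.symm {T T' : H →ₗ.[ℂ] H} (h : IsJointPair T T') : IsJointPair T' T where
  domain_eq := h.domain_eq.symm
  dense := h.domain_eq ▸ h.dense
  t1 φ ψ := by
    rw [← inner_conj_symm, ← h.t1 ψ φ, inner_conj_symm]
  t2 := by
    obtain ⟨c, hc, h2⟩ := h.t2
    exact ⟨c, hc, fun φ h h' => by rw [add_comm]; exact h2 φ h' h⟩
  t3 := by
    obtain ⟨c, hc, h2⟩ := h.t3
    exact ⟨c, hc, fun φ h h' => by rw [add_comm]; exact h2 φ h' h⟩

variable [CompleteSpace H]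

/-- The graph space `W = dom T₁ = dom T̃₁`, where `T₁ = T'†` and `T̃₁ = T†`. For a joint pair the
two domains are equal (see `IsJointPair.graphSpace_eq`). -/
def graphSpace (T T' : H →ₗ.[ℂ] H) : Submodule ℂ H :=
  T'.adjoint.domain ⊓ T.adjoint.domain

/-- The boundary form `[u | v] = ⟨T₁ u, v⟩ - ⟨u, T̃₁ v⟩` on the graph space. -/
def boundaryForm (T T' : H →ₗ.[ℂ] H) (u v : graphSpace T T') : ℂ :=
  inner ℂ (v : H) (T'.adjoint ⟨u, u.2.1⟩) - inner ℂ (T.adjoint ⟨v, v.2.2⟩) (u : H)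

/-- The complement `S^[⊥] = {u ∈ W : [u | v] = 0 for all v ∈ S}`. -/
def boundaryPerp (T T' : H →ₗ.[ℂ] H) (S : Set H) : Set H :=
  {u | ∃ hu : u ∈ graphSpace T T', ∀ (v : H) (hv : v ∈ graphSpace T T'), v ∈ S →
    boundaryForm T T' ⟨u, hu⟩ ⟨v, hv⟩ = 0}

open scoped ComplexOrder in
/-- The pair of subspaces `(V, V')` of the graph space satisfies the (V)-boundary conditions
related to `(T, T')`. The order on `ℂ` is the usual one: `0 ≤ z` says that `z` is real and
nonnegative. -/
structure VBoundaryConditions (T T' : H →ₗ.[ℂ] H) (V V' : Submodule ℂ H) : Prop where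
  le_graphSpace : V ≤ graphSpace T T'
  le_graphSpace' : V' ≤ graphSpace T T'
  v1 : ∀ (u : H) (hu : u ∈ graphSpace T T'), u ∈ V → 0 ≤ boundaryForm T T' ⟨u, hu⟩ ⟨u, hu⟩
  v1' : ∀ (v : H) (hv : v ∈ graphSpace T T'), v ∈ V' → boundaryForm T T' ⟨v, hv⟩ ⟨v, hv⟩ ≤ 0
  v2 : (V : Set H) = boundaryPerp T T' V'
  v2' : (V' : Set H) = boundaryPerp T T' V

/-- `(T₁|_V, T̃₁|_V')` is a pair of mutually adjoint bijective realisations relative to `(T, T')`: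
the operators lie between the minimal and the maximal ones, are bijections onto `H`, and are
adjoint to each other. -/
structure IsBijectiveRealisationPair (T T' : H →ₗ.[ℂ] H) (V V' : Submodule ℂ H) : Prop where
  le_domain : V ≤ T'.adjoint.domain
  le_domain' : V' ≤ T.adjoint.domain
  closure_le : T.closure ≤ T'.adjoint.domRestrict V
  closure_le' : T'.closure ≤ T.adjoint.domRestrict V'
  bijective : Function.Bijective (T'.adjoint.domRestrict V).toFun
  bijective' : Function.Bijective (T.adjoint.domRestrict V').toFun
  adjoint_eq : (T'.adjoint.domRestrict V).adjoint = T.adjoint.domRestrict V'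
  adjoint_eq' : (T.adjoint.domRestrict V').adjoint = T'.adjoint.domRestrict V

theorem IsJointPair.adjoint_domain_le {T T' : H →ₗ.[ℂ] H} (h : IsJointPair T T') :
    T.adjoint.domain ≤ T'.adjoint.domain := by
  intro y hy
  rw [LinearPMap.mem_adjoint_domain_iff] at hy ⊢
  obtain ⟨c, -, h2⟩ := h.t2
  let e : T'.domain →L[ℂ] T.domain :=
    (Submodule.subtypeL T'.domain).codRestrict T.domain fun x => h.domain_eq.symm.le x.2
  let S : T'.domain →ₗ[ℂ] H := T.toFun.comp e.toLinearMap + T'.toFun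
  have hS : Continuous S :=
    AddMonoidHomClass.continuous_of_bound S c fun φ => h2 φ (e φ).2 φ.2
  have h1 : Continuous fun φ : T'.domain => inner ℂ y (S φ) - inner ℂ y (T (e φ)) :=
    (continuous_const.inner hS).sub (hy.comp e.continuous)
  refine h1.congr fun φ => ?_
  change inner ℂ y (T (e φ) + T' φ) - inner ℂ y (T (e φ)) = inner ℂ y (T' φ)
  rw [inner_add_right, add_sub_cancel_left]

theorem IsJointPair.adjoint_domain_eq {T T' : H →ₗ.[ℂ] H} (h : IsJointPair T T') :
    T.adjoint.domain = T'.adjoint.domain :=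
  le_antisymm h.adjoint_domain_le h.symm.adjoint_domain_le

theorem IsJointPair.graphSpace_eq {T T' : H →ₗ.[ℂ] H} (h : IsJointPair T T') :
    graphSpace T T' = T'.adjoint.domain ∧ graphSpace T T' = T.adjoint.domain := by
  simp [graphSpace, h.adjoint_domain_eq]

end Abstract

/-! ### Weak derivatives on an interval -/

/-- `φ ∈ C_c^∞((a,b); F)`, as a function on `ℝ`. -/
structure IsTestFunction {F : Type*} [NormedAddCommGroup F] [NormedSpace ℝ F] (a b : ℝ)
    (φ : ℝ → F) : Prop where
  smooth : ContDiff ℝ ∞ φ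
  compact : HasCompactSupport φ
  supp : tsupport φ ⊆ Ioo a b

/-- `g` is the distributional derivative of `f` on `(a,b)`, both being integrable there. -/
structure IsWeakDeriv {F : Type*} [NormedAddCommGroup F] [NormedSpace ℂ F] (a b : ℝ)
    (f g : ℝ → F) : Prop where
  integrable : IntegrableOn f (Ioo a b)
  integrable' : IntegrableOn g (Ioo a b)
  eq : ∀ φ : ℝ → ℂ, IsTestFunction a b φ →
    ∫ x in Ioo a b, deriv φ x • f x = -∫ x in Ioo a b, φ x • g x

section TestFunctions

variable {F : Type*} [NormedAddCommGroup F] [NormedSpace ℝ F] {a b : ℝ} {φ ψ : ℝ → F}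

theorem IsTestFunction.zero : IsTestFunction a b (0 : ℝ → F) :=
  ⟨contDiff_const, HasCompactSupport.zero, by simp [tsupport]⟩

theorem IsTestFunction.add (hφ : IsTestFunction a b φ) (hψ : IsTestFunction a b ψ) :
    IsTestFunction a b (φ + ψ) :=
  ⟨hφ.smooth.add hψ.smooth, hφ.compact.add hψ.compact,
    (tsupport_add φ ψ).trans (union_subset hφ.supp hψ.supp)⟩

theorem IsTestFunction.const_smul {F : Type*} [NormedAddCommGroup F] [NormedSpace ℂ F]
    {φ : ℝ → F} (c : ℂ) (hφ : IsTestFunction a b φ) : IsTestFunction a b (c • φ) :=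
  ⟨hφ.smooth.const_smul c, hφ.compact.smul_left (f := fun _ => c),
    (tsupport_smul_subset_right (fun _ => c) φ).trans hφ.supp⟩

theorem IsTestFunction.continuous (hφ : IsTestFunction a b φ) : Continuous φ :=
  hφ.smooth.continuous

theorem IsTestFunction.continuous_deriv (hφ : IsTestFunction a b φ) : Continuous (deriv φ) :=
  hφ.smooth.continuous_deriv (by simp)

theorem IsTestFunction.deriv (hφ : IsTestFunction a b φ) : IsTestFunction a b (deriv φ) :=
  ⟨(contDiff_infty_iff_deriv.1 hφ.smooth).2, hφ.compact.deriv,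
    tsupport_deriv_subset.trans hφ.supp⟩

/-- Integrability of the product of an integrable function and a test function. -/
theorem IsTestFunction.integrable_smul {F : Type*} [NormedAddCommGroup F] [NormedSpace ℂ F]
    {φ : ℝ → ℂ} {f : ℝ → F} (hφ : IsTestFunction a b φ) (hf : IntegrableOn f (Ioo a b)) :
    IntegrableOn (fun x => φ x • f x) (Ioo a b) := by
  obtain ⟨C, hC⟩ := hφ.compact.exists_bound_of_continuous hφ.continuous
  exact Integrable.bdd_smul hf C hφ.continuous.aestronglyMeasurable (Eventually.of_forall hC)

end TestFunctions

section WeakDeriv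

variable {F : Type*} [NormedAddCommGroup F] [NormedSpace ℂ F] {a b : ℝ} {f g f₁ g₁ : ℝ → F}

theorem IsWeakDeriv.zero : IsWeakDeriv a b (0 : ℝ → F) 0 :=
  ⟨integrableOn_zero, integrableOn_zero, by simp⟩

theorem IsWeakDeriv.add (h : IsWeakDeriv a b f g) (h₁ : IsWeakDeriv a b f₁ g₁) :
    IsWeakDeriv a b (f + f₁) (g + g₁) := by
  refine ⟨h.integrable.add h₁.integrable, h.integrable'.add h₁.integrable', fun φ hφ => ?_⟩
  simp only [Pi.add_apply, smul_add]
  rw [integral_add (hφ.deriv.integrable_smul h.integrable)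
      (hφ.deriv.integrable_smul h₁.integrable),
    integral_add (hφ.integrable_smul h.integrable') (hφ.integrable_smul h₁.integrable'),
    h.eq φ hφ, h₁.eq φ hφ, neg_add]

theorem IsWeakDeriv.const_smul (c : ℂ) (h : IsWeakDeriv a b f g) :
    IsWeakDeriv a b (c • f) (c • g) := by
  refine ⟨h.integrable.smul c, h.integrable'.smul c, fun φ hφ => ?_⟩
  simp only [Pi.smul_apply, smul_comm _ c]
  rw [integral_smul, integral_smul, h.eq φ hφ, smul_neg]

/-- The weak derivative is determined almost everywhere. -/
theorem IsWeakDeriv.ae_eq_zero [CompleteSpace F] (h : IsWeakDeriv a b f g)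
    (hf : f =ᵐ[volume.restrict (Ioo a b)] 0) : g =ᵐ[volume.restrict (Ioo a b)] 0 := by
  have key : ∀ᵐ x ∂volume, x ∈ Ioo a b → g x = 0 := by
    refine isOpen_Ioo.ae_eq_zero_of_integral_contDiff_smul_eq_zero
      h.integrable'.locallyIntegrableOn fun η hη hc hs => ?_
    let φ : ℝ → ℂ := fun x => (η x : ℂ)
    have hs' : tsupport φ ⊆ tsupport η :=
      closure_mono fun x hx => by simpa [φ, Function.mem_support] using hx
    have hφ : IsTestFunction a b φ :=
      ⟨Complex.ofRealCLM.contDiff.comp hη, hc.comp_left Complex.ofReal_zero, hs'.trans hs⟩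
    have h0 : ∫ x in Ioo a b, deriv φ x • f x = 0 := by
      refine integral_eq_zero_of_ae (hf.mono fun x hx => ?_)
      simp [hx]
    have h1 := h.eq φ hφ
    rw [h0, eq_comm, neg_eq_zero, setIntegral_eq_integral_of_forall_compl_eq_zero] at h1
    · rw [← h1]
      rfl
    · intro x hx
      have : φ x = 0 := by
        by_contra hne
        exact hx (hφ.supp (subset_tsupport _ hne))
      rw [this, zero_smul]
  exact (ae_restrict_iff' measurableSet_Ioo).2 key

end WeakDeriv

/-! ### The one-dimensional vectorial Friedrichs operator -/

/-- `ℂ^r` with its standard scalar product. -/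
abbrev Cr (r : ℕ) : Type := EuclideanSpace ℂ (Fin r)

/-- `L²((a,b); ℂ^r)`. -/
abbrev L2 (a b : ℝ) (r : ℕ) : Type := Lp (Cr r) 2 (volume.restrict (Ioo a b))

/-- The matrix `M` acting on the vector `v`. -/
abbrev act {r : ℕ} (M : Matrix (Fin r) (Fin r) ℂ) (v : Cr r) : Cr r := Matrix.toEuclideanLin M v

open scoped ComplexOrder in
/-- The standing assumptions on the coefficients: `A ∈ W^{1,∞}((a,b); ℂ^{r×r})` (given by its
continuous representative on `[a,b]`, with weak derivative `A'`), `B ∈ L^∞((a,b); ℂ^{r×r})`,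
`A` is Hermitian on `(a,b)`, and `B + B* + A' ≥ 2 μ₀ 1` almost everywhere on `(a,b)`
for some `μ₀ > 0`. -/
structure IsFriedrichsCoeff {r : ℕ} (a b : ℝ) (A A' B : ℝ → Matrix (Fin r) (Fin r) ℂ) : Prop where
  continuousOn : ContinuousOn A (Icc a b)
  weakDeriv : ∀ i j, IsWeakDeriv a b (fun x => A x i j) (fun x => A' x i j)
  bounded' : ∀ i j, MemLp (fun x => A' x i j) ⊤ (volume.restrict (Ioo a b))
  boundedB : ∀ i j, MemLp (fun x => B x i j) ⊤ (volume.restrict (Ioo a b))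
  hermitian : ∀ x ∈ Ioo a b, (A x).IsHermitian
  positive : ∃ μ₀ : ℝ, 0 < μ₀ ∧ ∀ᵐ x ∂volume.restrict (Ioo a b),
    (B x + (B x).conjTranspose + A' x
      - ((2 * μ₀ : ℝ) : ℂ) • (1 : Matrix (Fin r) (Fin r) ℂ)).PosSemidef

/-- The graph of the operator `φ ↦ s (A φ)' + C φ` from `C_c^∞((a,b); ℂ^r)` to `L²((a,b); ℂ^r)`. -/
def opGraph {r : ℕ} (a b : ℝ) (A : ℝ → Matrix (Fin r) (Fin r) ℂ) (s : ℂ)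
    (C : ℝ → Matrix (Fin r) (Fin r) ℂ) : Submodule ℂ (L2 a b r × L2 a b r) where
  carrier := {p | ∃ φ g : ℝ → Cr r, IsTestFunction a b φ ∧
    IsWeakDeriv a b (fun x => act (A x) (φ x)) g ∧
    p.1 =ᵐ[volume.restrict (Ioo a b)] φ ∧
    p.2 =ᵐ[volume.restrict (Ioo a b)] fun x => s • g x + act (C x) (φ x)}
  zero_mem' := by
    refine ⟨0, 0, IsTestFunction.zero, ?_, Lp.coeFn_zero _ _ _, ?_⟩
    · convert IsWeakDeriv.zero (F := Cr r) (a := a) (b := b) using 1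
      ext1 x
      simp
    · filter_upwards [Lp.coeFn_zero (Cr r) 2 (volume.restrict (Ioo a b))] with x hx
      simpa using hx
  add_mem' := by
    rintro ⟨u, f⟩ ⟨v, k⟩ ⟨φ, g, hφ, hg, hu, hf⟩ ⟨ψ, h, hψ, hh, hv, hk⟩
    refine ⟨φ + ψ, g + h, hφ.add hψ, ?_, ?_, ?_⟩
    · convert hg.add hh using 1
      ext1 x
      simp only [Pi.add_apply, map_add]
    · filter_upwards [Lp.coeFn_add u v, hu, hv] with x h1 h2 h3
      simp only [Prod.mk_add_mk, h1, Pi.add_apply, h2, h3]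
    · filter_upwards [Lp.coeFn_add f k, hf, hk] with x h1 h2 h3
      simp only [Prod.mk_add_mk, h1, Pi.add_apply, h2, h3, map_add, smul_add]
      abel
  smul_mem' := by
    rintro c ⟨u, f⟩ ⟨φ, g, hφ, hg, hu, hf⟩
    refine ⟨c • φ, c • g, hφ.const_smul c, ?_, ?_, ?_⟩
    · convert hg.const_smul c using 1
      ext1 x
      simp only [Pi.smul_apply, map_smul]
    · filter_upwards [Lp.coeFn_smul c u, hu] with x h1 h2
      simp only [Prod.smul_mk, h1, Pi.smul_apply, h2]
    · filter_upwards [Lp.coeFn_smul c f, hf] with x h1 h2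
      simp only [Prod.smul_mk, h1, Pi.smul_apply, h2, map_smul, smul_add, smul_comm s c]

/-- The graph is single valued, so that it really is the graph of an operator. -/
theorem opGraph_snd_eq_zero {r : ℕ} {a b : ℝ} {A : ℝ → Matrix (Fin r) (Fin r) ℂ} {s : ℂ}
    {C : ℝ → Matrix (Fin r) (Fin r) ℂ} (p : L2 a b r × L2 a b r) (hp : p ∈ opGraph a b A s C)
    (h0 : p.1 = 0) : p.2 = 0 := by
  obtain ⟨φ, g, hφ, hg, hu, hf⟩ := hp
  have hφ0 : φ =ᵐ[volume.restrict (Ioo a b)] 0 := by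
    rw [h0] at hu
    exact hu.symm.trans (Lp.coeFn_zero _ _ _)
  have hg0 : g =ᵐ[volume.restrict (Ioo a b)] 0 := by
    refine hg.ae_eq_zero (hφ0.mono fun x hx => ?_)
    simp [hx]
  refine Lp.ext ?_
  filter_upwards [hf, hφ0, hg0, Lp.coeFn_zero (Cr r) 2 (volume.restrict (Ioo a b))]
    with x h1 h2 h3 h4
  rw [h1, h4, h2, h3]
  simp

/-- The operator `φ ↦ s (A φ)' + C φ` with domain `C_c^∞((a,b); ℂ^r)`, as a partially defined
operator in `L²((a,b); ℂ^r)`. -/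
def firstOrderOp {r : ℕ} (a b : ℝ) (A : ℝ → Matrix (Fin r) (Fin r) ℂ) (s : ℂ)
    (C : ℝ → Matrix (Fin r) (Fin r) ℂ) : L2 a b r →ₗ.[ℂ] L2 a b r :=
  (opGraph a b A s C).toLinearPMap

theorem firstOrderOp_graph {r : ℕ} (a b : ℝ) (A : ℝ → Matrix (Fin r) (Fin r) ℂ) (s : ℂ)
    (C : ℝ → Matrix (Fin r) (Fin r) ℂ) : (firstOrderOp a b A s C).graph = opGraph a b A s C :=
  Submodule.toLinearPMap_graph_eq _ opGraph_snd_eq_zero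

/-- Product rule for a scalar coefficient and a test function. -/
theorem IsWeakDeriv.mul_testFunction {a b : ℝ} {f g ψ : ℝ → ℂ} (h : IsWeakDeriv a b f g)
    (hψ : IsTestFunction a b ψ) :
    IsWeakDeriv a b (fun x => ψ x * f x) (fun x => ψ x * g x + deriv ψ x * f x) := by
  have i1 : IntegrableOn (fun x => ψ x * f x) (Ioo a b) := hψ.integrable_smul h.integrable
  have i2 : IntegrableOn (fun x => ψ x * g x) (Ioo a b) := hψ.integrable_smul h.integrable'
  have i3 : IntegrableOn (fun x => deriv ψ x * f x) (Ioo a b) :=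
    hψ.deriv.integrable_smul h.integrable
  refine ⟨i1, i2.add i3, fun φ hφ => ?_⟩
  have hφψ : IsTestFunction a b (fun x => φ x * ψ x) :=
    ⟨hφ.smooth.mul hψ.smooth, hφ.compact.mul_right, (tsupport_mul_subset_left).trans hφ.supp⟩
  have hd : ∀ x, deriv (fun x => φ x * ψ x) x = deriv φ x * ψ x + φ x * deriv ψ x := fun x =>
    deriv_fun_mul (hφ.smooth.differentiable (by simp) x) (hψ.smooth.differentiable (by simp) x)
  have e := h.eq _ hφψ
  have e1 : ∫ x in Ioo a b, deriv (fun x => φ x * ψ x) x • f x =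
      (∫ x in Ioo a b, deriv φ x • (ψ x * f x)) + ∫ x in Ioo a b, φ x • (deriv ψ x * f x) := by
    rw [← integral_add (hφ.deriv.integrable_smul i1) (hφ.integrable_smul i3)]
    refine integral_congr_ae (Eventually.of_forall fun x => ?_)
    simp only [hd, smul_eq_mul]
    ring
  have e2 : ∫ x in Ioo a b, φ x • (ψ x * g x + deriv ψ x * f x) =
      (∫ x in Ioo a b, (φ x * ψ x) • g x) + ∫ x in Ioo a b, φ x • (deriv ψ x * f x) := by
    rw [← integral_add (hφψ.integrable_smul h.integrable') (hφ.integrable_smul i3)]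
    refine integral_congr_ae (Eventually.of_forall fun x => ?_)
    simp only [smul_eq_mul]
    ring
  rw [e2, neg_add, ← e, e1]
  ring

theorem IsWeakDeriv.smul_vector {F : Type*} [NormedAddCommGroup F] [NormedSpace ℂ F]
    [CompleteSpace F] {a b : ℝ}
    {f g : ℝ → ℂ} (h : IsWeakDeriv a b f g) (e : F) :
    IsWeakDeriv a b (fun x => f x • e) (fun x => g x • e) := by
  refine ⟨h.integrable.smul_const e, h.integrable'.smul_const e, fun φ hφ => ?_⟩
  have e1 := h.eq φ hφ
  simp only [← smul_assoc]
  rw [integral_smul_const, integral_smul_const, e1, neg_smul]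

theorem IsWeakDeriv.sum {ι F : Type*} [NormedAddCommGroup F] [NormedSpace ℂ F] {a b : ℝ}
    (s : Finset ι) {f g : ι → ℝ → F} (h : ∀ i ∈ s, IsWeakDeriv a b (f i) (g i)) :
    IsWeakDeriv a b (∑ i ∈ s, f i) (∑ i ∈ s, g i) := by
  classical
  induction s using Finset.induction_on with
  | empty => exact IsWeakDeriv.zero
  | insert i s hi ih =>
    rw [Finset.sum_insert hi, Finset.sum_insert hi]
    exact (h i (Finset.mem_insert_self i s)).add
      (ih fun j hj => h j (Finset.mem_insert_of_mem hj))

theorem act_eq_sum {r : ℕ} (M : Matrix (Fin r) (Fin r) ℂ) (v : Cr r) :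
    act M v = ∑ i, ∑ j, (v j * M i j) • EuclideanSpace.single i (1 : ℂ) := by
  ext k
  simp [Matrix.toLpLin_apply, Matrix.mulVec, dotProduct, Finset.sum_apply, Pi.single_apply,
    mul_comm]

theorem deriv_coord {r : ℕ} {a b : ℝ} {φ : ℝ → Cr r} (hφ : IsTestFunction a b φ) (j : Fin r)
    (x : ℝ) : deriv (fun y => φ y j) x = deriv φ x j :=
  (((EuclideanSpace.proj j : Cr r →L[ℂ] ℂ).restrictScalars ℝ).hasFDerivAt.comp_hasDerivAt x
    (hφ.smooth.differentiable (by simp) x).hasDerivAt).deriv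

theorem IsTestFunction.coord {r : ℕ} {a b : ℝ} {φ : ℝ → Cr r} (hφ : IsTestFunction a b φ)
    (j : Fin r) : IsTestFunction a b (fun y => φ y j) :=
  ⟨((EuclideanSpace.proj j : Cr r →L[ℂ] ℂ).restrictScalars ℝ).contDiff.comp hφ.smooth,
    hφ.compact.comp_left (g := fun v : Cr r => v j) rfl,
    (tsupport_comp_subset (g := fun v : Cr r => v j) rfl φ).trans hφ.supp⟩

/-- On test functions, `(A φ)' = A' φ + A φ'`. -/
theorem IsFriedrichsCoeff.isWeakDeriv_act {r : ℕ} {a b : ℝ} {A A' B : ℝ → Matrix (Fin r) (Fin r) ℂ}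
    (h : IsFriedrichsCoeff a b A A' B) {φ : ℝ → Cr r} (hφ : IsTestFunction a b φ) :
    IsWeakDeriv a b (fun x => act (A x) (φ x))
      (fun x => act (A' x) (φ x) + act (A x) (deriv φ x)) := by
  have key := IsWeakDeriv.sum Finset.univ fun (i : Fin r) _ =>
    IsWeakDeriv.sum Finset.univ fun (j : Fin r) _ =>
      ((h.weakDeriv i j).mul_testFunction (hφ.coord j)).smul_vector
        (EuclideanSpace.single i (1 : ℂ) : Cr r)
  convert key using 1
  · ext1 x
    simp only [Finset.sum_apply, act_eq_sum]
  · ext1 x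
    simp only [Finset.sum_apply, act_eq_sum, deriv_coord hφ, add_smul, Finset.sum_add_distrib]

theorem memLp_act {r : ℕ} {a b : ℝ} {M : ℝ → Matrix (Fin r) (Fin r) ℂ}
    (hM : ∀ i j, MemLp (fun x => M x i j) ⊤ (volume.restrict (Ioo a b))) {φ : ℝ → Cr r}
    (hφ : IsTestFunction a b φ) :
    MemLp (fun x => act (M x) (φ x)) 2 (volume.restrict (Ioo a b)) := by
  simp only [act_eq_sum]
  refine memLp_finsetSum _ fun i _ => memLp_finsetSum _ fun j _ => ?_
  have h1 : MemLp (fun x => φ x j) 2 (volume.restrict (Ioo a b)) :=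
    ((hφ.coord j).continuous.memLp_of_hasCompactSupport (hφ.coord j).compact).restrict _
  have h2 : MemLp (fun x => φ x j * M x i j) 2 (volume.restrict (Ioo a b)) :=
    (hM i j).mul h1
  exact (ContinuousLinearMap.toSpanSingleton ℂ
    (EuclideanSpace.single i (1 : ℂ) : Cr r)).comp_memLp' h2

/-- The domain of the operators consists of (the classes of) all test functions. -/
theorem IsFriedrichsCoeff.mem_opGraph_fst {r : ℕ} {a b : ℝ}
    {A A' B : ℝ → Matrix (Fin r) (Fin r) ℂ} (h : IsFriedrichsCoeff a b A A' B) (s : ℂ)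
    {C : ℝ → Matrix (Fin r) (Fin r) ℂ}
    (hC : ∀ i j, MemLp (fun x => C x i j) ⊤ (volume.restrict (Ioo a b)))
    {φ : ℝ → Cr r} (hφ : IsTestFunction a b φ) (u : L2 a b r)
    (hu : u =ᵐ[volume.restrict (Ioo a b)] φ) : u ∈ (firstOrderOp a b A s C).domain := by
  have hA : ∀ i j, MemLp (fun x => A x i j) ⊤ (volume.restrict (Ioo a b)) := fun i j => by
    have hc : ContinuousOn (fun x => A x i j) (Icc a b) :=
      (continuous_apply_apply i j).comp_continuousOn h.continuousOn
    obtain ⟨K, hK⟩ := isCompact_Icc.exists_bound_of_continuousOn hc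
    exact memLp_top_of_bound (h.weakDeriv i j).integrable.aestronglyMeasurable K
      ((ae_restrict_iff' measurableSet_Ioo).2 (Eventually.of_forall fun x hx =>
        hK x (Ioo_subset_Icc_self hx)))
  have hm : MemLp (fun x => s • (act (A' x) (φ x) + act (A x) (deriv φ x)) + act (C x) (φ x)) 2
      (volume.restrict (Ioo a b)) :=
    (((memLp_act h.bounded' hφ).add (memLp_act hA hφ.deriv)).const_smul s).add (memLp_act hC hφ)
  exact ⟨(u, hm.toLp _), ⟨φ, _, hφ, h.isWeakDeriv_act hφ, hu, hm.coeFn_toLp⟩, rfl⟩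

/-- `T u = (A u)' + B u` on `C_c^∞((a,b); ℂ^r)`. -/
def opT {r : ℕ} (a b : ℝ) (A B : ℝ → Matrix (Fin r) (Fin r) ℂ) : L2 a b r →ₗ.[ℂ] L2 a b r :=
  firstOrderOp a b A 1 B

/-- `T̃ u = -(A u)' + (B* + A') u` on `C_c^∞((a,b); ℂ^r)`. -/
def opT' {r : ℕ} (a b : ℝ) (A A' B : ℝ → Matrix (Fin r) (Fin r) ℂ) :
    L2 a b r →ₗ.[ℂ] L2 a b r :=
  firstOrderOp a b A (-1) fun x => (B x).conjTranspose + A' x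

/-! ### Total projections and evaluation at a point -/

/-- `μ` is an eigenvalue of the matrix `M`. -/
def IsEigenvalue {r : ℕ} (M : Matrix (Fin r) (Fin r) ℂ) (μ : ℝ) : Prop :=
  Module.End.HasEigenvalue (Matrix.toEuclideanLin M) (μ : ℂ)

/-- The `λ`-group: those eigenvalues of `A x` which are nearer to the eigenvalue `l` of `A x₀` than
to any other eigenvalue of `A x₀`. For `x` close to `x₀` these are the eigenvalues of `A x` into
which `l` splits, i.e. those inside a small circle around `l`. -/
def eigenGroup {r : ℕ} (A : ℝ → Matrix (Fin r) (Fin r) ℂ) (x₀ l x : ℝ) : Set ℝ :=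
  {μ | IsEigenvalue (A x) μ ∧ ∀ l', IsEigenvalue (A x₀) l' → l' ≠ l → |μ - l| < |μ - l'|}

/-- The total projection `P_λ(x)`: the sum of the (orthogonal) eigenprojections of `A x` over the
`λ`-group. -/
def totalProj {r : ℕ} (A : ℝ → Matrix (Fin r) (Fin r) ℂ) (x₀ l x : ℝ) : Cr r →L[ℂ] Cr r :=
  ∑ᶠ μ ∈ eigenGroup A x₀ l x,
    (Module.End.eigenspace (Matrix.toEuclideanLin (A x)) (μ : ℂ)).starProjection

/-- `(P_λ u)(x₀) = w`: on some neighbourhood `[a,b] ∩ [x₀-ε, x₀+ε]` of `x₀`, the function `P_λ u`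
has a continuous representative, and its value at `x₀` is `w`. -/
def HasProjValue {r : ℕ} (a b : ℝ) (A : ℝ → Matrix (Fin r) (Fin r) ℂ) (l x₀ : ℝ) (u : ℝ → Cr r)
    (w : Cr r) : Prop :=
  ∃ ε > 0, ∃ g : ℝ → Cr r, ContinuousOn g (Icc a b ∩ Icc (x₀ - ε) (x₀ + ε)) ∧
    (∀ᵐ x ∂volume.restrict (Icc a b ∩ Icc (x₀ - ε) (x₀ + ε)), totalProj A x₀ l x (u x) = g x) ∧
    g x₀ = w

section ProjValue

variable {r : ℕ} {a b : ℝ} {A : ℝ → Matrix (Fin r) (Fin r) ℂ} {l x₀ : ℝ} {u v u₁ : ℝ → Cr r}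
  {w w₁ : Cr r}

theorem HasProjValue.congr (h : HasProjValue a b A l x₀ u w)
    (huv : u =ᵐ[volume.restrict (Ioo a b)] v) : HasProjValue a b A l x₀ v w := by
  obtain ⟨ε, hε, g, hg, hgu, hw⟩ := h
  refine ⟨ε, hε, g, hg, ?_, hw⟩
  rw [Measure.restrict_congr_set Ioo_ae_eq_Icc] at huv
  filter_upwards [hgu, ae_restrict_of_ae_restrict_of_subset inter_subset_left huv] with x h1 h2
  rw [← h2, h1]

theorem HasProjValue.zero : HasProjValue a b A l x₀ (0 : ℝ → Cr r) 0 :=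
  ⟨1, one_pos, 0, continuousOn_const, by simp, rfl⟩

theorem HasProjValue.add (h : HasProjValue a b A l x₀ u w) (h₁ : HasProjValue a b A l x₀ u₁ w₁) :
    HasProjValue a b A l x₀ (u + u₁) (w + w₁) := by
  obtain ⟨ε, hε, g, hg, hgu, hw⟩ := h
  obtain ⟨ε₁, hε₁, g₁, hg₁, hgu₁, hw₁⟩ := h₁
  have s : Icc a b ∩ Icc (x₀ - min ε ε₁) (x₀ + min ε ε₁) ⊆ Icc a b ∩ Icc (x₀ - ε) (x₀ + ε) :=
    inter_subset_inter_right _ (Icc_subset_Icc (by linarith [min_le_left ε ε₁])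
      (by linarith [min_le_left ε ε₁]))
  have s₁ : Icc a b ∩ Icc (x₀ - min ε ε₁) (x₀ + min ε ε₁) ⊆ Icc a b ∩ Icc (x₀ - ε₁) (x₀ + ε₁) :=
    inter_subset_inter_right _ (Icc_subset_Icc (by linarith [min_le_right ε ε₁])
      (by linarith [min_le_right ε ε₁]))
  refine ⟨min ε ε₁, lt_min hε hε₁, g + g₁, (hg.mono s).add (hg₁.mono s₁), ?_, by simp [hw, hw₁]⟩
  filter_upwards [ae_restrict_of_ae_restrict_of_subset s hgu,
    ae_restrict_of_ae_restrict_of_subset s₁ hgu₁] with x h1 h2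
  simp [h1, h2]

theorem HasProjValue.const_smul (c : ℂ) (h : HasProjValue a b A l x₀ u w) :
    HasProjValue a b A l x₀ (c • u) (c • w) := by
  obtain ⟨ε, hε, g, hg, hgu, hw⟩ := h
  refine ⟨ε, hε, c • g, hg.const_smul c, ?_, by simp [hw]⟩
  filter_upwards [hgu] with x h1
  simp [h1]

end ProjValue

/-- `{u ∈ L²((a,b); ℂ^r) : (P_λ u)(x₀) = 0}`. -/
def vanishing {r : ℕ} (a b : ℝ) (A : ℝ → Matrix (Fin r) (Fin r) ℂ) (l x₀ : ℝ) :
    Submodule ℂ (L2 a b r) where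
  carrier := {u | HasProjValue a b A l x₀ u 0}
  zero_mem' := HasProjValue.zero.congr (Lp.coeFn_zero _ _ _).symm
  add_mem' {u v} hu hv := by
    have h := HasProjValue.add hu hv
    rw [add_zero] at h
    exact h.congr (Lp.coeFn_add u v).symm
  smul_mem' c u hu := by
    have h := HasProjValue.const_smul c hu
    rw [smul_zero] at h
    exact h.congr (Lp.coeFn_smul c u).symm

/-- `V`: the `u ∈ W` with `(P_λ u)(a) = 0` for all eigenvalues `λ > 0` of `A(a)` and
`(P_λ u)(b) = 0` for all eigenvalues `λ < 0` of `A(b)`. -/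
def spaceV {r : ℕ} (a b : ℝ) (A A' B : ℝ → Matrix (Fin r) (Fin r) ℂ) : Submodule ℂ (L2 a b r) :=
  graphSpace (opT a b A B) (opT' a b A A' B)
    ⊓ (⨅ (l : ℝ) (_ : IsEigenvalue (A a) l) (_ : 0 < l), vanishing a b A l a)
    ⊓ (⨅ (l : ℝ) (_ : IsEigenvalue (A b) l) (_ : l < 0), vanishing a b A l b)

/-- `Ṽ`: the `u ∈ W` with `(P_λ u)(a) = 0` for all eigenvalues `λ < 0` of `A(a)` and
`(P_λ u)(b) = 0` for all eigenvalues `λ > 0` of `A(b)`. -/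
def spaceV' {r : ℕ} (a b : ℝ) (A A' B : ℝ → Matrix (Fin r) (Fin r) ℂ) : Submodule ℂ (L2 a b r) :=
  graphSpace (opT a b A B) (opT' a b A A' B)
    ⊓ (⨅ (l : ℝ) (_ : IsEigenvalue (A a) l) (_ : l < 0), vanishing a b A l a)
    ⊓ (⨅ (l : ℝ) (_ : IsEigenvalue (A b) l) (_ : 0 < l), vanishing a b A l b)

end Friedrichs

end

/-! The proof has an abstract half and a concrete half.

Abstractly, T + T̃ extends to a bounded symmetric coercive operator K on H, and T₁ + T̃₁ = K on the
graph space W (`exists_sum_extension`). Hence the boundary form is Hermitian. Under (V1), Re⟨T₁u, u⟩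
≥ μ‖u‖² on V, and likewise for T̃₁ on Ṽ; under (V2), the adjoint of T₁|_V is T̃₁|_Ṽ. Each
restriction is then closed, bounded below, and has an adjoint with trivial kernel, hence is
bijective. What remains is to prove the (V)-conditions.

Concretely, u ∈ W means that Au has a weak derivative in L². Where A is singular u itself need not
be regular, so only Au has endpoint values. Two facts make these usable: they lie in the range of
A(a) and A(b) (`IsGraphFunction.exists_trace`), say A(a)t and A(b)s, and the boundary form is
⟨A(b)s₁, s₂⟩ − ⟨A(a)t₁, t₂⟩ (`boundaryForm_eq_traces`). Since u and v cannot be differentiated,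
integration by parts is done with difference quotients: in `integral_difference_quotient` only Au,
Av and A are differenced, and what survives are integrals over layers of width h at the endpoints.
Their means converge because A is Lipschitz (`IsGraphFunction.tendsto_mean`).

Near x₀ one has P_λ(x) = R(x)A(x) with R continuous (`exists_reducedInverse`), where R = ρ(A) for a
continuous ρ equal to 1/t near λ and 0 near the other eigenvalues of A(x₀). So P_λu = R(Au) is
continuous, and its value at x₀ is the eigenprojection of the trace. Membership in V or Ṽ becomes
orthogonality of t and s to the eigenvectors of one sign. Then (V1) and the orthogonality half of
(V2) follow by diagonalising A(a) and A(b); the other half of (V2) by testing with affine functions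
that carry an eigenvector at one endpoint and 0 at the other (`eq_boundaryPerp`). -/

noncomputable section

namespace Friedrichs

/-! ### Abstract theory: the (V)-conditions imply mutually adjoint bijective realisations. -/

section AbstractTheory

variable {H : Type*} [NormedAddCommGroup H] [InnerProductSpace ℂ H] {T T' : H →ₗ.[ℂ] H}

theorem IsJointPair.dense' (h : IsJointPair T T') : Dense (T'.domain : Set H) :=
  h.symm.dense

variable [CompleteSpace H]

theorem IsJointPair.mem_graphSpace_iff (h : IsJointPair T T') {u : H} :
    u ∈ graphSpace T T' ↔ u ∈ T'.adjoint.domain := by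
  rw [h.graphSpace_eq.1]

open scoped ComplexOrder in
/-- The bounded self-adjoint, coercive extension of `T + T̃`, which on the graph space coincides
with `T₁ + T̃₁`. -/
theorem IsJointPair.exists_sum_extension (h : IsJointPair T T') :
    ∃ K : H →L[ℂ] H, (∀ x y, inner ℂ (K x) y = inner ℂ x (K y)) ∧
      (∀ (u : H) (h₁ : u ∈ T'.adjoint.domain) (h₂ : u ∈ T.adjoint.domain),
        T'.adjoint ⟨u, h₁⟩ + T.adjoint ⟨u, h₂⟩ = K u) ∧
      ∃ μ : ℝ, 0 < μ ∧ ∀ x, 2 * μ * ‖x‖ ^ 2 ≤ (inner ℂ x (K x)).re := by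
  obtain ⟨c, -, h2⟩ := h.t2
  obtain ⟨μ, hμ, h3⟩ := h.t3
  let e : T.domain →ₗ[ℂ] T'.domain := Submodule.inclusion h.domain_eq.le
  let C : T.domain →L[ℂ] H :=
    (T.toFun + T'.toFun.comp e).mkContinuous c fun φ => h2 φ φ.2 (e φ).2
  let K : H →L[ℂ] H := C.extend (Submodule.subtypeL T.domain)
  have hK : ∀ φ : T.domain, K φ = T φ + T' (e φ) := fun φ =>
    ContinuousLinearMap.extend_eq _ h.dense.denseRange_val
      isUniformEmbedding_subtype_val.isUniformInducing φ
  have hsymm : ∀ x y, inner ℂ (K x) y = inner ℂ x (K y) := by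
    have hx : ∀ (x : T.domain) (y : H), inner ℂ (K x) y = inner ℂ (x : H) (K y) := by
      intro x y
      refine congrFun (Continuous.ext_on (f := fun y => inner ℂ (K x) y)
        (g := fun y => inner ℂ (x : H) (K y)) h.dense (by fun_prop) (by fun_prop)
        fun y hy => ?_) y
      have e1 := h.t1 ⟨y, hy⟩ (e x)
      have e2 := h.symm.t1 (e ⟨y, hy⟩) x
      change inner ℂ (K x) y = inner ℂ (x : H) (K (⟨y, hy⟩ : T.domain))
      rw [hK, hK, inner_add_left, inner_add_right]
      change inner ℂ (x : H) (T _) = _ at e1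
      change inner ℂ (x : H) (T' _) = inner ℂ _ y at e2
      rw [e1, e2, add_comm]
    intro x y
    exact congrFun (Continuous.ext_on (f := fun x => inner ℂ (K x) y)
        (g := fun x => inner ℂ (x : H) (K y)) h.dense (by fun_prop) (by fun_prop)
        fun x hx' => hx ⟨x, hx'⟩ y) x
  refine ⟨K, hsymm, fun u h₁ h₂ => ?_, μ, hμ, fun x => ?_⟩
  -- Paired with φ ∈ dom T, the left side is ⟨u, (T + T̃)φ⟩ = ⟨u, Kφ⟩.
  · refine h.dense.eq_of_inner_left ℂ fun φ hφ => ?_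
    have e1 := LinearPMap.adjoint_isFormalAdjoint h.dense ⟨u, h₂⟩ ⟨φ, hφ⟩
    have e2 := LinearPMap.adjoint_isFormalAdjoint h.dense' ⟨u, h₁⟩ (e ⟨φ, hφ⟩)
    change inner ℂ _ φ = inner ℂ u _ at e1
    change inner ℂ _ φ = inner ℂ u _ at e2
    have e3 := hK ⟨φ, hφ⟩
    rw [inner_add_left, e1, e2, hsymm, e3, inner_add_right, add_comm]
  · have hcl : IsClosed {x : H | 2 * μ * ‖x‖ ^ 2 ≤ (inner ℂ x (K x)).re} :=
      isClosed_le (by fun_prop) (Complex.continuous_re.comp (by fun_prop))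
    have : closure (T.domain : Set H) ⊆ {x : H | 2 * μ * ‖x‖ ^ 2 ≤ (inner ℂ x (K x)).re} := by
      refine hcl.closure_subset_iff.2 fun φ hφ => ?_
      have h4 := (Complex.le_def.1 (h3 φ hφ (h.domain_eq.le hφ))).1
      rw [Complex.ofReal_re] at h4
      have e3 := hK ⟨φ, hφ⟩
      change 2 * μ * ‖φ‖ ^ 2 ≤ (inner ℂ φ (K φ)).re
      rw [e3]
      exact h4
    exact this (h.dense x)

/-- Substituting T̃₁ = K − T₁ gives [u | v] = ⟨T₁u, v⟩ + ⟨u, T₁v⟩ − ⟨u, Kv⟩, which is visibly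
Hermitian because K is symmetric. -/
theorem IsJointPair.boundaryForm_conj (h : IsJointPair T T') (u v : graphSpace T T') :
    starRingEnd ℂ (boundaryForm T T' u v) = boundaryForm T T' v u := by
  obtain ⟨K, hK, hs, -⟩ := h.exists_sum_extension
  have hu := hs u u.2.1 u.2.2
  have hv := hs v v.2.1 v.2.2
  have e1 := eq_sub_of_add_eq' hu
  have e2 := eq_sub_of_add_eq' hv
  unfold boundaryForm
  rw [e1, e2, map_sub, inner_conj_symm, inner_conj_symm, inner_sub_left, inner_sub_right, hK]
  ring

/-- Here T₁u = Tu, and ⟨Tu, v⟩ = ⟨u, T*v⟩ by definition of the adjoint. Consequently every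
complement S^[⊥], in particular V, contains dom T. -/
theorem IsJointPair.boundaryForm_of_mem_domain (h : IsJointPair T T') (u v : graphSpace T T')
    (hu : (u : H) ∈ T.domain) : boundaryForm T T' u v = 0 := by
  have e1 : T'.adjoint ⟨u, u.2.1⟩ = T ⟨u, hu⟩ :=
    LinearPMap.adjoint_apply_eq h.dense' _ fun x => by
      have := h.t1 ⟨u, hu⟩ x
      rw [← inner_conj_symm, this, inner_conj_symm]
  have e2 := LinearPMap.adjoint_isFormalAdjoint h.dense ⟨v, v.2.2⟩ ⟨u, hu⟩
  unfold boundaryForm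
  rw [e1, e2, sub_self]

theorem IsJointPair.domain_le_graphSpace (h : IsJointPair T T') :
    T.domain ≤ graphSpace T T' := fun φ hφ =>
  h.mem_graphSpace_iff.2 <| LinearPMap.mem_adjoint_domain_of_exists _
    ⟨T ⟨φ, hφ⟩, fun x => by
      have := h.t1 ⟨φ, hφ⟩ x
      rw [← inner_conj_symm, this, inner_conj_symm]⟩

theorem IsJointPair.le_adjoint (h : IsJointPair T T') : T ≤ T'.adjoint :=
  LinearPMap.IsFormalAdjoint.le_adjoint h.dense' fun x y => (h.t1 y x).symm

variable {V V' : Submodule ℂ H}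

theorem VBoundaryConditions.domain_le (hV : VBoundaryConditions T T' V V')
    (h : IsJointPair T T') : T.domain ≤ V := fun φ hφ => by
  have : φ ∈ (V : Set H) := by
    rw [hV.v2]
    exact ⟨h.domain_le_graphSpace hφ, fun v hv _ =>
      h.boundaryForm_of_mem_domain ⟨φ, _⟩ ⟨v, hv⟩ hφ⟩
  exact this

theorem domRestrict_apply_mem {E : Type*} [NormedAddCommGroup E] [InnerProductSpace ℂ E]
    (g : E →ₗ.[ℂ] E) (S : Submodule ℂ E) (y : (g.domRestrict S).domain)
    (hy : (y : E) ∈ g.domain) : g.domRestrict S y = g ⟨y, hy⟩ :=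
  LinearPMap.domRestrict_apply (x := y) (y := ⟨y, hy⟩) rfl

theorem le_domRestrict {f g : H →ₗ.[ℂ] H} {S : Submodule ℂ H} (hfg : f ≤ g) (hS : f.domain ≤ S) :
    f ≤ g.domRestrict S :=
  ⟨fun x hx => ⟨hS hx, hfg.1 hx⟩, fun x y hxy => by
    rw [domRestrict_apply_mem g S y y.2.2]
    exact hfg.2 hxy⟩

/-- The adjoint of `T₁|_V` is `T̃₁|_Ṽ`. -/
theorem VBoundaryConditions.adjoint_eq (hV : VBoundaryConditions T T' V V')
    (h : IsJointPair T T') :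
    (T'.adjoint.domRestrict V).adjoint = T.adjoint.domRestrict V' := by
  have hle : T ≤ T'.adjoint.domRestrict V := le_domRestrict h.le_adjoint (hV.domain_le h)
  have hd : Dense ((T'.adjoint.domRestrict V).domain : Set H) := h.dense.mono hle.1
  have hz : ∀ (u v : H) (hu : u ∈ graphSpace T T') (hv : v ∈ graphSpace T T'),
      u ∈ V → v ∈ V' → boundaryForm T T' ⟨u, hu⟩ ⟨v, hv⟩ = 0 := by
    intro u v hu hv huV hvV
    have : u ∈ (V : Set H) := huV
    rw [hV.v2] at this
    exact this.2 v hv hvV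
  refine le_antisymm ?_ ?_
  -- Adjoints reverse the inclusion T ⊆ T₁|_V, so the adjoint of T₁|_V is a restriction of T* = T̃₁.
  · have key : ∀ y (hy : y ∈ (T'.adjoint.domRestrict V).adjoint.domain),
        ∃ hy' : y ∈ T.adjoint.domain,
          (T'.adjoint.domRestrict V).adjoint ⟨y, hy⟩ = T.adjoint ⟨y, hy'⟩ := by
      intro y hy
      have e : ∀ x : T.domain, inner ℂ ((T'.adjoint.domRestrict V).adjoint ⟨y, hy⟩) (x : H)
          = inner ℂ y (T x) := fun x => by
        have := LinearPMap.adjoint_isFormalAdjoint hd ⟨y, hy⟩ ⟨x, hle.1 x.2⟩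
        rwa [← hle.2 (x := x) (y := ⟨x, hle.1 x.2⟩) rfl] at this
      have hy' : y ∈ T.adjoint.domain := LinearPMap.mem_adjoint_domain_of_exists _ ⟨_, e⟩
      exact ⟨hy', (LinearPMap.adjoint_apply_eq h.dense ⟨y, hy'⟩ e).symm⟩
    -- The adjoint relation ⟨T₁u, y⟩ = ⟨u, T̃₁y⟩ for u ∈ V says precisely that y ∈ V^[⊥] = Ṽ.
    have hyV : ∀ y (hy : y ∈ (T'.adjoint.domRestrict V).adjoint.domain), y ∈ V' := by
      intro y hy
      obtain ⟨hy', hyy⟩ := key y hy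
      have hyW : y ∈ graphSpace T T' := by rw [h.graphSpace_eq.2]; exact hy'
      have : y ∈ (V' : Set H) := by
        rw [hV.v2']
        refine ⟨hyW, fun u hu huV => ?_⟩
        rw [← h.boundaryForm_conj, map_eq_zero]
        have e1 := LinearPMap.adjoint_isFormalAdjoint hd ⟨y, hy⟩ ⟨u, huV, hu.1⟩
        rw [hyy, domRestrict_apply_mem _ _ _ hu.1] at e1
        unfold boundaryForm
        rw [sub_eq_zero]
        exact e1.symm
      exact this
    refine ⟨fun y hy => ⟨hyV y hy, (key y hy).1⟩, fun x y hxy => ?_⟩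
    rw [domRestrict_apply_mem _ _ y y.2.2]
    obtain ⟨hy', hyy⟩ := key x x.2
    rw [hyy]
    congr 1
    exact Subtype.ext hxy
  · refine LinearPMap.IsFormalAdjoint.le_adjoint hd fun u y => ?_
    rw [domRestrict_apply_mem _ _ y y.2.2, domRestrict_apply_mem _ _ u u.2.2]
    have e := hz u y (hV.le_graphSpace u.2.1) (hV.le_graphSpace' y.2.1) u.2.1 y.2.1
    unfold boundaryForm at e
    rw [sub_eq_zero] at e
    rw [← inner_conj_symm, e, inner_conj_symm]

open scoped ComplexOrder in
/-- The (V)-conditions for `(T, T̃)` and `(V, Ṽ)` are those for `(T̃, T)` and `(Ṽ, V)`. -/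
theorem VBoundaryConditions.symm (hV : VBoundaryConditions T T' V V') (h : IsJointPair T T') :
    VBoundaryConditions T' T V' V := by
  have hg : graphSpace T' T = graphSpace T T' := inf_comm _ _
  -- Exchanging T and T̃ negates the Hermitian form: the signs in (V1) swap while all complements
  -- stay the same.
  have hb : ∀ (u v : H) (hu : u ∈ graphSpace T' T) (hv : v ∈ graphSpace T' T),
      boundaryForm T' T ⟨u, hu⟩ ⟨v, hv⟩ = -boundaryForm T T' ⟨u, hg ▸ hu⟩ ⟨v, hg ▸ hv⟩ := by
    intro u v hu hv
    rw [← h.boundaryForm_conj, boundaryForm, boundaryForm, map_sub, inner_conj_symm,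
      inner_conj_symm]
    ring
  have hp : ∀ S : Set H, boundaryPerp T' T S = boundaryPerp T T' S := by
    intro S
    ext u
    constructor
    · rintro ⟨hu, h1⟩
      refine ⟨hg ▸ hu, fun v hv hvS => ?_⟩
      have := h1 v (hg.symm ▸ hv) hvS
      rwa [hb, neg_eq_zero] at this
    · rintro ⟨hu, h1⟩
      refine ⟨hg.symm ▸ hu, fun v hv hvS => ?_⟩
      rw [hb, neg_eq_zero]
      exact h1 v (hg ▸ hv) hvS
  exact
  { le_graphSpace := hg ▸ hV.le_graphSpace'
    le_graphSpace' := hg ▸ hV.le_graphSpace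
    v1 := fun u hu huV => by
      rw [hb, neg_nonneg]
      exact hV.v1' u _ huV
    v1' := fun u hu huV => by
      rw [hb, neg_nonpos]
      exact hV.v1 u _ huV
    v2 := by rw [hp]; exact hV.v2'
    v2' := by rw [hp]; exact hV.v2 }

open scoped ComplexOrder in
/-- `T₁|_V` is bounded below. -/
theorem VBoundaryConditions.exists_norm_le (hV : VBoundaryConditions T T' V V')
    (h : IsJointPair T T') : ∃ μ : ℝ, 0 < μ ∧ ∀ u : (T'.adjoint.domRestrict V).domain,
      μ * ‖(u : H)‖ ≤ ‖T'.adjoint.domRestrict V u‖ := by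
  obtain ⟨K, -, hs, μ, hμ, hpos⟩ := h.exists_sum_extension
  -- By (V1), Re⟨T₁u, u⟩ ≥ Re⟨T̃₁u, u⟩, and the two add up to ⟨Ku, u⟩ ≥ 2μ‖u‖². So the first is at
  -- least μ‖u‖², and Cauchy–Schwarz removes one factor ‖u‖.
  refine ⟨μ, hμ, fun u => ?_⟩
  have hu : (u : H) ∈ graphSpace T T' := hV.le_graphSpace u.2.1
  rw [domRestrict_apply_mem _ _ u hu.1]
  have e1 := hs u hu.1 hu.2
  have e2 := (Complex.le_def.1 (hV.v1 u hu u.2.1)).1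
  have e3 := hpos u
  unfold boundaryForm at e2
  rw [← e1, inner_add_right, Complex.add_re] at e3
  have e4 : (inner ℂ (T.adjoint ⟨u, hu.2⟩) (u : H)).re
      = (inner ℂ (u : H) (T.adjoint ⟨u, hu.2⟩)).re := by
    rw [← inner_conj_symm, Complex.conj_re]
  rw [Complex.sub_re, Complex.zero_re] at e2
  rcases (norm_nonneg (u : H)).eq_or_lt with h0 | h0
  · rw [← h0, mul_zero]; positivity
  · have e5 : (inner ℂ (u : H) (T'.adjoint ⟨u, hu.1⟩)).re
        ≤ ‖(u : H)‖ * ‖T'.adjoint ⟨u, hu.1⟩‖ :=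
      (Complex.re_le_norm _).trans (norm_inner_le_norm _ _)
    change 0 ≤ (inner ℂ (u : H) (T'.adjoint ⟨u, hu.1⟩)).re
      - (inner ℂ (T.adjoint ⟨u, hu.2⟩) (u : H)).re at e2
    nlinarith

/-- The lower bound gives injectivity and, with closedness, closed range. The orthogonal complement
of the range is the kernel of the adjoint T̃₁|_Ṽ, which is trivial by the lower bound for the
swapped pair. -/
theorem VBoundaryConditions.bijective (hV : VBoundaryConditions T T' V V')
    (h : IsJointPair T T') : Function.Bijective (T'.adjoint.domRestrict V).toFun := by
  obtain ⟨μ, hμ, hb⟩ := hV.exists_norm_le h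
  obtain ⟨μ', hμ', hb'⟩ := (hV.symm h).exists_norm_le h.symm
  have hadj := hV.adjoint_eq h
  have hadj' := (hV.symm h).adjoint_eq h.symm
  set S := T'.adjoint.domRestrict V with hS
  have hle : T ≤ S := le_domRestrict h.le_adjoint (hV.domain_le h)
  have hle' : T' ≤ T.adjoint.domRestrict V' :=
    le_domRestrict h.symm.le_adjoint ((hV.symm h).domain_le h.symm)
  have hd : Dense (S.domain : Set H) := h.dense.mono hle.1
  -- By the swapped pair, T₁|_V is itself an adjoint.
  have hcl : S.IsClosed := by
    rw [← hadj']
    exact LinearPMap.adjoint_isClosed (h.dense'.mono hle'.1)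
  have hinj : Function.Injective S.toFun := by
    refine (injective_iff_map_eq_zero _).2 fun u hu => ?_
    have := hb u
    rw [show S u = 0 from hu, norm_zero] at this
    have h0 : ‖(u : H)‖ = 0 := le_antisymm (by nlinarith) (norm_nonneg _)
    exact Subtype.ext (norm_eq_zero.1 h0)
  have hran : IsClosed (LinearMap.range S.toFun : Set H) := by
    refine isSeqClosed_iff_isClosed.1 fun f y hf hy => ?_
    choose u hu using hf
    have hu' : ∀ n, S (u n) = f n := hu
    have hcau : CauchySeq fun n => (u n : H) := by
      have hc := hy.cauchySeq
      rw [Metric.cauchySeq_iff'] at hc ⊢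
      intro ε hε
      obtain ⟨N, hN⟩ := hc (μ * ε) (by positivity)
      refine ⟨N, fun n hn => ?_⟩
      have h1 := hN n hn
      have h2 := hb (u n - u N)
      rw [LinearPMap.map_sub, hu', hu', ← dist_eq_norm] at h2
      change μ * ‖(u n : H) - (u N : H)‖ ≤ _ at h2
      rw [← dist_eq_norm] at h2
      exact lt_of_mul_lt_mul_left (h2.trans_lt h1) hμ.le
    obtain ⟨x, hx⟩ := cauchySeq_tendsto_of_complete hcau
    have hmem : (x, y) ∈ S.graph := by
      have hcl' : IsClosed (S.graph : Set (H × H)) := hcl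
      refine hcl'.mem_of_tendsto (hx.prodMk_nhds hy) (Eventually.of_forall fun n => ?_)
      rw [← hu' n]
      exact S.mem_graph (u n)
    obtain ⟨z, -, hz⟩ := (LinearPMap.mem_graph_iff S).1 hmem
    exact ⟨z, hz⟩
  refine ⟨hinj, LinearMap.range_eq_top.1 ?_⟩
  have : CompleteSpace (LinearMap.range S.toFun) := hran.completeSpace_coe
  rw [← Submodule.orthogonal_eq_bot_iff, Submodule.eq_bot_iff]
  intro y hy
  have e : ∀ x : S.domain, inner ℂ (0 : H) (x : H) = inner ℂ y (S x) := fun x => by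
    rw [inner_zero_left]
    exact ((Submodule.mem_orthogonal' _ _).1 hy (S x) ⟨x, rfl⟩).symm
  have hy1 : y ∈ S.adjoint.domain := LinearPMap.mem_adjoint_domain_of_exists _ ⟨0, e⟩
  have hy2 : S.adjoint ⟨y, hy1⟩ = 0 := LinearPMap.adjoint_apply_eq hd _ e
  have hy3 : y ∈ (T.adjoint.domRestrict V').domain := hadj ▸ hy1
  have hy4 : T.adjoint.domRestrict V' ⟨y, hy3⟩ = 0 := by
    rw [← hy2]
    exact (hadj.ge.2 rfl)
  have := hb' ⟨y, hy3⟩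
  rw [hy4, norm_zero] at this
  have h0 : ‖y‖ = 0 := le_antisymm (by
    change μ' * ‖y‖ ≤ 0 at this
    nlinarith) (norm_nonneg _)
  exact norm_eq_zero.1 h0

theorem VBoundaryConditions.closure_le (hV : VBoundaryConditions T T' V V')
    (h : IsJointPair T T') : T.closure ≤ T'.adjoint.domRestrict V := by
  have hle : T ≤ T'.adjoint.domRestrict V := le_domRestrict h.le_adjoint (hV.domain_le h)
  have hle' : T' ≤ T.adjoint.domRestrict V' :=
    le_domRestrict h.symm.le_adjoint ((hV.symm h).domain_le h.symm)
  have hcl : (T'.adjoint.domRestrict V).IsClosed := by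
    rw [← (hV.symm h).adjoint_eq h.symm]
    exact LinearPMap.adjoint_isClosed (h.dense'.mono hle'.1)
  refine LinearPMap.le_of_le_graph ?_
  rw [← (hcl.isClosable.leIsClosable hle).graph_closure_eq_closure_graph]
  exact Submodule.topologicalClosure_minimal _ (LinearPMap.le_graph_of_le hle) hcl

/-- The (V)-boundary conditions imply that the restrictions are mutually adjoint bijective
realisations. -/
theorem VBoundaryConditions.isBijectiveRealisationPair (hV : VBoundaryConditions T T' V V')
    (h : IsJointPair T T') : IsBijectiveRealisationPair T T' V V' where
  le_domain := hV.le_graphSpace.trans inf_le_left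
  le_domain' := hV.le_graphSpace'.trans inf_le_right
  closure_le := hV.closure_le h
  closure_le' := (hV.symm h).closure_le h.symm
  bijective := hV.bijective h
  bijective' := (hV.symm h).bijective h.symm
  adjoint_eq := hV.adjoint_eq h
  adjoint_eq' := (hV.symm h).adjoint_eq h.symm

end AbstractTheory

/-! ### Weakly differentiable functions on an interval are primitives. -/

section AbsolutelyContinuous

variable {F : Type*} [NormedAddCommGroup F] [NormedSpace ℂ F] {a b : ℝ} {f g : ℝ → F}

theorem continuousOn_primitive_Icc (hg : IntegrableOn g (Ioo a b)) :
    ContinuousOn (fun x => ∫ y in a..x, g y) (Icc a b) := by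
  rw [← integrableOn_Icc_iff_integrableOn_Ioo] at hg
  rcases le_or_gt a b with hab | hab
  · rw [← uIcc_of_le hab] at hg ⊢
    exact intervalIntegral.continuousOn_primitive_interval hg
  · simp [hab]

theorem IsTestFunction.ofReal {η : ℝ → ℝ} (hη : IsTestFunction a b η) :
    IsTestFunction a b (fun x => (η x : ℂ)) := by
  have hs' : tsupport (fun x => (η x : ℂ)) ⊆ tsupport η :=
    closure_mono fun x hx => by simpa [Function.mem_support] using hx
  exact ⟨Complex.ofRealCLM.contDiff.comp hη.smooth, hη.compact.comp_left Complex.ofReal_zero,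
    hs'.trans hη.supp⟩

theorem IsTestFunction.eq_zero {G : Type*} [NormedAddCommGroup G] [NormedSpace ℝ G] {φ : ℝ → G}
    (hφ : IsTestFunction a b φ) {x : ℝ} (hx : x ∉ Ioo a b) : φ x = 0 := by
  by_contra hne
  exact hx (hφ.supp (subset_tsupport _ hne))

/-- The primitive of an integrable function is weakly differentiable. -/
theorem isWeakDeriv_primitive [CompleteSpace F] (hg : IntegrableOn g (Ioo a b)) :
    IsWeakDeriv a b (fun x => ∫ y in a..x, g y) g := by
  have hc := continuousOn_primitive_Icc hg
  refine ⟨(hc.integrableOn_Icc).mono_set Ioo_subset_Icc_self, hg, fun φ hφ => ?_⟩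
  set μ := volume.restrict (Ioo a b) with hμ
  have hd : Integrable (deriv φ) μ :=
    (hφ.deriv.continuous.integrable_of_hasCompactSupport hφ.deriv.compact).restrict
  -- Fubini on the triangle y ≤ x: integrating first in y gives φ' times the primitive, integrating
  -- first in x gives φ(b) − φ(y) = −φ(y) times g(y).
  let S : Set (ℝ × ℝ) := {p | p.2 ≤ p.1}
  have hS : MeasurableSet S := measurableSet_le measurable_snd measurable_fst
  have hint : Integrable (S.indicator fun p : ℝ × ℝ => deriv φ p.1 • g p.2) (μ.prod μ) :=
    (hd.smul_prod hg).indicator hS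
  have e1 : ∀ x ∈ Ioo a b, deriv φ x • ∫ y in a..x, g y =
      ∫ y, S.indicator (fun p : ℝ × ℝ => deriv φ p.1 • g p.2) (x, y) ∂μ := by
    intro x hx
    rw [intervalIntegral.integral_of_le hx.1.le, ← integral_smul]
    have : ∀ y, S.indicator (fun p : ℝ × ℝ => deriv φ p.1 • g p.2) (x, y) =
        (Iic x).indicator (fun y => deriv φ x • g y) y := fun y => by
      by_cases h : y ≤ x <;> simp [S, indicator, h]
    simp only [this]
    rw [integral_indicator measurableSet_Iic, hμ, Measure.restrict_restrict measurableSet_Iic]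
    have : Iic x ∩ Ioo a b = Ioc a x := by
      ext y
      simp only [mem_inter_iff, mem_Iic, mem_Ioo, mem_Ioc]
      constructor
      · exact fun h => ⟨h.2.1, h.1⟩
      · exact fun h => ⟨h.2, h.1, h.2.trans_lt hx.2⟩
    rw [this]
  have e2 : ∀ y ∈ Ioo a b,
      ∫ x, S.indicator (fun p : ℝ × ℝ => deriv φ p.1 • g p.2) (x, y) ∂μ = -(φ y • g y) := by
    intro y hy
    have : ∀ x, S.indicator (fun p : ℝ × ℝ => deriv φ p.1 • g p.2) (x, y) =
        (Ici y).indicator (fun x => deriv φ x • g y) x := fun x => by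
      by_cases h : y ≤ x <;> simp [S, indicator, h]
    simp only [this]
    rw [integral_indicator measurableSet_Ici, hμ, Measure.restrict_restrict measurableSet_Ici]
    have : Ici y ∩ Ioo a b = Ico y b := by
      ext x
      simp only [mem_inter_iff, mem_Ici, mem_Ioo, mem_Ico]
      constructor
      · exact fun h => ⟨h.1, h.2.2⟩
      · exact fun h => ⟨h.1, hy.1.trans_le h.1, h.2⟩
    rw [this, integral_smul_const, integral_Ico_eq_integral_Ioc,
      ← intervalIntegral.integral_of_le hy.2.le,
      intervalIntegral.integral_deriv_eq_sub
        (fun x _ => hφ.smooth.differentiable (by simp) x)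
        (hφ.continuous_deriv.intervalIntegrable _ _),
      hφ.eq_zero (x := b) (by simp), zero_sub, neg_smul]
  rw [setIntegral_congr_fun measurableSet_Ioo e1, integral_integral_swap
    (f := fun x y => S.indicator (fun p : ℝ × ℝ => deriv φ p.1 • g p.2) (x, y)) hint,
    setIntegral_congr_fun measurableSet_Ioo e2, integral_neg]

theorem exists_isTestFunction_integral_eq_one (hab : a < b) :
    ∃ η : ℝ → ℝ, IsTestFunction a b η ∧ ∫ x, η x = 1 := by
  let B : ContDiffBump ((a + b) / 2) :=
    ⟨(b - a) / 8, (b - a) / 4, by linarith, by linarith⟩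
  refine ⟨B.normed volume, ⟨B.contDiff_normed, B.hasCompactSupport_normed, ?_⟩, B.integral_normed⟩
  rw [B.tsupport_normed_eq, Real.closedBall_eq_Icc]
  exact Icc_subset_Ioo (by simp only [B]; linarith) (by simp only [B]; linarith)

/-- A test function with vanishing integral is the derivative of a test function. -/
theorem IsTestFunction.exists_primitive {ζ : ℝ → ℝ} (hab : a < b) (hζ : IsTestFunction a b ζ)
    (h0 : ∫ x, ζ x = 0) : ∃ ψ : ℝ → ℝ, IsTestFunction a b ψ ∧ _root_.deriv ψ = ζ := by
  obtain ⟨α, β, hα, hβ, hK⟩ : ∃ α β, a < α ∧ β < b ∧ tsupport ζ ⊆ Icc α β := by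
    rcases (tsupport ζ).eq_empty_or_nonempty with he | hne
    -- For empty support take α = b and β = a: both inequalities hold and [α, β] is empty.
    · exact ⟨b, a, hab, hab, by simp [he]⟩
    · obtain ⟨α, hα⟩ := hζ.compact.isCompact.exists_isLeast hne
      obtain ⟨β, hβ⟩ := hζ.compact.isCompact.exists_isGreatest hne
      exact ⟨α, β, (hζ.supp hα.1).1, (hζ.supp hβ.1).2, fun x hx => ⟨hα.2 hx, hβ.2 hx⟩⟩
  have hz : ∀ x, x ∉ Icc α β → ζ x = 0 := fun x hx => by
    by_contra hne
    exact hx (hK (subset_tsupport _ hne))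
  let ψ : ℝ → ℝ := fun x => ∫ y in Iic x, ζ y
  have hζi : Integrable ζ := hζ.continuous.integrable_of_hasCompactSupport hζ.compact
  have hψ : ∀ x, HasDerivAt ψ (ζ x) x := by
    intro x
    have e : ψ = fun x => (∫ y in Iic a, ζ y) + ∫ y in a..x, ζ y := by
      ext x
      rw [← intervalIntegral.integral_Iic_sub_Iic hζi.integrableOn hζi.integrableOn]
      simp [ψ]
    rw [e]
    exact (intervalIntegral.integral_hasDerivAt_right (hζ.continuous.intervalIntegrable _ _)
      (hζ.continuous.stronglyMeasurableAtFilter _ _) hζ.continuous.continuousAt).const_add _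
  have hd : _root_.deriv ψ = ζ := funext fun x => (hψ x).deriv
  have hs : ∀ x, x ∉ Icc α β → ψ x = 0 := by
    intro x hx
    rw [mem_Icc, not_and_or, not_le, not_le] at hx
    rcases hx with hx | hx
    · refine setIntegral_eq_zero_of_forall_eq_zero fun y hy => hz y fun h => ?_
      exact absurd (h.1.trans hy) (not_le.2 hx)
    · change ∫ y in Iic x, ζ y = 0
      rw [setIntegral_eq_integral_of_forall_compl_eq_zero, h0]
      intro y hy
      rw [mem_Iic, not_le] at hy
      exact hz y fun h => absurd (h.2.trans_lt hx) (not_lt.2 hy.le)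
  have hts : tsupport ψ ⊆ Icc α β :=
    closure_minimal (fun x hx => by_contra fun h => hx (hs x h)) isClosed_Icc
  refine ⟨ψ, ⟨?_, ?_, hts.trans (Icc_subset_Ioo hα hβ)⟩, hd⟩
  · rw [contDiff_infty_iff_deriv, hd]
    exact ⟨fun x => (hψ x).differentiableAt, hζ.smooth⟩
  · exact HasCompactSupport.of_support_subset_isCompact isCompact_Icc
      ((subset_tsupport _).trans hts)

/-- A function with vanishing weak derivative is constant almost everywhere. -/
theorem IsWeakDeriv.exists_eq_const [CompleteSpace F] (hab : a < b) (h : IsWeakDeriv a b f 0) :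
    ∃ c, f =ᵐ[volume.restrict (Ioo a b)] fun _ => c := by
  obtain ⟨η₀, h₀, hi₀⟩ := exists_isTestFunction_integral_eq_one hab
  have hφi : ∀ {η : ℝ → ℝ}, IsTestFunction a b η →
      IntegrableOn (fun x => η x • f x) (Ioo a b) := fun hη => by
    exact (hη.ofReal.integrable_smul h.integrable).congr
      (Eventually.of_forall fun x => Complex.coe_smul _ _)
  let c := ∫ x in Ioo a b, η₀ x • f x
  refine ⟨c, ?_⟩
  have key : ∀ᵐ x ∂volume, x ∈ Ioo a b → f x - c = 0 := by
    refine isOpen_Ioo.ae_eq_zero_of_integral_contDiff_smul_eq_zero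
      (h.integrable.sub (integrableOn_const (by simp))).locallyIntegrableOn fun η hη hc hs => ?_
    have hηt : IsTestFunction a b η := ⟨hη, hc, hs⟩
    have hηi : Integrable η := hηt.continuous.integrable_of_hasCompactSupport hηt.compact
    have h₀i : Integrable η₀ := h₀.continuous.integrable_of_hasCompactSupport h₀.compact
    set I := ∫ x, η x with hI
    -- The du Bois-Reymond argument: η − (∫η)η₀ has integral zero, hence is the derivative of a test
    -- function, and f integrates to zero against it.
    have hζ : IsTestFunction a b (η + (-I) • η₀) :=
      hηt.add ⟨contDiff_const.smul h₀.smooth, h₀.compact.smul_left (f := fun _ => -I),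
        (tsupport_smul_subset_right (fun _ => -I) η₀).trans h₀.supp⟩
    obtain ⟨ψ, hψ, hψd⟩ := hζ.exists_primitive hab (by
      simp only [Pi.add_apply, Pi.smul_apply]
      rw [integral_add hηi (h₀i.const_mul (-I) : Integrable fun x => -I • η₀ x), integral_smul, hi₀]
      simp [hI])
    have e := h.eq _ hψ.ofReal
    have hd : ∀ x, deriv (fun x => (ψ x : ℂ)) x • f x = η x • f x - I • η₀ x • f x := fun x => by
      have h1 : HasDerivAt ψ (η x + -I * η₀ x) x := by
        have := (hψ.smooth.differentiable (by simp) x).hasDerivAt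
        rw [hψd] at this
        exact this
      rw [h1.ofReal_comp.deriv, Complex.coe_smul, add_smul, neg_mul, neg_smul, mul_smul,
        sub_eq_add_neg]
    simp only [hd, Pi.zero_apply, smul_zero, integral_zero, neg_zero] at e
    have e₀ : IntegrableOn (fun x => I • η₀ x • f x) (Ioo a b) := (hφi h₀).smul I
    rw [integral_sub (hφi hηt) e₀, integral_smul] at e
    rw [← setIntegral_eq_integral_of_forall_compl_eq_zero (s := Ioo a b)]
    · simp only [smul_sub]
      rw [integral_sub (hφi hηt) (hηi.smul_const c).integrableOn, integral_smul_const,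
        setIntegral_eq_integral_of_forall_compl_eq_zero (fun x hx => hηt.eq_zero hx), ← hI]
      exact e
    · intro x hx
      rw [hηt.eq_zero hx, zero_smul]
  exact (ae_restrict_iff' measurableSet_Ioo).2 (key.mono fun x hx hx' => sub_eq_zero.1 (hx hx'))

/-- A weakly differentiable function has an absolutely continuous representative. -/
theorem IsWeakDeriv.exists_eq_primitive [CompleteSpace F] (hab : a < b)
    (h : IsWeakDeriv a b f g) :
    ∃ c, f =ᵐ[volume.restrict (Ioo a b)] fun x => c + ∫ y in a..x, g y := by
  have h1 := h.add ((isWeakDeriv_primitive h.integrable').const_smul (-1))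
  have e : g + (-1 : ℂ) • g = 0 := by simp
  rw [e] at h1
  obtain ⟨c, hc⟩ := h1.exists_eq_const hab
  refine ⟨c, hc.mono fun x hx => ?_⟩
  simp only [Pi.add_apply, neg_smul, one_smul, Pi.neg_apply] at hx
  simp only [← hx, neg_add_cancel_right]

/-- Two functions continuous on `[a,b]` which agree a.e. on `(a,b)` agree on `[a,b]`. -/
theorem eqOn_Icc_of_ae_eq {X : Type*} [TopologicalSpace X] [T2Space X] {f g : ℝ → X} (hab : a < b)
    (hf : ContinuousOn f (Icc a b)) (hg : ContinuousOn g (Icc a b))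
    (h : f =ᵐ[volume.restrict (Ioo a b)] g) : EqOn f g (Icc a b) := by
  have h1 : EqOn f g (Ioo a b) :=
    Measure.eqOn_open_of_ae_eq h isOpen_Ioo (hf.mono Ioo_subset_Icc_self)
      (hg.mono Ioo_subset_Icc_self)
  exact h1.of_subset_closure hf hg Ioo_subset_Icc_self (closure_Ioo hab.ne).ge

end AbsolutelyContinuous

/-! ### Translations and short-interval means in L². -/

section DifferenceQuotients

variable {E : Type*} [NormedAddCommGroup E]

theorem sq_eLpNorm_two {α : Type*} [MeasurableSpace α] {μ : Measure α} (f : α → E) :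
    eLpNorm f 2 μ ^ 2 = ∫⁻ x, ‖f x‖ₑ ^ 2 ∂μ := by
  have := eLpNorm_nnreal_pow_eq_lintegral (μ := μ) (f := f) (p := 2) (by norm_num)
  simpa using this

theorem tendsto_eLpNorm_two_of_sq {α ι : Type*} [MeasurableSpace α] {μ : Measure α}
    {f : ι → α → E} {l : Filter ι} (h : Tendsto (fun i => ∫⁻ x, ‖f i x‖ₑ ^ 2 ∂μ) l (𝓝 0)) :
    Tendsto (fun i => eLpNorm (f i) 2 μ) l (𝓝 0) := by
  have h1 := (ENNReal.continuous_rpow_const (y := 1 / 2)).tendsto 0 |>.comp h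
  rw [ENNReal.zero_rpow_of_pos (by norm_num)] at h1
  refine h1.congr fun i => ?_
  simp only [Function.comp_apply]
  rw [← sq_eLpNorm_two, ← ENNReal.rpow_natCast, ← ENNReal.rpow_mul]
  simp

theorem memLp_comp_add_right {G : ℝ → E} (hG : MemLp G 2 volume) (h : ℝ) :
    MemLp (fun x => G (x + h)) 2 volume :=
  hG.comp_measurePreserving (measurePreserving_add_right volume h)

/-- Translation is continuous in `L²`. -/
theorem tendsto_eLpNorm_translate {G : ℝ → E} (hG : MemLp G 2 volume) :
    Tendsto (fun h => eLpNorm (fun x => G (x + h) - G x) 2 volume) (𝓝 (0 : ℝ)) (𝓝 0) := by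
  let τ : ℝ → C(ℝ, ℝ) := fun h => ⟨fun x => x + h, by fun_prop⟩
  have hτ : Continuous τ := ContinuousMap.continuous_of_continuous_uncurry _ (by
    change Continuous fun p : ℝ × ℝ => p.2 + p.1
    fun_prop)
  have hm : ∀ h, MeasurePreserving (τ h) volume volume := fun h =>
    measurePreserving_add_right volume h
  have h1 := (Tendsto.compMeasurePreservingLp (p := 2) (tendsto_const_nhds (x := hG.toLp G))
    (hτ.tendsto 0) hm (hm 0) (by simp))
  have h2 := (tendsto_iff_edist_tendsto_0.1 h1)
  refine h2.congr fun h => ?_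
  rw [Lp.toLp_compMeasurePreserving hG (hm h), Lp.toLp_compMeasurePreserving hG (hm 0),
    Lp.edist_toLp_toLp]
  refine congrArg (fun f => eLpNorm f 2 volume) (funext fun x => ?_)
  simp [τ]

theorem eLpNorm_translate_sub_le {G : ℝ → E} (hG : MemLp G 2 volume) (h : ℝ) :
    eLpNorm (fun x => G (x + h) - G x) 2 volume ≤ 2 * eLpNorm G 2 volume := by
  have h1 : eLpNorm (fun x => G (x + h)) 2 volume = eLpNorm G 2 volume :=
    eLpNorm_comp_measurePreserving hG.1 (measurePreserving_add_right volume h)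
  have h2 := eLpNorm_sub_le (memLp_comp_add_right hG h).1 hG.1 (p := 2) (by norm_num)
  rw [h1, ← two_mul] at h2
  exact h2

variable [NormedSpace ℝ E]

/-- The mean of `G` over the interval from `x` to `x + h`. -/
def meanValue (G : ℝ → E) (h x : ℝ) : E := ∫ t in (0 : ℝ)..1, G (x + h * t)

theorem smul_meanValue (G : ℝ → E) (h x : ℝ) :
    h • meanValue G h x = ∫ t in x..(x + h), G t := by
  unfold meanValue
  rw [intervalIntegral.smul_integral_comp_add_mul]
  simp

theorem stronglyMeasurable_meanValue {G : ℝ → E} (hG : StronglyMeasurable G) (h : ℝ) :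
    StronglyMeasurable (meanValue G h) := by
  have : meanValue G h = fun x => ∫ t in Ioc (0 : ℝ) 1, G (x + h * t) := by
    ext x
    exact intervalIntegral.integral_of_le zero_le_one
  rw [this]
  refine StronglyMeasurable.integral_prod_right (f := fun x t => G (x + h * t)) ?_
  exact hG.comp_measurable (by fun_prop)

/-- `meanValue G h - G` averages the differences G(x + ht) − G(x) over the probability space t ∈ (0,
1]. The L¹ norm there is at most the L² norm, and Tonelli then reduces to translations by at most
|h|. -/
theorem eLpNorm_meanValue_sub_le [CompleteSpace E] {G : ℝ → E} (hm : StronglyMeasurable G)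
    (hG : MemLp G 2 volume) {h : ℝ} (hh : h ≠ 0) {M : ENNReal}
    (hM : ∀ y, |y| ≤ |h| → eLpNorm (fun x => G (x + y) - G x) 2 volume ≤ M) :
    eLpNorm (meanValue G h - G) 2 volume ≤ M := by
  have hp : IsProbabilityMeasure (volume.restrict (Ioc (0 : ℝ) 1)) :=
    ⟨by simp⟩
  have hint : ∀ x, IntervalIntegrable (fun t => G (x + h * t)) volume 0 1 := by
    intro x
    have hl : IntervalIntegrable G volume (x + h * 0) (x + h * 1) :=
      ((hG.locallyIntegrable (by norm_num)).integrableOn_isCompact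
        isCompact_uIcc).intervalIntegrable
    have := (hl.comp_add_left x).comp_mul_left (c := h)
    simpa [hh] using this
  have h1 : ∀ x, ‖(meanValue G h - G) x‖ₑ ^ 2
      ≤ ∫⁻ t in Ioc (0 : ℝ) 1, ‖G (x + h * t) - G x‖ₑ ^ 2 := by
    intro x
    have e : (meanValue G h - G) x = ∫ t in Ioc (0 : ℝ) 1, (G (x + h * t) - G x) := by
      rw [← intervalIntegral.integral_of_le zero_le_one,
        intervalIntegral.integral_sub (hint x) (by simp)]
      simp [meanValue]
    have hmeas : AEStronglyMeasurable (fun t => G (x + h * t) - G x)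
        (volume.restrict (Ioc (0 : ℝ) 1)) :=
      ((hm.comp_measurable (by fun_prop)).sub stronglyMeasurable_const).aestronglyMeasurable
    have e2 : ‖(meanValue G h - G) x‖ₑ ≤ eLpNorm (fun t => G (x + h * t) - G x) 2
        (volume.restrict (Ioc (0 : ℝ) 1)) := by
      rw [e]
      refine (enorm_integral_le_lintegral_enorm _).trans ?_
      rw [← eLpNorm_one_eq_lintegral_enorm]
      exact eLpNorm_le_eLpNorm_of_exponent_le (by norm_num) hmeas
    rw [← sq_eLpNorm_two]
    gcongr
  have h2 : eLpNorm (meanValue G h - G) 2 volume ^ 2 ≤ M ^ 2 := by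
    rw [sq_eLpNorm_two]
    refine (lintegral_mono h1).trans ?_
    rw [lintegral_lintegral_swap]
    · refine (setLIntegral_mono' (g := fun _ => M ^ 2) measurableSet_Ioc fun t ht => ?_).trans ?_
      · rw [← sq_eLpNorm_two]
        gcongr
        refine hM _ ?_
        rw [abs_mul, abs_of_pos ht.1]
        exact mul_le_of_le_one_right (abs_nonneg _) ht.2
      · simp
    · refine Measurable.aemeasurable ?_
      have : StronglyMeasurable fun p : ℝ × ℝ => G (p.1 + h * p.2) - G p.1 :=
        (hm.comp_measurable (by fun_prop)).sub (hm.comp_measurable (by fun_prop))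
      exact this.enorm.pow_const 2
  exact (ENNReal.pow_le_pow_left_iff two_ne_zero).1 h2

theorem memLp_meanValue [CompleteSpace E] {G : ℝ → E} (hm : StronglyMeasurable G)
    (hG : MemLp G 2 volume) {h : ℝ} (hh : h ≠ 0) : MemLp (meanValue G h) 2 volume := by
  have h1 := eLpNorm_meanValue_sub_le hm hG hh fun y _ => eLpNorm_translate_sub_le hG y
  have h2 : MemLp (meanValue G h - G) 2 volume :=
    ⟨((stronglyMeasurable_meanValue hm h).sub hm).aestronglyMeasurable,
      h1.trans_lt (ENNReal.mul_lt_top (by simp) hG.2)⟩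
  simpa using h2.add hG

/-- Means over small intervals converge in `L²`. -/
theorem tendsto_eLpNorm_meanValue [CompleteSpace E] {G : ℝ → E} (hm : StronglyMeasurable G)
    (hG : MemLp G 2 volume) :
    Tendsto (fun h => eLpNorm (meanValue G h - G) 2 volume) (𝓝[>] 0) (𝓝 0) := by
  rw [ENNReal.tendsto_nhds_zero]
  intro ε hε
  have h1 := (ENNReal.tendsto_nhds_zero.1 (tendsto_eLpNorm_translate hG)) ε hε
  obtain ⟨δ, hδ, h2⟩ := Metric.eventually_nhds_iff.1 h1
  filter_upwards [Ioo_mem_nhdsGT hδ] with h hh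
  refine eLpNorm_meanValue_sub_le hm hG hh.1.ne' fun y hy => h2 ?_
  rw [Real.dist_eq, sub_zero]
  rw [abs_of_pos hh.1] at hy
  exact hy.trans_lt hh.2

/-- Lebesgue differentiation: for h > 0 the mean is the right difference quotient of a primitive of
G. -/
theorem ae_tendsto_meanValue [CompleteSpace E] {G : ℝ → E} (hG : LocallyIntegrable G volume) :
    ∀ᵐ x, Tendsto (fun h => meanValue G h x) (𝓝[>] 0) (𝓝 (G x)) := by
  filter_upwards [_root_.LocallyIntegrable.ae_hasDerivAt_integral hG] with x hx
  have h1 := (hx x).tendsto_slope_zero_right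
  refine h1.congr' ?_
  filter_upwards [self_mem_nhdsWithin] with h hh
  rw [intervalIntegral.integral_same, sub_zero, ← smul_meanValue, smul_smul,
    inv_mul_cancel₀ (ne_of_gt hh), one_smul]

theorem norm_meanValue_le {G : ℝ → E} {C : ℝ} (hC : ∀ x, ‖G x‖ ≤ C) (h x : ℝ) :
    ‖meanValue G h x‖ ≤ C := by
  have := intervalIntegral.norm_integral_le_of_norm_le_const (a := 0) (b := 1)
    (f := fun t => G (x + h * t)) (C := C) fun t _ => hC _
  simpa [meanValue] using this

end DifferenceQuotients

/-! ### Limits of L² pairings. -/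

section Pairing

variable {E : Type*} [NormedAddCommGroup E] [InnerProductSpace ℂ E]

theorem inner_toLp {α : Type*} [MeasurableSpace α] {μ : Measure α} {f g : α → E}
    (hf : MemLp f 2 μ) (hg : MemLp g 2 μ) :
    inner ℂ (hf.toLp f) (hg.toLp g) = ∫ x, inner ℂ (f x) (g x) ∂μ := by
  rw [L2.inner_def]
  refine integral_congr_ae ?_
  filter_upwards [hf.coeFn_toLp, hg.coeFn_toLp] with x h1 h2
  rw [h1, h2]

theorem integrable_inner_of_memLp {α : Type*} [MeasurableSpace α] {μ : Measure α} {f g : α → E}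
    (hf : MemLp f 2 μ) (hg : MemLp g 2 μ) : Integrable (fun x => inner ℂ (f x) (g x)) μ := by
  refine (L2.integrable_inner (𝕜 := ℂ) (hf.toLp f) (hg.toLp g)).congr ?_
  filter_upwards [hf.coeFn_toLp, hg.coeFn_toLp] with x h1 h2
  rw [h1, h2]

/-- Joint continuity of the scalar product of L². Membership in L² holds only eventually along `l`,
so the value 0 stands in for the class where it fails. -/
theorem tendsto_integral_inner {α ι : Type*} [MeasurableSpace α] {μ : Measure α} {l : Filter ι}
    {F K : ι → α → E} {F₀ K₀ : α → E} (hF : ∀ᶠ i in l, MemLp (F i) 2 μ)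
    (hK : ∀ᶠ i in l, MemLp (K i) 2 μ) (hF₀ : MemLp F₀ 2 μ) (hK₀ : MemLp K₀ 2 μ)
    (h₁ : Tendsto (fun i => eLpNorm (F i - F₀) 2 μ) l (𝓝 0))
    (h₂ : Tendsto (fun i => eLpNorm (K i - K₀) 2 μ) l (𝓝 0)) :
    Tendsto (fun i => ∫ x, inner ℂ (F i x) (K i x) ∂μ) l (𝓝 (∫ x, inner ℂ (F₀ x) (K₀ x) ∂μ)) := by
  classical
  have aux : ∀ {F : ι → α → E} {F₀ : α → E}, (∀ᶠ i in l, MemLp (F i) 2 μ) →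
      (hF₀ : MemLp F₀ 2 μ) → Tendsto (fun i => eLpNorm (F i - F₀) 2 μ) l (𝓝 0) →
      Tendsto (fun i => if h : MemLp (F i) 2 μ then h.toLp (F i) else 0) l (𝓝 (hF₀.toLp F₀)) := by
    intro F F₀ hF hF₀ h
    rw [tendsto_iff_edist_tendsto_0]
    refine h.congr' (hF.mono fun i hi => ?_)
    simp only [dif_pos hi, Lp.edist_toLp_toLp]
  have h3 := (aux hF hF₀ h₁).inner (𝕜 := ℂ) (aux hK hK₀ h₂)
  rw [inner_toLp] at h3
  refine h3.congr' ?_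
  filter_upwards [hF, hK] with i hi hk
  rw [dif_pos hi, dif_pos hk, inner_toLp]

variable [CompleteSpace E]

/-- Means of a bounded operator coefficient applied to an `L²` function converge in `L²`. -/
theorem tendsto_eLpNorm_meanValue_apply {D : ℝ → E →L[ℂ] E} {V : ℝ → E}
    (hD : StronglyMeasurable D) {C : ℝ} (hC : ∀ x, ‖D x‖ ≤ C) (hV : StronglyMeasurable V)
    (hV2 : MemLp V 2 volume) :
    (∀ h, MemLp (fun x => meanValue D h x (V x)) 2 volume) ∧ MemLp (fun x => D x (V x)) 2 volume ∧
    Tendsto (fun h => eLpNorm ((fun x => meanValue D h x (V x)) - fun x => D x (V x)) 2 volume)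
      (𝓝[>] 0) (𝓝 0) := by
  have happ : ∀ {D : ℝ → E →L[ℂ] E}, StronglyMeasurable D →
      StronglyMeasurable fun x => D x (V x) := fun h =>
    isBoundedBilinearMap_apply.continuous.comp_stronglyMeasurable (h.prodMk hV)
  have hmem : ∀ {D : ℝ → E →L[ℂ] E}, StronglyMeasurable D → (∀ x, ‖D x‖ ≤ C) →
      MemLp (fun x => D x (V x)) 2 volume := fun hD hC =>
    MemLp.of_le_mul (c := C) hV2 (happ hD).aestronglyMeasurable (Eventually.of_forall fun x =>
      ((_ : E →L[ℂ] E).le_opNorm _).trans (by gcongr; exact hC x))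
  have hC0 : 0 ≤ C := (norm_nonneg _).trans (hC 0)
  have hDh := stronglyMeasurable_meanValue hD
  refine ⟨fun h => hmem (hDh h) (norm_meanValue_le hC h), hmem hD hC,
    tendsto_eLpNorm_two_of_sq ?_⟩
  have hloc : LocallyIntegrable D volume :=
    (memLp_top_of_bound hD.aestronglyMeasurable C (Eventually.of_forall hC)).locallyIntegrable
      (by simp)
  -- `D` is merely bounded and measurable, so its means need not converge uniformly. They converge
  -- almost everywhere, and (2C‖V‖)² dominates.
  have hlim : Tendsto (fun h => ∫⁻ x, ‖meanValue D h x (V x) - D x (V x)‖ₑ ^ 2) (𝓝[>] 0)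
      (𝓝 (∫⁻ _ : ℝ, 0)) := by
    refine tendsto_lintegral_filter_of_dominated_convergence
      (fun x => (ENNReal.ofReal (2 * C) * ‖V x‖ₑ) ^ 2) ?_ ?_ ?_ ?_
    · exact Eventually.of_forall fun h => (((happ (hDh h)).sub (happ hD)).enorm).pow_const 2
    · refine Eventually.of_forall fun h => Eventually.of_forall fun x => ?_
      gcongr
      rw [← ofReal_norm, ← ofReal_norm,
        ← ENNReal.ofReal_mul (by positivity)]
      refine ENNReal.ofReal_le_ofReal ?_
      refine (norm_sub_le _ _).trans ?_
      have h1 := (meanValue D h x).le_of_opNorm_le (norm_meanValue_le hC h x) (V x)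
      have h2 := (D x).le_of_opNorm_le (hC x) (V x)
      linarith
    · simp only [mul_pow]
      rw [lintegral_const_mul' _ _ (ENNReal.pow_ne_top ENNReal.ofReal_ne_top), ← sq_eLpNorm_two]
      exact ENNReal.mul_ne_top (ENNReal.pow_ne_top ENNReal.ofReal_ne_top)
        (ENNReal.pow_ne_top hV2.2.ne)
    · filter_upwards [ae_tendsto_meanValue hloc] with x hx
      have h1 : Tendsto (fun h => meanValue D h x (V x) - D x (V x)) (𝓝[>] 0) (𝓝 0) := by
        have := ((ContinuousLinearMap.apply ℂ E (V x)).continuous.tendsto _).comp hx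
        simpa using this.sub_const (D x (V x))
      have h2 := ((ENNReal.continuous_pow 2).tendsto _).comp h1.enorm
      simpa [Function.comp_def] using h2
  rw [lintegral_zero] at hlim
  exact hlim

end Pairing

/-! ### Integration by parts for functions of which only L u is differentiable. -/

section BoundaryLimit

variable {E : Type*} [NormedAddCommGroup E] [InnerProductSpace ℂ E]

/-- A symmetric operator on a finite-dimensional space: a vector orthogonal to the kernel lies in
the range. -/
theorem exists_apply_eq_of_symmetric [FiniteDimensional ℂ E] {M : E →L[ℂ] E}
    (hM : ∀ y z, inner ℂ (M y) z = inner ℂ y (M z)) {w : E}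
    (hw : ∀ z, M z = 0 → inner ℂ z w = 0) : ∃ t, M t = w := by
  have hs : (M : E →ₗ[ℂ] E).IsSymmetric := hM
  have h1 : w ∈ (LinearMap.ker (M : E →ₗ[ℂ] E))ᗮ := by
    rw [Submodule.mem_orthogonal]
    exact fun z hz => hw z hz
  rw [← hs.orthogonal_range, Submodule.orthogonal_orthogonal] at h1
  exact h1

/-- A Lipschitz continuous operator coefficient `L` on `ℝ`, symmetric on `(a,b)`, constant to the
left of `a` and to the right of `b`, with derivative `D`. -/
structure IsLipschitzCoeff (a b : ℝ) (L D : ℝ → E →L[ℂ] E) : Prop where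
  measurable : StronglyMeasurable D
  bounded : ∃ C, ∀ x, ‖D x‖ ≤ C
  eq_zero : ∀ x, x ∉ Ioo a b → D x = 0
  eq_primitive : ∀ x, L x = L a + ∫ t in a..x, D t
  symmetric : ∀ x ∈ Ioo a b, ∀ y z, inner ℂ (L x y) z = inner ℂ y (L x z)

/-- `u ∈ L²(a,b)`, extended by zero, is such that `L u` has the absolutely continuous
representative `w`, with derivative `G ∈ L²`. -/
structure IsGraphFunction (a b : ℝ) (L : ℝ → E →L[ℂ] E) (u w G : ℝ → E) : Prop where
  measurable : StronglyMeasurable u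
  memLp : MemLp u 2 volume
  eq_zero : ∀ x, x ∉ Ioo a b → u x = 0
  measurable' : StronglyMeasurable G
  memLp' : MemLp G 2 volume
  eq_zero' : ∀ x, x ∉ Ioo a b → G x = 0
  eq_primitive : ∀ x, w x = w a + ∫ t in a..x, G t
  apply_eq : ∀ᵐ x, x ∈ Ioo a b → L x (u x) = w x

variable {a b : ℝ} {L D : ℝ → E →L[ℂ] E} {u v w₁ w₂ G₁ G₂ w G : ℝ → E}

theorem integrable_of_integrableOn {F : Type*} [NormedAddCommGroup F] {f : ℝ → F}
    (hf : IntegrableOn f (Ioo a b)) (h0 : ∀ x, x ∉ Ioo a b → f x = 0) : Integrable f :=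
  hf.integrable_of_forall_notMem_eq_zero h0

theorem integrable_of_memLp_two {F : Type*} [NormedAddCommGroup F] {f : ℝ → F}
    (hf : MemLp f 2 volume) (h0 : ∀ x, x ∉ Ioo a b → f x = 0) : Integrable f := by
  have h1 : IntegrableOn f (Ioo a b) := (hf.restrict _).integrable (by norm_num)
  exact h1.integrable_of_forall_notMem_eq_zero h0

theorem IsLipschitzCoeff.integrable (hL : IsLipschitzCoeff a b L D) : Integrable D := by
  obtain ⟨C, hC⟩ := hL.bounded
  have h1 : IntegrableOn D (Ioo a b) :=
    Measure.integrableOn_of_bounded (by simp) hL.measurable.aestronglyMeasurable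
      (Eventually.of_forall hC)
  exact integrable_of_integrableOn h1 hL.eq_zero

theorem IsGraphFunction.integrable (hu : IsGraphFunction a b L u w G) : Integrable u :=
  integrable_of_memLp_two hu.memLp hu.eq_zero

theorem IsGraphFunction.integrable' (hu : IsGraphFunction a b L u w G) : Integrable G :=
  integrable_of_memLp_two hu.memLp' hu.eq_zero'

theorem IsGraphFunction.sub_eq (hu : IsGraphFunction a b L u w G) (x y : ℝ) :
    w y - w x = ∫ t in x..y, G t := by
  rw [hu.eq_primitive y, hu.eq_primitive x, add_sub_add_left_eq_sub,
    intervalIntegral.integral_interval_sub_left hu.integrable'.intervalIntegrable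
      hu.integrable'.intervalIntegrable]

theorem IsLipschitzCoeff.sub_eq (hL : IsLipschitzCoeff a b L D) (x y : ℝ) :
    L y - L x = ∫ t in x..y, D t := by
  rw [hL.eq_primitive y, hL.eq_primitive x, add_sub_add_left_eq_sub,
    intervalIntegral.integral_interval_sub_left hL.integrable.intervalIntegrable
      hL.integrable.intervalIntegrable]

theorem IsGraphFunction.continuous (hu : IsGraphFunction a b L u w G) : Continuous w := by
  have : w = fun x => w a + ∫ t in a..x, G t := funext hu.eq_primitive
  rw [this]
  exact continuous_const.add (intervalIntegral.continuous_primitive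
    (fun _ _ => hu.integrable'.intervalIntegrable) a)

theorem IsLipschitzCoeff.exists_lipschitz (hL : IsLipschitzCoeff a b L D) :
    ∃ C, 0 ≤ C ∧ ∀ x y, ‖L y - L x‖ ≤ C * |y - x| := by
  obtain ⟨C, hC⟩ := hL.bounded
  refine ⟨C, (norm_nonneg _).trans (hC 0), fun x y => ?_⟩
  rw [hL.sub_eq]
  exact intervalIntegral.norm_integral_le_of_norm_le_const fun t _ => hC t

theorem IsLipschitzCoeff.continuous (hL : IsLipschitzCoeff a b L D) : Continuous L := by
  have : L = fun x => L a + ∫ t in a..x, D t := funext hL.eq_primitive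
  rw [this]
  exact continuous_const.add (intervalIntegral.continuous_primitive
    (fun _ _ => hL.integrable.intervalIntegrable) a)

theorem IsLipschitzCoeff.symmetric_Icc (hL : IsLipschitzCoeff a b L D) (hab : a < b) {x : ℝ}
    (hx : x ∈ Icc a b) (y z : E) : inner ℂ (L x y) z = inner ℂ y (L x z) := by
  have hc := hL.continuous
  have h1 : EqOn (fun x => inner ℂ (L x y) z) (fun x => inner ℂ y (L x z)) (Ioo a b) :=
    fun x hx => hL.symmetric x hx y z
  have h2 := h1.closure (by fun_prop) (by fun_prop)
  rw [closure_Ioo hab.ne] at h2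
  exact h2 hx

theorem IsGraphFunction.eq_left (hu : IsGraphFunction a b L u w G) {x : ℝ} (hx : x ≤ a) :
    w x = w a := by
  rw [eq_comm, ← sub_eq_zero, hu.sub_eq]
  refine intervalIntegral.integral_zero_ae (Eventually.of_forall fun t ht => hu.eq_zero' t ?_)
  rw [uIoc_of_le hx] at ht
  exact fun h => absurd h.1 (not_lt.2 ht.2)

theorem IsGraphFunction.eq_right (hu : IsGraphFunction a b L u w G) {x : ℝ} (hx : b ≤ x) :
    w x = w b := by
  rw [← sub_eq_zero, hu.sub_eq]
  refine intervalIntegral.integral_zero_ae (Eventually.of_forall fun t ht => hu.eq_zero' t ?_)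
  rw [uIoc_of_le hx] at ht
  exact fun h => absurd h.2 (not_lt.2 ht.1.le)

theorem IsGraphFunction.integrable_inner (hv : IsGraphFunction a b L v w₂ G₂)
    (hu : IsGraphFunction a b L u w₁ G₁) : Integrable fun x => inner ℂ (v x) (w₁ x) := by
  obtain ⟨K, hK⟩ := isCompact_Icc.exists_bound_of_continuousOn
    (hu.continuous.continuousOn (s := Icc a b))
  refine (hv.integrable.norm.const_mul K).mono'
    (hv.measurable.inner hu.continuous.stronglyMeasurable).aestronglyMeasurable
    (Eventually.of_forall fun x => ?_)
  by_cases hx : x ∈ Ioo a b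
  · have h1 := norm_inner_le_norm (𝕜 := ℂ) (v x) (w₁ x)
    have h2 := hK x (Ioo_subset_Icc_self hx)
    nlinarith [norm_nonneg (v x)]
  · simp [hv.eq_zero x hx]

/-- The discrete product rule for `⟨L u, v⟩`. -/
theorem integral_difference_quotient (hL : IsLipschitzCoeff a b L D)
    (hu : IsGraphFunction a b L u w₁ G₁) (hv : IsGraphFunction a b L v w₂ G₂) {h : ℝ}
    (h0 : 0 < h) :
    ∫ x, (inner ℂ (v x) (w₁ (x + h) - w₁ x) + inner ℂ (w₂ (x + h) - w₂ x) (u (x + h))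
        - inner ℂ ((L (x + h) - L x) (v x)) (u (x + h)))
      = (∫ x in Ioo (b - h) b, inner ℂ (v x) (w₁ b)) -
        ∫ x in Ioo a (a + h), inner ℂ (w₂ a) (u x) := by
  -- `f` is the pairing ⟨Lu, v⟩. `p` lives on the layer where x + h has already left the interval at
  -- b, and q(x + h) on the layer where x has not yet entered it at a.
  let f : ℝ → ℂ := fun x => inner ℂ (v x) (w₁ x)
  let p : ℝ → ℂ := (Ioo (b - h) b).indicator fun x => inner ℂ (v x) (w₁ b)
  let q : ℝ → ℂ := (Ioo a (a + h)).indicator fun x => inner ℂ (w₂ a) (u x)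
  have hf : Integrable f := hv.integrable_inner hu
  have hf' : Integrable fun x => f (x + h) := hf.comp_add_right h
  have hp : Integrable p := (hv.integrable.inner_const (w₁ b)).indicator measurableSet_Ioo
  have hq : Integrable q := (hu.integrable.const_inner (w₂ a)).indicator measurableSet_Ioo
  have hq' : Integrable fun x => q (x + h) := hq.comp_add_right h
  have key : ∀ᵐ x, inner ℂ (v x) (w₁ (x + h) - w₁ x) + inner ℂ (w₂ (x + h) - w₂ x) (u (x + h))
        - inner ℂ ((L (x + h) - L x) (v x)) (u (x + h)) = f (x + h) - f x + p x - q (x + h) := by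
    have hu' := (measurePreserving_add_right (volume : Measure ℝ) h).quasiMeasurePreserving.ae
      hu.apply_eq
    have hv' := (measurePreserving_add_right (volume : Measure ℝ) h).quasiMeasurePreserving.ae
      hv.apply_eq
    have hne : ∀ c : ℝ, ∀ᵐ x : ℝ, x ≠ c := fun c => by simp [ae_iff]
    filter_upwards [hu', hv', hv.apply_eq, hne a, hne (b - h)] with x e1 e2 e3 n1 n2
    have s1 : ∀ y, inner ℂ ((L (x + h) - L x) (v x)) y
        = inner ℂ (L (x + h) (v x)) y - inner ℂ (L x (v x)) y := fun y => by
      rw [sub_apply, inner_sub_left]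
    -- If x and x + h are both inside, symmetry of L(x + h) turns ⟨L(x + h)v(x), u(x + h)⟩ into a
    -- pairing of v(x) with w₁(x + h), while L(x)v(x) = w₂(x). The mixed terms cancel and f(x + h) −
    -- f(x) remains, without any difference of u or v.
    by_cases hx' : x + h ∈ Ioo a b
    · have s2 := hL.symmetric _ hx' (v x) (u (x + h))
      have s3 := hL.symmetric _ hx' (v (x + h)) (u (x + h))
      rw [e1 hx'] at s2 s3
      rw [e2 hx'] at s3
      have p0 : p x = 0 := indicator_of_notMem
        (fun hm => by linarith [hm.1, hx'.2]) _
      by_cases hx : x ∈ Ioo a b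
      · have q0 : q (x + h) = 0 := indicator_of_notMem
          (fun hm => by linarith [hm.2, hx.1]) _
        rw [s1, s2, e3 hx, p0, q0, inner_sub_right, inner_sub_left, s3]
        simp only [f]
        ring
      · have hxa : x < a := by
          refine lt_of_le_of_ne (not_lt.1 fun hlt => hx ⟨hlt, ?_⟩) n1
          linarith [hx'.2]
        have q0 : q (x + h) = inner ℂ (w₂ a) (u (x + h)) := indicator_of_mem
          (show x + h ∈ Ioo a (a + h) from ⟨hx'.1, by linarith⟩) _
        rw [q0, p0]
        simp only [f, hv.eq_zero x hx, hv.eq_left hxa.le, inner_zero_left, map_zero,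
          inner_sub_left, s3]
        ring
    · have f0 : f (x + h) = 0 := by simp [f, hv.eq_zero _ hx']
      have q0 : q (x + h) = 0 := by
        simp only [q, indicator_apply, hu.eq_zero _ hx', inner_zero_right, ite_self]
      rw [f0, q0, hu.eq_zero _ hx', inner_zero_right, inner_zero_right]
      by_cases hx : x ∈ Ioo a b
      · have hxb : b < x + h := by
          refine lt_of_le_of_ne (not_lt.1 fun hlt => hx' ⟨by linarith [hx.1], hlt⟩) ?_
          intro h3
          exact n2 (by linarith)
        have p0 : p x = inner ℂ (v x) (w₁ b) := indicator_of_mem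
          (show x ∈ Ioo (b - h) b from ⟨by linarith, hx.2⟩) _
        rw [p0, hu.eq_right hxb.le, inner_sub_right]
        simp only [f]
        ring
      · simp [f, p, indicator_apply, hv.eq_zero x hx]
  have hs : Integrable fun x => f (x + h) - f x := hf'.sub hf
  have hs' : Integrable fun x => f (x + h) - f x + p x := hs.add hp
  -- By translation invariance the two integrals of `f` cancel, and only the layers are left.
  rw [integral_congr_ae key, integral_sub hs' hq', integral_add hs hp,
    integral_sub hf' hf, integral_add_right_eq_self f h, integral_add_right_eq_self q h, sub_self,
    zero_add, integral_indicator measurableSet_Ioo, integral_indicator measurableSet_Ioo]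

variable [CompleteSpace E]

/-- The boundary form as a limit of means over small intervals at the endpoints. -/
theorem tendsto_boundary_means (hL : IsLipschitzCoeff a b L D)
    (hu : IsGraphFunction a b L u w₁ G₁) (hv : IsGraphFunction a b L v w₂ G₂) :
    Tendsto (fun h : ℝ => h⁻¹ • (∫ x in Ioo (b - h) b, inner ℂ (v x) (w₁ b)) -
        h⁻¹ • ∫ x in Ioo a (a + h), inner ℂ (w₂ a) (u x)) (𝓝[>] 0)
      (𝓝 ((∫ x, inner ℂ (v x) (G₁ x)) + (∫ x, inner ℂ (G₂ x) (u x))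
        - ∫ x, inner ℂ (D x (v x)) (u x))) := by
  obtain ⟨C, hC⟩ := hL.bounded
  have hpos : ∀ᶠ h : ℝ in 𝓝[>] 0, 0 < h := self_mem_nhdsWithin
  have hzero : ∀ {f : ℝ → E}, Tendsto (fun _ : ℝ => eLpNorm (f - f) 2 volume) (𝓝[>] 0) (𝓝 0) := by
    intro f
    simp
  obtain ⟨m1, m2, t3⟩ := tendsto_eLpNorm_meanValue_apply hL.measurable hC hv.measurable hv.memLp
  have tr : Tendsto (fun h : ℝ => eLpNorm ((fun x => u (x + h)) - u) 2 volume) (𝓝[>] 0) (𝓝 0) :=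
    (tendsto_eLpNorm_translate hu.memLp).mono_left nhdsWithin_le_nhds
  have mu : ∀ h, MemLp (fun x => u (x + h)) 2 volume := memLp_comp_add_right hu.memLp
  have mG₁ : ∀ᶠ h : ℝ in 𝓝[>] 0, MemLp (meanValue G₁ h) 2 volume :=
    hpos.mono fun h hh => memLp_meanValue hu.measurable' hu.memLp' hh.ne'
  have mG₂ : ∀ᶠ h : ℝ in 𝓝[>] 0, MemLp (meanValue G₂ h) 2 volume :=
    hpos.mono fun h hh => memLp_meanValue hv.measurable' hv.memLp' hh.ne'
  have l1 := tendsto_integral_inner (F := fun _ => v) (Eventually.of_forall fun _ => hv.memLp) mG₁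
    hv.memLp hu.memLp' hzero (tendsto_eLpNorm_meanValue hu.measurable' hu.memLp')
  have l2 := tendsto_integral_inner mG₂ (Eventually.of_forall mu) hv.memLp' hu.memLp
    (tendsto_eLpNorm_meanValue hv.measurable' hv.memLp') tr
  have l3 := tendsto_integral_inner (Eventually.of_forall m1) (Eventually.of_forall mu) m2
    hu.memLp t3 tr
  refine ((l1.add l2).sub l3).congr' ?_
  filter_upwards [hpos, mG₁, mG₂] with h h0 n1 n2
  have i1 := integrable_inner_of_memLp hv.memLp n1
  have i2 := integrable_inner_of_memLp n2 (mu h)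
  have i3 := integrable_inner_of_memLp (m1 h) (mu h)
  have i4 : Integrable fun x =>
      inner ℂ (v x) (meanValue G₁ h x) + inner ℂ (meanValue G₂ h x) (u (x + h)) := i1.add i2
  rw [← integral_add i1 i2, ← integral_sub i4 i3, ← smul_sub,
    ← integral_difference_quotient hL hu hv h0, ← integral_smul]
  refine integral_congr_ae (Eventually.of_forall fun x => ?_)
  have e1 : w₁ (x + h) - w₁ x = (h : ℂ) • meanValue G₁ h x := by
    rw [hu.sub_eq, Complex.coe_smul, smul_meanValue]
  have e2 : w₂ (x + h) - w₂ x = (h : ℂ) • meanValue G₂ h x := by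
    rw [hv.sub_eq, Complex.coe_smul, smul_meanValue]
  have e3 : L (x + h) - L x = (h : ℂ) • meanValue D h x := by
    rw [hL.sub_eq, Complex.coe_smul, smul_meanValue]
  have h2 : (h : ℂ) ≠ 0 := Complex.ofReal_ne_zero.2 h0.ne'
  simp only [e1, e2, e3, smul_apply, inner_smul_left, inner_smul_right, Complex.conj_ofReal,
    Complex.real_smul, Complex.ofReal_inv]
  field_simp

omit [CompleteSpace E] in
/-- Means of `⟨u, L(x₀) z⟩` over small sets near `x₀`. -/
theorem IsGraphFunction.tendsto_mean (hL : IsLipschitzCoeff a b L D)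
    (hu : IsGraphFunction a b L u w G) {x₀ : ℝ} {S : ℝ → Set ℝ}
    (hS : ∀ᶠ h in 𝓝[>] 0, MeasurableSet (S h) ∧ S h ⊆ Ioo a b ∧ (∀ x ∈ S h, |x - x₀| ≤ h) ∧
      volume (S h) = ENNReal.ofReal h) (z : E) :
    Tendsto (fun h : ℝ => h⁻¹ • ∫ x in S h, inner ℂ (L x₀ z) (u x)) (𝓝[>] 0)
      (𝓝 (inner ℂ z (w x₀))) := by
  obtain ⟨C, hC0, hC⟩ := hL.exists_lipschitz
  have hpos : ∀ᶠ h : ℝ in 𝓝[>] 0, 0 < h := self_mem_nhdsWithin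
  have hvol : Tendsto (fun h => volume (S h)) (𝓝[>] 0) (𝓝 0) := by
    have h1 : Tendsto ENNReal.ofReal (𝓝[>] 0) (𝓝 0) := by
      have := (ENNReal.continuous_ofReal.tendsto 0).mono_left (nhdsWithin_le_nhds (s := Ioi 0))
      rwa [ENNReal.ofReal_zero] at this
    exact h1.congr' (hS.mono fun h hh => hh.2.2.2.symm)
  have hnorm : Tendsto (fun h => ∫ x in S h, ‖u x‖) (𝓝[>] 0) (𝓝 0) :=
    hu.integrable.norm.tendsto_setIntegral_nhds_zero hvol
  have hcont : Tendsto (fun x => inner ℂ z (w x)) (𝓝 x₀) (𝓝 (inner ℂ z (w x₀))) := by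
    have := hu.continuous
    exact Continuous.tendsto (by fun_prop) x₀
  rw [Metric.tendsto_nhds]
  intro ε hε
  obtain ⟨δ, hδ, h2⟩ := Metric.tendsto_nhds_nhds.1 hcont (ε / 2) (by positivity)
  have h3 : ∀ᶠ h in 𝓝[>] 0, C * ‖z‖ * ∫ x in S h, ‖u x‖ < ε / 2 := by
    have := hnorm.const_mul (C * ‖z‖)
    rw [mul_zero] at this
    exact this.eventually_lt_const (by positivity)
  filter_upwards [hpos, hS, h3, Ioo_mem_nhdsGT hδ] with h h0 hSh h3 hhδ
  obtain ⟨hm, hsub, hball, hv⟩ := hSh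
  have hi1 : IntegrableOn (fun x => inner ℂ z (w x)) (S h) := by
    have := hu.continuous
    refine (Continuous.integrableOn_Icc (a := x₀ - h) (b := x₀ + h) (by fun_prop)).mono_set ?_
    intro x hx
    have := abs_le.1 (hball x hx)
    exact ⟨by linarith, by linarith⟩
  have hi2 : IntegrableOn (fun x => inner ℂ (L x₀ z) (u x)) (S h) :=
    (hu.integrable.const_inner _).integrableOn
  have hi3 : IntegrableOn (fun _ => inner ℂ z (w x₀)) (S h) :=
    integrableOn_const (by simp [hv])
  have e1 : (inner ℂ z (w x₀) : ℂ) = h⁻¹ • ∫ x in S h, inner ℂ z (w x₀) := by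
    rw [setIntegral_const, Measure.real, hv, ENNReal.toReal_ofReal h0.le, smul_smul,
      inv_mul_cancel₀ h0.ne', one_smul]
  rw [dist_eq_norm, e1, ← smul_sub, ← integral_sub hi2 hi3, norm_smul, norm_inv,
    Real.norm_of_nonneg h0.le]
  have hbd : ‖∫ x in S h, (inner ℂ (L x₀ z) (u x) - inner ℂ z (w x₀))‖
      ≤ ∫ x in S h, (h * (C * ‖z‖ * ‖u x‖) + ε / 2) := by
    refine norm_integral_le_of_norm_le
      (((hu.integrable.norm.integrableOn.const_mul _).const_mul _).add
        (integrableOn_const (by simp [hv]))) ?_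
    refine (ae_restrict_iff' hm).2 ?_
    filter_upwards [hu.apply_eq] with x hx hxS
    have hxI := hsub hxS
    -- Replacing L(x₀) by L(x) costs at most Ch‖z‖‖u(x)‖. The Lipschitz factor h absorbs the factor
    -- 1/h, and the remaining ∫‖u‖ over a set of measure h tends to 0; the other error is controlled
    -- by continuity of w.
    have e2 : inner ℂ (L x₀ z) (u x) - inner ℂ z (w x₀)
        = inner ℂ ((L x₀ - L x) z) (u x) + (inner ℂ z (w x) - inner ℂ z (w x₀)) := by
      rw [← hx hxI, ← hL.symmetric x hxI, sub_apply, inner_sub_left]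
      ring
    rw [e2]
    refine (norm_add_le _ _).trans (add_le_add ?_ ?_)
    · refine (norm_inner_le_norm _ _).trans ?_
      have h4 : ‖(L x₀ - L x) z‖ ≤ C * h * ‖z‖ := by
        refine (ContinuousLinearMap.le_opNorm _ _).trans ?_
        gcongr
        refine (hC _ _).trans ?_
        rw [abs_sub_comm]
        gcongr
        exact hball x hxS
      calc ‖(L x₀ - L x) z‖ * ‖u x‖ ≤ C * h * ‖z‖ * ‖u x‖ := by gcongr
        _ = h * (C * ‖z‖ * ‖u x‖) := by ring
    · have := h2 (x := x) (by
        rw [Real.dist_eq]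
        exact (hball x hxS).trans_lt hhδ.2)
      rw [dist_eq_norm] at this
      exact this.le
  have e3 : ∫ x in S h, (h * (C * ‖z‖ * ‖u x‖) + ε / 2)
      = h * (C * ‖z‖ * ∫ x in S h, ‖u x‖) + h * (ε / 2) := by
    rw [integral_add ((hu.integrable.norm.integrableOn.const_mul _).const_mul _)
      (integrableOn_const (by simp [hv])), integral_const_mul, integral_const_mul,
      setIntegral_const, Measure.real, hv, ENNReal.toReal_ofReal h0.le, smul_eq_mul]
  rw [e3] at hbd
  calc h⁻¹ * _ ≤ h⁻¹ * (h * (C * ‖z‖ * ∫ x in S h, ‖u x‖) + h * (ε / 2)) := by gcongr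
    _ = C * ‖z‖ * (∫ x in S h, ‖u x‖) + ε / 2 := by field_simp
    _ < ε := by linarith

omit [CompleteSpace E] in
theorem IsGraphFunction.tendsto_mean_left (hab : a < b) (hL : IsLipschitzCoeff a b L D)
    (hu : IsGraphFunction a b L u w G) (z : E) :
    Tendsto (fun h : ℝ => h⁻¹ • ∫ x in Ioo a (a + h), inner ℂ (L a z) (u x)) (𝓝[>] 0)
      (𝓝 (inner ℂ z (w a))) := by
  refine hu.tendsto_mean hL ?_ z
  filter_upwards [Ioo_mem_nhdsGT (sub_pos.2 hab)] with h hh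
  refine ⟨measurableSet_Ioo, Ioo_subset_Ioo_right (by linarith [hh.2]), fun x hx => ?_, by simp⟩
  rw [abs_of_pos (by linarith [hx.1])]
  linarith [hx.2]

omit [CompleteSpace E] in
theorem IsGraphFunction.tendsto_mean_right (hab : a < b) (hL : IsLipschitzCoeff a b L D)
    (hu : IsGraphFunction a b L u w G) (z : E) :
    Tendsto (fun h : ℝ => h⁻¹ • ∫ x in Ioo (b - h) b, inner ℂ (L b z) (u x)) (𝓝[>] 0)
      (𝓝 (inner ℂ z (w b))) := by
  refine hu.tendsto_mean hL ?_ z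
  filter_upwards [Ioo_mem_nhdsGT (sub_pos.2 hab)] with h hh
  refine ⟨measurableSet_Ioo, Ioo_subset_Ioo_left (by linarith [hh.2]), fun x hx => ?_, by simp⟩
  rw [abs_of_neg (by linarith [hx.2])]
  linarith [hx.1]

omit [CompleteSpace E] in
/-- The value of `L u` at an endpoint lies in the range of `L` there. -/
theorem IsGraphFunction.exists_trace [FiniteDimensional ℂ E] (hab : a < b)
    (hL : IsLipschitzCoeff a b L D) (hu : IsGraphFunction a b L u w G) {x₀ : ℝ}
    (hx₀ : x₀ ∈ ({a, b} : Set ℝ)) : ∃ t, L x₀ t = w x₀ := by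
  refine exists_apply_eq_of_symmetric (hL.symmetric_Icc hab ?_) fun z hz => ?_
  · rcases hx₀ with rfl | rfl
    · exact left_mem_Icc.2 hab.le
    · exact right_mem_Icc.2 hab.le
  -- For z in the kernel of L(x₀) the means vanish identically, hence so does their limit ⟨z,
  -- w(x₀)⟩: the endpoint value is orthogonal to the kernel.
  · rcases hx₀ with rfl | rfl
    · have h1 := hu.tendsto_mean_left hab hL z
      simp only [hz, inner_zero_left, integral_zero, smul_zero] at h1
      exact tendsto_nhds_unique h1 tendsto_const_nhds
    · have h1 := hu.tendsto_mean_right hab hL z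
      simp only [hz, inner_zero_left, integral_zero, smul_zero] at h1
      exact tendsto_nhds_unique h1 tendsto_const_nhds

/-- Integration by parts in the graph space: the boundary form in terms of the endpoint values. -/
theorem integral_eq_boundary_terms (hab : a < b) (hL : IsLipschitzCoeff a b L D)
    (hu : IsGraphFunction a b L u w₁ G₁) (hv : IsGraphFunction a b L v w₂ G₂) {s t : E}
    (hs : L b s = w₁ b) (ht : L a t = w₂ a) :
    (∫ x, inner ℂ (v x) (G₁ x)) + (∫ x, inner ℂ (G₂ x) (u x)) - ∫ x, inner ℂ (D x (v x)) (u x)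
      = inner ℂ (w₂ b) s - inner ℂ t (w₁ a) := by
  have h1 := tendsto_boundary_means hL hu hv
  have h2 := hv.tendsto_mean_right hab hL s
  have h3 := hu.tendsto_mean_left hab hL t
  rw [hs] at h2
  rw [ht] at h3
  -- As w₁(b) = L(b)s, these means are the complex conjugates of those in `h2`.
  have h4 : Tendsto (fun h : ℝ => h⁻¹ • ∫ x in Ioo (b - h) b, inner ℂ (v x) (w₁ b)) (𝓝[>] 0)
      (𝓝 (inner ℂ (w₂ b) s)) := by
    have h5 := (Complex.continuous_conj.tendsto _).comp h2
    rw [inner_conj_symm] at h5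
    refine h5.congr fun h => ?_
    simp only [Function.comp_apply, Complex.real_smul, map_mul, Complex.conj_ofReal]
    rw [← integral_conj]
    simp only [inner_conj_symm]
  exact tendsto_nhds_unique h1 (h4.sub h3)

end BoundaryLimit

/-! ### Matrix-valued coefficients acting on L². -/

section MatrixAction

variable {r : ℕ} {a b : ℝ}

/-- The matrix `M` as a continuous linear map. -/
abbrev actL (M : Matrix (Fin r) (Fin r) ℂ) : Cr r →L[ℂ] Cr r := Matrix.toEuclideanCLM (𝕜 := ℂ) M

theorem actL_apply (M : Matrix (Fin r) (Fin r) ℂ) (v : Cr r) : actL M v = act M v := rfl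

theorem inner_act_left (M : Matrix (Fin r) (Fin r) ℂ) (v w : Cr r) :
    inner ℂ (act M v) w = inner ℂ v (act M.conjTranspose w) := by
  unfold act
  rw [Matrix.toEuclideanLin_conjTranspose_eq_adjoint, LinearMap.adjoint_inner_right]

theorem inner_act_conjTranspose_left (M : Matrix (Fin r) (Fin r) ℂ) (v w : Cr r) :
    inner ℂ (act M.conjTranspose v) w = inner ℂ v (act M w) := by
  rw [inner_act_left, Matrix.conjTranspose_conjTranspose]

/-- The matrix unit `E_{ij}` as a continuous linear map. -/
def unitL (i j : Fin r) : Cr r →L[ℂ] Cr r :=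
  (EuclideanSpace.proj j : Cr r →L[ℂ] ℂ).smulRight (EuclideanSpace.single i (1 : ℂ))

theorem actL_eq_sum (M : Matrix (Fin r) (Fin r) ℂ) :
    actL M = ∑ i, ∑ j, M i j • unitL i j := by
  ext1 v
  rw [actL_apply, act_eq_sum]
  simp only [sum_apply, smul_apply, unitL,
    ContinuousLinearMap.smulRight_apply, smul_smul]
  simp [mul_comm]

theorem memLp_finsetSum_normed {F ι : Type*} [NormedAddCommGroup F] {p : ENNReal} {μ : Measure ℝ}
    (t : Finset ι) {f : ι → ℝ → F} (hf : ∀ i ∈ t, MemLp (f i) p μ) :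
    MemLp (fun x => ∑ i ∈ t, f i x) p μ :=
  memLp_finsetSum t hf

theorem memLp_actL {M : ℝ → Matrix (Fin r) (Fin r) ℂ} {p : ENNReal} {μ : Measure ℝ}
    (hM : ∀ i j, MemLp (fun x => M x i j) p μ) : MemLp (fun x => actL (M x)) p μ := by
  simp only [actL_eq_sum]
  exact memLp_finsetSum_normed _ fun i _ => memLp_finsetSum_normed _ fun j _ =>
    (ContinuousLinearMap.toSpanSingleton ℂ (unitL i j)).comp_memLp' (hM i j)

theorem exists_bound_actL {M : ℝ → Matrix (Fin r) (Fin r) ℂ} {μ : Measure ℝ}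
    (hM : ∀ i j, MemLp (fun x => M x i j) ⊤ μ) : ∃ C, 0 < C ∧ ∀ᵐ x ∂μ, ‖actL (M x)‖ ≤ C := by
  have h := memLp_actL hM
  have h1 : eLpNormEssSup (fun x => actL (M x)) μ < ⊤ := by
    have := h.2
    rwa [eLpNorm_exponent_top] at this
  -- Adding 1 keeps the constant strictly positive even for M = 0, as the bound on T + T̃ demands.
  refine ⟨(eLpNormEssSup (fun x => actL (M x)) μ).toReal + 1, by positivity, ?_⟩
  filter_upwards [ae_le_eLpNormEssSup (f := fun x => actL (M x)) (μ := μ)] with x hx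
  have := ENNReal.toReal_mono h1.ne hx
  rw [toReal_enorm] at this
  linarith

theorem memLp_act_of_memLp {M : ℝ → Matrix (Fin r) (Fin r) ℂ} {μ : Measure ℝ}
    (hM : ∀ i j, MemLp (fun x => M x i j) ⊤ μ) {u : ℝ → Cr r} (hu : MemLp u 2 μ) :
    MemLp (fun x => act (M x) (u x)) 2 μ := by
  obtain ⟨C, -, hC⟩ := exists_bound_actL hM
  refine MemLp.of_le_mul (c := C) hu
    (isBoundedBilinearMap_apply.continuous.comp_aestronglyMeasurable
      ((memLp_actL hM).1.prodMk hu.1)) ?_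
  filter_upwards [hC] with x hx
  exact (actL (M x)).le_of_opNorm_le hx _

end MatrixAction

/-! ### Weak derivatives tested with vector-valued functions. -/

section WeakDerivVector

variable {r : ℕ} {a b : ℝ}

theorem IsWeakDeriv.ae_unique {F : Type*} [NormedAddCommGroup F] [NormedSpace ℂ F]
    [CompleteSpace F] {f g f₁ g₁ : ℝ → F} (h : IsWeakDeriv a b f g) (h₁ : IsWeakDeriv a b f₁ g₁)
    (hf : f =ᵐ[volume.restrict (Ioo a b)] f₁) : g =ᵐ[volume.restrict (Ioo a b)] g₁ := by
  have h2 := (h.add (h₁.const_smul (-1))).ae_eq_zero (hf.mono fun x hx => by simp [hx])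
  refine h2.mono fun x hx => ?_
  simpa [← sub_eq_add_neg, sub_eq_zero] using hx

theorem IsWeakDeriv.congr {F : Type*} [NormedAddCommGroup F] [NormedSpace ℂ F]
    {f g f₁ g₁ : ℝ → F} (h : IsWeakDeriv a b f g)
    (hf : f =ᵐ[volume.restrict (Ioo a b)] f₁) (hg : g =ᵐ[volume.restrict (Ioo a b)] g₁) :
    IsWeakDeriv a b f₁ g₁ := by
  refine ⟨h.integrable.congr hf, h.integrable'.congr hg, fun φ hφ => ?_⟩
  rw [← integral_congr_ae (hf.mono fun x hx => by simp only [hx] : (fun x => deriv φ x • f x)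
    =ᵐ[volume.restrict (Ioo a b)] fun x => deriv φ x • f₁ x),
    ← integral_congr_ae (hg.mono fun x hx => by simp only [hx] : (fun x => φ x • g x)
    =ᵐ[volume.restrict (Ioo a b)] fun x => φ x • g₁ x)]
  exact h.eq φ hφ

theorem IsTestFunction.conj {ψ : ℝ → ℂ} (hψ : IsTestFunction a b ψ) :
    IsTestFunction a b (fun x => starRingEnd ℂ (ψ x)) := by
  refine ⟨Complex.conjCLE.contDiff.comp hψ.smooth, hψ.compact.comp_left (map_zero _),
    (tsupport_comp_subset (map_zero (starRingEnd ℂ)) ψ).trans hψ.supp⟩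

theorem IsTestFunction.deriv_conj {ψ : ℝ → ℂ} (hψ : IsTestFunction a b ψ) (x : ℝ) :
    _root_.deriv (fun x => starRingEnd ℂ (ψ x)) x = starRingEnd ℂ (_root_.deriv ψ x) :=
  (Complex.conjCLE.toContinuousLinearMap.hasFDerivAt.comp_hasDerivAt x
    (hψ.smooth.differentiable (by simp) x).hasDerivAt).deriv

theorem IsTestFunction.smul_const {ψ : ℝ → ℂ} (hψ : IsTestFunction a b ψ) (e : Cr r) :
    IsTestFunction a b (fun x => ψ x • e) :=
  ⟨hψ.smooth.smul contDiff_const, hψ.compact.smul_right,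
    (tsupport_smul_subset_left ψ fun _ => e).trans hψ.supp⟩

theorem IsTestFunction.deriv_smul_const {ψ : ℝ → ℂ} (hψ : IsTestFunction a b ψ) (e : Cr r)
    (x : ℝ) : _root_.deriv (fun x => ψ x • e) x = _root_.deriv ψ x • e :=
  ((hψ.smooth.differentiable (by simp) x).hasDerivAt.smul_const e).deriv

theorem IsTestFunction.eq_sum {φ : ℝ → Cr r} (x : ℝ) :
    φ x = ∑ j, φ x j • EuclideanSpace.single j (1 : ℂ) := by
  ext k
  simp [Finset.sum_apply, Pi.single_apply]

/-- Integrability of the scalar product of an integrable function and a test function. -/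
theorem IsTestFunction.integrable_inner {φ : ℝ → Cr r} (hφ : IsTestFunction a b φ)
    {f : ℝ → Cr r} (hf : IntegrableOn f (Ioo a b)) :
    IntegrableOn (fun x => inner ℂ (f x) (φ x)) (Ioo a b) := by
  obtain ⟨C, hC⟩ := hφ.compact.exists_bound_of_continuous hφ.continuous
  refine (hf.norm.const_mul C).mono' (hf.1.inner hφ.continuous.aestronglyMeasurable)
    (Eventually.of_forall fun x => ?_)
  refine (norm_inner_le_norm _ _).trans ?_
  rw [mul_comm]
  gcongr
  exact hC x

theorem setIntegral_inner_smul {ψ : ℝ → ℂ} (hψ : IsTestFunction a b ψ) {f : ℝ → Cr r}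
    (hf : IntegrableOn f (Ioo a b)) (e : Cr r) :
    ∫ x in Ioo a b, inner ℂ (f x) (ψ x • e) =
      inner ℂ (∫ x in Ioo a b, starRingEnd ℂ (ψ x) • f x) e := by
  rw [← inner_conj_symm, ← integral_inner (hψ.conj.integrable_smul hf), ← integral_conj]
  refine integral_congr_ae (Eventually.of_forall fun x => ?_)
  simp only [inner_smul_right, map_mul, Complex.conj_conj]
  rw [inner_conj_symm]

/-- Weak derivatives of vector-valued functions, tested with vector-valued test functions. -/
theorem isWeakDeriv_iff_inner {f g : ℝ → Cr r} (hf : IntegrableOn f (Ioo a b))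
    (hg : IntegrableOn g (Ioo a b)) :
    IsWeakDeriv a b f g ↔ ∀ φ : ℝ → Cr r, IsTestFunction a b φ →
      ∫ x in Ioo a b, inner ℂ (f x) (deriv φ x) = -∫ x in Ioo a b, inner ℂ (g x) (φ x) := by
  constructor
  · intro h φ hφ
    have e1 : ∀ x, inner ℂ (f x) (deriv φ x) = ∑ j, inner ℂ (f x)
        (deriv (fun y => φ y j) x • EuclideanSpace.single j (1 : ℂ) : Cr r) := fun x => by
      rw [← inner_sum, IsTestFunction.eq_sum (φ := deriv φ) x]
      simp only [deriv_coord hφ]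
    have e2 : ∀ x, inner ℂ (g x) (φ x) = ∑ j, inner ℂ (g x)
        (φ x j • EuclideanSpace.single j (1 : ℂ) : Cr r) := fun x => by
      rw [← inner_sum, ← IsTestFunction.eq_sum (φ := φ) x]
    simp only [e1, e2]
    rw [integral_finsetSum _ fun j _ => ((hφ.coord j).deriv.smul_const _).integrable_inner hf,
      integral_finsetSum _ fun j _ => ((hφ.coord j).smul_const _).integrable_inner hg,
      ← Finset.sum_neg_distrib]
    refine Finset.sum_congr rfl fun j _ => ?_
    rw [setIntegral_inner_smul (hφ.coord j).deriv hf, setIntegral_inner_smul (hφ.coord j) hg,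
      ← inner_neg_left, ← h.eq _ (hφ.coord j).conj]
    simp only [(hφ.coord j).deriv_conj]
  · intro h
    refine ⟨hf, hg, fun ψ hψ => ext_inner_right ℂ fun e => ?_⟩
    -- The conjugate compensates for the antilinearity of `inner` in its first slot; as e is
    -- arbitrary, the vector identity follows.
    have e1 := h _ (hψ.conj.smul_const e)
    have e2 := setIntegral_inner_smul hψ.conj.deriv hf e
    rw [setIntegral_inner_smul hψ.conj hg] at e1
    simp only [hψ.conj.deriv_smul_const] at e1
    rw [e1] at e2
    simp only [hψ.deriv_conj, Complex.conj_conj] at e2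
    rw [inner_neg_left, ← e2]

end WeakDerivVector

/-! ### The maximal operators in terms of weak derivatives, and the joint pair property. -/

section Operators

variable {r : ℕ} {a b : ℝ} {A A' B C : ℝ → Matrix (Fin r) (Fin r) ℂ} {s : ℂ}

theorem IsFriedrichsCoeff.memLp_top (h : IsFriedrichsCoeff a b A A' B) (i j : Fin r) :
    MemLp (fun x => A x i j) ⊤ (volume.restrict (Ioo a b)) := by
  have hc : ContinuousOn (fun x => A x i j) (Icc a b) :=
    (continuous_apply_apply i j).comp_continuousOn h.continuousOn
  obtain ⟨K, hK⟩ := isCompact_Icc.exists_bound_of_continuousOn hc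
  exact memLp_top_of_bound (h.weakDeriv i j).integrable.aestronglyMeasurable K
    ((ae_restrict_iff' measurableSet_Ioo).2 (Eventually.of_forall fun x hx =>
      hK x (Ioo_subset_Icc_self hx)))

theorem memLp_top_conjTranspose (h : ∀ i j, MemLp (fun x => B x i j) ⊤ (volume.restrict (Ioo a b)))
    (i j : Fin r) : MemLp (fun x => (B x).conjTranspose i j) ⊤ (volume.restrict (Ioo a b)) := by
  have := (h j i).star
  exact this

theorem IsFriedrichsCoeff.memLp_top_dual (h : IsFriedrichsCoeff a b A A' B) (i j : Fin r) :
    MemLp (fun x => ((B x).conjTranspose + A' x) i j) ⊤ (volume.restrict (Ioo a b)) :=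
  (memLp_top_conjTranspose h.boundedB i j).add (h.bounded' i j)

/-- `A'` is Hermitian almost everywhere. -/
theorem IsFriedrichsCoeff.ae_isHermitian (h : IsFriedrichsCoeff a b A A' B) :
    ∀ᵐ x ∂volume.restrict (Ioo a b), (A' x).conjTranspose = A' x := by
  obtain ⟨μ, -, hμ⟩ := h.positive
  filter_upwards [hμ] with x hx
  -- Positive semidefiniteness includes being Hermitian; B + B* and the multiple of the identity are
  -- Hermitian, so A' is too.
  have h1 := hx.1
  unfold Matrix.IsHermitian at h1
  simp only [Matrix.conjTranspose_sub, Matrix.conjTranspose_add, Matrix.conjTranspose_smul,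
    Matrix.conjTranspose_one, Matrix.conjTranspose_conjTranspose, Complex.star_def,
    Complex.conj_ofReal, sub_left_inj] at h1
  rw [add_comm (B x).conjTranspose] at h1
  exact add_left_cancel h1

theorem memLp_two_integrableOn {F : Type*} [NormedAddCommGroup F] {f : ℝ → F}
    (hf : MemLp f 2 (volume.restrict (Ioo a b))) : IntegrableOn f (Ioo a b) :=
  hf.integrable (by norm_num)

theorem firstOrderOp_spec (x : (firstOrderOp a b A s C).domain) :
    ∃ φ g : ℝ → Cr r, IsTestFunction a b φ ∧
      IsWeakDeriv a b (fun x => act (A x) (φ x)) g ∧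
      (x : L2 a b r) =ᵐ[volume.restrict (Ioo a b)] φ ∧
      firstOrderOp a b A s C x =ᵐ[volume.restrict (Ioo a b)]
        fun x => s • g x + act (C x) (φ x) := by
  have h := (firstOrderOp a b A s C).mem_graph x
  rw [firstOrderOp_graph] at h
  exact h

theorem IsFriedrichsCoeff.exists_testFunction (h : IsFriedrichsCoeff a b A A' B)
    (x : (firstOrderOp a b A s C).domain) :
    ∃ φ : ℝ → Cr r, IsTestFunction a b φ ∧
      (x : L2 a b r) =ᵐ[volume.restrict (Ioo a b)] φ ∧
      firstOrderOp a b A s C x =ᵐ[volume.restrict (Ioo a b)]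
        fun x => s • (act (A' x) (φ x) + act (A x) (deriv φ x)) + act (C x) (φ x) := by
  obtain ⟨φ, g, hφ, hg, h1, h2⟩ := firstOrderOp_spec x
  refine ⟨φ, hφ, h1, ?_⟩
  have h3 := hg.ae_unique (h.isWeakDeriv_act hφ) ae_eq_rfl
  filter_upwards [h2, h3] with x e1 e2
  rw [e1, e2]

theorem IsFriedrichsCoeff.exists_mem_domain (h : IsFriedrichsCoeff a b A A' B) (s : ℂ)
    (hC : ∀ i j, MemLp (fun x => C x i j) ⊤ (volume.restrict (Ioo a b)))
    {φ : ℝ → Cr r} (hφ : IsTestFunction a b φ) :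
    ∃ x : (firstOrderOp a b A s C).domain, (x : L2 a b r) =ᵐ[volume.restrict (Ioo a b)] φ ∧
      firstOrderOp a b A s C x =ᵐ[volume.restrict (Ioo a b)]
        fun x => s • (act (A' x) (φ x) + act (A x) (deriv φ x)) + act (C x) (φ x) := by
  have hm : MemLp φ 2 (volume.restrict (Ioo a b)) :=
    (hφ.continuous.memLp_of_hasCompactSupport hφ.compact).restrict _
  let x : (firstOrderOp a b A s C).domain :=
    ⟨hm.toLp φ, h.mem_opGraph_fst s hC hφ _ hm.coeFn_toLp⟩
  obtain ⟨φ', g, hφ', hg, h1, h2⟩ := firstOrderOp_spec x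
  have e0 : φ' =ᵐ[volume.restrict (Ioo a b)] φ := h1.symm.trans hm.coeFn_toLp
  refine ⟨x, hm.coeFn_toLp, ?_⟩
  have h3 := hg.ae_unique (h.isWeakDeriv_act hφ) (e0.mono fun x hx => by simp only [hx])
  filter_upwards [h2, h3, e0] with x e1 e2 e3
  rw [e1, e2, e3]

/-- Formal adjointness on test functions amounts to weak differentiability. -/
theorem IsFriedrichsCoeff.forall_inner_eq_iff (h : IsFriedrichsCoeff a b A A' B)
    (hs : starRingEnd ℂ s = s) (hss : s * s = 1)
    (hC : ∀ i j, MemLp (fun x => C x i j) ⊤ (volume.restrict (Ioo a b))) (u f : L2 a b r) :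
    (∀ x : (firstOrderOp a b A s C).domain,
      inner ℂ f (x : L2 a b r) = inner ℂ u (firstOrderOp a b A s C x)) ↔
    IsWeakDeriv a b (fun x => act (A x) (u x))
      (fun x => act (A' x) (u x) + s • act (C x).conjTranspose (u x) - s • f x) := by
  set μ := volume.restrict (Ioo a b) with hμ
  have hu : MemLp u 2 μ := Lp.memLp u
  have hf : MemLp f 2 μ := Lp.memLp f
  have hAu := memLp_two_integrableOn (memLp_act_of_memLp h.memLp_top hu)
  have hg : IntegrableOn (fun x => act (A' x) (u x) + s • act (C x).conjTranspose (u x)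
      - s • f x) (Ioo a b) :=
    memLp_two_integrableOn (((memLp_act_of_memLp h.bounded' hu).add
      ((memLp_act_of_memLp (memLp_top_conjTranspose hC) hu).const_smul s)).sub (hf.const_smul s))
  have hfi := memLp_two_integrableOn hf
  rw [isWeakDeriv_iff_inner hAu hg]
  -- The defect in the duality identity is −s times the defect in the weak derivative identity.
  -- Since s² = 1, one vanishes exactly when the other does.
  have key : ∀ φ : ℝ → Cr r, IsTestFunction a b φ →
      (∫ x in Ioo a b, inner ℂ (f x) (φ x)) - (∫ x in Ioo a b, inner ℂ (u x)
        (s • (act (A' x) (φ x) + act (A x) (deriv φ x)) + act (C x) (φ x))) =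
      -s * ((∫ x in Ioo a b, inner ℂ (act (A x) (u x)) (deriv φ x)) +
        ∫ x in Ioo a b, inner ℂ (act (A' x) (u x) + s • act (C x).conjTranspose (u x)
          - s • f x) (φ x)) := by
    intro φ hφ
    have i1 := hφ.integrable_inner hfi
    have i2 := hφ.integrable_inner hg
    have i3 := hφ.deriv.integrable_inner hAu
    have e : ∀ᵐ x ∂μ, inner ℂ (u x) (s • (act (A' x) (φ x) + act (A x) (deriv φ x))
        + act (C x) (φ x)) = inner ℂ (f x) (φ x) + (s * (inner ℂ (act (A x) (u x)) (deriv φ x) +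
        inner ℂ (act (A' x) (u x) + s • act (C x).conjTranspose (u x) - s • f x) (φ x))) := by
      filter_upwards [h.ae_isHermitian, ae_restrict_mem measurableSet_Ioo] with x h1 h2
      have h3 : (A x).conjTranspose = A x := h.hermitian x h2
      rw [inner_sub_left, inner_add_left, inner_smul_left, inner_smul_left, hs,
        inner_act_conjTranspose_left, inner_act_left, inner_act_left, h1, h3, inner_add_right,
        inner_smul_right, inner_add_right]
      linear_combination (inner ℂ (f x) (φ x) - inner ℂ (u x) (act (C x) (φ x))) * hss
    have i4 : IntegrableOn (fun x => inner ℂ (act (A x) (u x)) (deriv φ x) +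
        inner ℂ (act (A' x) (u x) + s • act (C x).conjTranspose (u x) - s • f x) (φ x))
        (Ioo a b) := i3.add i2
    rw [integral_congr_ae e, integral_add i1 (i4.const_mul s), integral_const_mul,
      integral_add i3 i2]
    ring
  have hs0 : s ≠ 0 := fun h0 => by simp [h0] at hss
  have hx : ∀ (x : (firstOrderOp a b A s C).domain) (φ : ℝ → Cr r),
      (x : L2 a b r) =ᵐ[μ] φ → firstOrderOp a b A s C x =ᵐ[μ]
        (fun x => s • (act (A' x) (φ x) + act (A x) (deriv φ x)) + act (C x) (φ x)) →
      inner ℂ f (x : L2 a b r) - inner ℂ u (firstOrderOp a b A s C x) =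
        (∫ x in Ioo a b, inner ℂ (f x) (φ x)) - (∫ x in Ioo a b, inner ℂ (u x)
        (s • (act (A' x) (φ x) + act (A x) (deriv φ x)) + act (C x) (φ x))) := by
    intro x φ h1 h2
    rw [L2.inner_def, L2.inner_def]
    congr 1
    · exact integral_congr_ae (h1.mono fun x hx => by simp only [hx])
    · exact integral_congr_ae (h2.mono fun x hx => by simp only [hx])
  constructor
  · intro H φ hφ
    obtain ⟨x, h1, h2⟩ := h.exists_mem_domain s hC hφ
    have h3 := hx x φ h1 h2
    rw [H x, sub_self, key φ hφ, eq_comm, mul_eq_zero] at h3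
    exact eq_neg_of_add_eq_zero_left (h3.resolve_left (neg_ne_zero.2 hs0))
  · intro H x
    obtain ⟨φ, hφ, h1, h2⟩ := h.exists_testFunction x
    have h3 := hx x φ h1 h2
    rw [key φ hφ, H φ hφ, neg_add_cancel, mul_zero, sub_eq_zero] at h3
    exact h3

/-- Characterises T̃₁u = f as (Au)' = (B* + A')u − f. -/
theorem IsFriedrichsCoeff.forall_inner_opT_iff (h : IsFriedrichsCoeff a b A A' B)
    (u f : L2 a b r) :
    (∀ x : (opT a b A B).domain, inner ℂ f (x : L2 a b r) = inner ℂ u (opT a b A B x)) ↔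
    IsWeakDeriv a b (fun x => act (A x) (u x))
      (fun x => act ((B x).conjTranspose + A' x) (u x) - f x) := by
  unfold opT
  rw [h.forall_inner_eq_iff (by simp) (by simp) h.boundedB]
  simp only [one_smul, act, map_add, LinearMap.add_apply, add_comm]

/-- Characterises T₁u = f as (Au)' = f − Bu: the adjoint of B* + A' is B + A' almost everywhere, and
its A' cancels the one from moving A across. -/
theorem IsFriedrichsCoeff.forall_inner_opT'_iff (h : IsFriedrichsCoeff a b A A' B)
    (u f : L2 a b r) :
    (∀ x : (opT' a b A A' B).domain,
      inner ℂ f (x : L2 a b r) = inner ℂ u (opT' a b A A' B x)) ↔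
    IsWeakDeriv a b (fun x => act (A x) (u x)) (fun x => f x - act (B x) (u x)) := by
  unfold opT'
  rw [h.forall_inner_eq_iff (by simp) (by simp) h.memLp_top_dual]
  have e : (fun x => act (A' x) (u x) + (-1 : ℂ) • act ((B x).conjTranspose + A' x).conjTranspose
      (u x) - (-1 : ℂ) • f x) =ᵐ[volume.restrict (Ioo a b)]
      fun x => f x - act (B x) (u x) := by
    filter_upwards [h.ae_isHermitian] with x hx
    rw [Matrix.conjTranspose_add, Matrix.conjTranspose_conjTranspose, hx]
    simp only [act, map_add, LinearMap.add_apply, neg_smul, one_smul]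
    abel
  exact ⟨fun h => h.congr ae_eq_rfl e, fun h => h.congr ae_eq_rfl e.symm⟩

/-- A vector orthogonal to all products ηe, with η a scalar test function and e ∈ ℂ^r, integrates to
zero against every η and so vanishes almost everywhere. -/
theorem IsFriedrichsCoeff.dense_domain (h : IsFriedrichsCoeff a b A A' B) (s : ℂ)
    (hC : ∀ i j, MemLp (fun x => C x i j) ⊤ (volume.restrict (Ioo a b))) :
    Dense ((firstOrderOp a b A s C).domain : Set (L2 a b r)) := by
  rw [Submodule.dense_iff_topologicalClosure_eq_top, Submodule.topologicalClosure_eq_top_iff,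
    Submodule.eq_bot_iff]
  intro u hu
  have hui := memLp_two_integrableOn (Lp.memLp u)
  have key : ∀ᵐ x ∂volume, x ∈ Ioo a b → u x = 0 := by
    refine isOpen_Ioo.ae_eq_zero_of_integral_contDiff_smul_eq_zero hui.locallyIntegrableOn
      fun η hη hc hsupp => ?_
    have hηt : IsTestFunction a b η := ⟨hη, hc, hsupp⟩
    have h1 : ∫ x in Ioo a b, (η x : ℂ) • u x = 0 := by
      refine ext_inner_right ℂ fun e => ?_
      have h2 := setIntegral_inner_smul hηt.ofReal hui e
      simp only [Complex.conj_ofReal] at h2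
      rw [← h2, inner_zero_left]
      obtain ⟨x, hx, -⟩ := h.exists_mem_domain s hC (hηt.ofReal.smul_const e)
      have h3 := (Submodule.mem_orthogonal' _ _).1 hu x x.2
      rw [L2.inner_def] at h3
      rw [← h3]
      exact integral_congr_ae (hx.mono fun y hy => by simp only [hy])
    rw [setIntegral_eq_integral_of_forall_compl_eq_zero] at h1
    · simpa only [Complex.coe_smul] using h1
    · intro x hx
      rw [hηt.eq_zero hx]
      simp
  refine Lp.ext ?_
  filter_upwards [(ae_restrict_iff' measurableSet_Ioo).2 key,
    Lp.coeFn_zero (Cr r) 2 (volume.restrict (Ioo a b))] with x h1 h2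
  rw [h1, h2, Pi.zero_apply]

theorem IsFriedrichsCoeff.domain_le (h : IsFriedrichsCoeff a b A A' B) (s s' : ℂ)
    {C' : ℝ → Matrix (Fin r) (Fin r) ℂ}
    (hC' : ∀ i j, MemLp (fun x => C' x i j) ⊤ (volume.restrict (Ioo a b))) :
    (firstOrderOp a b A s C).domain ≤ (firstOrderOp a b A s' C').domain := fun x hx => by
  obtain ⟨φ, g, hφ, -, h1, -⟩ := firstOrderOp_spec ⟨x, hx⟩
  exact h.mem_opGraph_fst s' hC' hφ x h1

/-- `T + T̃` is the multiplication with `B + B* + A'`. -/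
theorem IsFriedrichsCoeff.opT_add_opT' {φ : L2 a b r}
    (h₁ : φ ∈ (opT a b A B).domain) (h₂ : φ ∈ (opT' a b A A' B).domain) :
    opT a b A B ⟨φ, h₁⟩ + opT' a b A A' B ⟨φ, h₂⟩ =ᵐ[volume.restrict (Ioo a b)]
      fun x => act (B x + (B x).conjTranspose + A' x) (φ x) := by
  obtain ⟨φ₁, g₁, -, hg₁, e1, e2⟩ := firstOrderOp_spec (⟨φ, h₁⟩ : (opT a b A B).domain)
  obtain ⟨φ₂, g₂, -, hg₂, e3, e4⟩ := firstOrderOp_spec (⟨φ, h₂⟩ : (opT' a b A A' B).domain)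
  have e5 := hg₁.ae_unique hg₂ ((e1.symm.trans e3).mono fun x hx => by simp only [hx])
  filter_upwards [Lp.coeFn_add (opT a b A B ⟨φ, h₁⟩) (opT' a b A A' B ⟨φ, h₂⟩), e1, e2, e3, e4, e5]
    with x e0 e1 e2 e3 e4 e5
  change φ x = _ at e1
  change φ x = _ at e3
  change opT a b A B ⟨φ, h₁⟩ x = _ at e2
  change opT' a b A A' B ⟨φ, h₂⟩ x = _ at e4
  rw [e0, Pi.add_apply, e2, e4, ← e1, ← e3, e5]
  simp only [act, map_add, LinearMap.add_apply, neg_smul, one_smul]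
  abel

open scoped ComplexOrder in
theorem inner_act_nonneg {M : Matrix (Fin r) (Fin r) ℂ} (hM : M.PosSemidef) (v : Cr r) :
    0 ≤ inner ℂ v (act M v) := by
  have h := (Matrix.isPositive_toEuclideanLin_iff.2 hM)
  exact h.inner_nonneg_right v

open scoped ComplexOrder in
theorem IsFriedrichsCoeff.isJointPair (h : IsFriedrichsCoeff a b A A' B) :
    IsJointPair (opT a b A B) (opT' a b A A' B) where
  domain_eq := le_antisymm (h.domain_le _ _ h.memLp_top_dual) (h.domain_le _ _ h.boundedB)
  dense := h.dense_domain _ h.boundedB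
  t1 := by
    intro φ ψ
    -- An element of dom T̃ comes with the weak derivative of its product with A, so the criterion
    -- for T̃₁ gives the duality at once.
    have h1 : ∀ x : (opT a b A B).domain,
        inner ℂ (opT' a b A A' B ψ) (x : L2 a b r) = inner ℂ (ψ : L2 a b r) (opT a b A B x) := by
      rw [h.forall_inner_opT_iff]
      obtain ⟨φ₂, g₂, -, hg₂, e1, e2⟩ := firstOrderOp_spec (ψ : (opT' a b A A' B).domain)
      refine hg₂.congr (e1.mono fun x hx => by simp only [hx]) ?_
      filter_upwards [e1, e2] with x h1 h2
      change opT' a b A A' B ψ x = _ at h2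
      rw [h2, h1]
      simp
    exact (h1 φ).symm
  t2 := by
    obtain ⟨c, hc, hb⟩ := exists_bound_actL (M := fun x => B x + (B x).conjTranspose + A' x)
      (μ := volume.restrict (Ioo a b)) fun i j =>
        ((h.boundedB i j).add (memLp_top_conjTranspose h.boundedB i j)).add (h.bounded' i j)
    refine ⟨c, hc, fun φ h₁ h₂ => Lp.norm_le_mul_norm_of_ae_le_mul ?_⟩
    filter_upwards [IsFriedrichsCoeff.opT_add_opT' h₁ h₂, hb] with x e1 e2
    rw [e1]
    exact (actL _).le_of_opNorm_le e2 _
  t3 := by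
    obtain ⟨μ, hμ, hp⟩ := h.positive
    refine ⟨μ, hμ, fun φ h₁ h₂ => ?_⟩
    have hint : Integrable (fun x => ‖φ x‖ ^ 2) (volume.restrict (Ioo a b)) :=
      (Lp.memLp φ).integrable_norm_pow (by norm_num)
    have hn : ‖φ‖ ^ 2 = ∫ x in Ioo a b, ‖φ x‖ ^ 2 := by
      have h3 := L2.inner_def (𝕜 := ℂ) φ φ
      simp only [inner_self_eq_norm_sq_to_K] at h3
      have h4 : ((‖φ‖ ^ 2 : ℝ) : ℂ) = ∫ x in Ioo a b, ((‖φ x‖ ^ 2 : ℝ) : ℂ) := by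
        simpa using h3
      exact Complex.ofReal_injective (h4.trans integral_complex_ofReal)
    have hi := L2.integrable_inner (𝕜 := ℂ) φ (opT a b A B ⟨φ, h₁⟩ + opT' a b A A' B ⟨φ, h₂⟩)
    have hae : ∀ᵐ x ∂volume.restrict (Ioo a b),
        ((2 * μ * ‖φ x‖ ^ 2 : ℝ) : ℂ) ≤
          inner ℂ (φ x) ((opT a b A B ⟨φ, h₁⟩ + opT' a b A A' B ⟨φ, h₂⟩ : L2 a b r) x) := by
      filter_upwards [IsFriedrichsCoeff.opT_add_opT' h₁ h₂, hp] with x e1 e2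
      rw [e1]
      have h3 := inner_act_nonneg e2 (φ x)
      simp only [act, map_sub, LinearMap.sub_apply, inner_sub_right, sub_nonneg] at h3
      refine le_trans (le_of_eq ?_) h3
      rw [map_smul, LinearMap.smul_apply, inner_smul_right]
      have : Matrix.toEuclideanLin (1 : Matrix (Fin r) (Fin r) ℂ) (φ x) = φ x := by
        simp
      rw [this, inner_self_eq_norm_sq_to_K]
      push_cast
      rfl
    rw [L2.inner_def, hn, ← integral_const_mul, Complex.le_def]
    constructor
    · rw [Complex.ofReal_re, ← Complex.reCLM_apply, ← Complex.reCLM.integral_comp_comm hi]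
      exact integral_mono_ae (hint.const_mul _) (Complex.reCLM.integrable_comp hi)
        (hae.mono fun x hx => (Complex.le_def.1 hx).1)
    · rw [Complex.ofReal_im, ← Complex.imCLM_apply, ← Complex.imCLM.integral_comp_comm hi]
      rw [integral_eq_zero_of_ae]
      exact hae.mono fun x hx => by
        have := (Complex.le_def.1 hx).2
        rw [Complex.ofReal_im] at this
        exact this.symm

end Operators

/-! ### Linear images and affine multiples of weakly differentiable functions. -/

section WeakDerivOperations

variable {F F' : Type*} [NormedAddCommGroup F] [NormedSpace ℂ F] [NormedAddCommGroup F']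
  [NormedSpace ℂ F'] {a b : ℝ} {f g : ℝ → F}

theorem IsWeakDeriv.clm_apply [CompleteSpace F] [CompleteSpace F'] (h : IsWeakDeriv a b f g)
    (l : F →L[ℂ] F') : IsWeakDeriv a b (fun x => l (f x)) (fun x => l (g x)) := by
  refine ⟨l.integrable_comp h.integrable, l.integrable_comp h.integrable', fun φ hφ => ?_⟩
  simp only [← map_smul]
  rw [l.integral_comp_comm (hφ.deriv.integrable_smul h.integrable),
    l.integral_comp_comm (hφ.integrable_smul h.integrable'), h.eq φ hφ, map_neg]

/-- Product rule for an affine scalar factor. -/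
theorem IsWeakDeriv.affine_smul (h : IsWeakDeriv a b f g) (c d : ℝ) :
    IsWeakDeriv a b (fun x => ((c + d * x : ℝ) : ℂ) • f x)
      (fun x => ((c + d * x : ℝ) : ℂ) • g x + (d : ℂ) • f x) := by
  have hη : ContDiff ℝ ∞ fun x : ℝ => ((c + d * x : ℝ) : ℂ) :=
    Complex.ofRealCLM.contDiff.comp (contDiff_const.add (contDiff_const.mul contDiff_id))
  obtain ⟨K, hK⟩ := isCompact_Icc.exists_bound_of_continuousOn
    (hη.continuous.continuousOn (s := Icc a b))
  have hb : ∀ᵐ x ∂volume.restrict (Ioo a b), ‖((c + d * x : ℝ) : ℂ)‖ ≤ K :=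
    (ae_restrict_iff' measurableSet_Ioo).2
      (Eventually.of_forall fun x hx => hK x (Ioo_subset_Icc_self hx))
  have i1 : IntegrableOn (fun x => ((c + d * x : ℝ) : ℂ) • f x) (Ioo a b) :=
    Integrable.bdd_smul h.integrable K hη.continuous.aestronglyMeasurable hb
  have i2 : IntegrableOn (fun x => ((c + d * x : ℝ) : ℂ) • g x) (Ioo a b) :=
    Integrable.bdd_smul h.integrable' K hη.continuous.aestronglyMeasurable hb
  have i3 : IntegrableOn (fun x => (d : ℂ) • f x) (Ioo a b) := h.integrable.smul (d : ℂ)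
  refine ⟨i1, i2.add i3, fun φ hφ => ?_⟩
  have hφη : IsTestFunction a b (fun x => φ x * ((c + d * x : ℝ) : ℂ)) :=
    ⟨hφ.smooth.mul hη, hφ.compact.mul_right, (tsupport_mul_subset_left).trans hφ.supp⟩
  have hd : ∀ x, deriv (fun x => φ x * ((c + d * x : ℝ) : ℂ)) x =
      deriv φ x * ((c + d * x : ℝ) : ℂ) + φ x * (d : ℂ) := fun x => by
    have h1 : HasDerivAt (fun x : ℝ => ((c + d * x : ℝ) : ℂ)) (d : ℂ) x := by
      have := (((hasDerivAt_id x).const_mul d).const_add c).ofReal_comp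
      simpa using this
    exact ((hφ.smooth.differentiable (by simp) x).hasDerivAt.mul h1).deriv
  have e := h.eq _ hφη
  have e1 : ∫ x in Ioo a b, deriv (fun x => φ x * ((c + d * x : ℝ) : ℂ)) x • f x =
      (∫ x in Ioo a b, deriv φ x • ((c + d * x : ℝ) : ℂ) • f x) +
        ∫ x in Ioo a b, φ x • (d : ℂ) • f x := by
    rw [← integral_add (hφ.deriv.integrable_smul i1) (hφ.integrable_smul i3)]
    refine integral_congr_ae (Eventually.of_forall fun x => ?_)
    simp only [hd, add_smul, mul_smul]
  have e2 : ∫ x in Ioo a b, φ x • (((c + d * x : ℝ) : ℂ) • g x + (d : ℂ) • f x) =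
      (∫ x in Ioo a b, (φ x * ((c + d * x : ℝ) : ℂ)) • g x) +
        ∫ x in Ioo a b, φ x • (d : ℂ) • f x := by
    rw [← integral_add (hφη.integrable_smul h.integrable') (hφ.integrable_smul i3)]
    refine integral_congr_ae (Eventually.of_forall fun x => ?_)
    simp only [smul_add, mul_smul]
  rw [e2, neg_add, ← e, e1]
  abel

end WeakDerivOperations

/-! ### Continuous representatives of A u, the boundary form, and affine elements of the graph
space. -/

section GraphSpace

variable {r : ℕ} {a b : ℝ} {A A' B : ℝ → Matrix (Fin r) (Fin r) ℂ} {L D : ℝ → Cr r →L[ℂ] Cr r}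

theorem IsFriedrichsCoeff.isWeakDeriv_actL (h : IsFriedrichsCoeff a b A A' B) :
    IsWeakDeriv a b (fun x => actL (A x)) (fun x => actL (A' x)) := by
  have key := IsWeakDeriv.sum Finset.univ fun (i : Fin r) _ =>
    IsWeakDeriv.sum Finset.univ fun (j : Fin r) _ =>
      (h.weakDeriv i j).smul_vector (unitL i j)
  convert key using 1
  · ext1 x
    simp only [Finset.sum_apply, actL_eq_sum]
  · ext1 x
    simp only [Finset.sum_apply, actL_eq_sum]

theorem IsFriedrichsCoeff.continuousOn_actL (h : IsFriedrichsCoeff a b A A' B) :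
    ContinuousOn (fun x => actL (A x)) (Icc a b) := by
  simp only [actL_eq_sum]
  refine continuousOn_finsetSum _ fun i _ => continuousOn_finsetSum _ fun j _ => ?_
  have hc : ContinuousOn (fun x => A x i j) (Icc a b) :=
    (continuous_apply_apply i j).comp_continuousOn h.continuousOn
  exact hc.smul continuousOn_const

/-- The coefficient `A`, extended to a Lipschitz continuous operator coefficient on `ℝ`. -/
theorem IsFriedrichsCoeff.exists_isLipschitzCoeff (h : IsFriedrichsCoeff a b A A' B)
    (hab : a < b) : ∃ L D, IsLipschitzCoeff a b L D ∧ (∀ x ∈ Icc a b, L x = actL (A x)) ∧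
      D =ᵐ[volume.restrict (Ioo a b)] fun x => actL (A' x) := by
  obtain ⟨K, hK, hb⟩ := exists_bound_actL h.bounded'
  obtain ⟨D₀, hD₀, hD₀e⟩ := (memLp_actL h.bounded').1
  -- Truncating at the essential bound alters `D₀` on (a, b) only on a null set and makes the bound
  -- hold at every point.
  let S : Set ℝ := Ioo a b ∩ {x | ‖D₀ x‖ ≤ K}
  have hS : MeasurableSet S :=
    measurableSet_Ioo.inter (hD₀.norm.measurableSet_le stronglyMeasurable_const)
  let D : ℝ → Cr r →L[ℂ] Cr r := S.indicator D₀
  have hDe : D =ᵐ[volume.restrict (Ioo a b)] fun x => actL (A' x) := by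
    filter_upwards [hb, hD₀e, ae_restrict_mem measurableSet_Ioo] with x h1 h2 h3
    have : x ∈ S := ⟨h3, by rw [mem_ofPred_eq, ← h2]; exact h1⟩
    rw [h2]
    exact indicator_of_mem this D₀
  have hDz : ∀ x, x ∉ Ioo a b → D x = 0 := fun x hx =>
    indicator_of_notMem (fun hm => hx hm.1) D₀
  have hDi : IntegrableOn D (Ioo a b) := h.isWeakDeriv_actL.integrable'.congr hDe.symm
  let L : ℝ → Cr r →L[ℂ] Cr r := fun x => actL (A a) + ∫ t in a..x, D t
  have hLa : L a = actL (A a) := by simp [L]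
  have hLA : ∀ x ∈ Icc a b, L x = actL (A x) := by
    obtain ⟨c, hc⟩ := (h.isWeakDeriv_actL.congr ae_eq_rfl hDe.symm).exists_eq_primitive hab
    have h1 : EqOn (fun x => actL (A x)) (fun x => c + ∫ t in a..x, D t) (Icc a b) :=
      eqOn_Icc_of_ae_eq hab h.continuousOn_actL
        (continuousOn_const.add (continuousOn_primitive_Icc hDi)) hc
    have h2 := h1 (left_mem_Icc.2 hab.le)
    simp only [intervalIntegral.integral_same, add_zero] at h2
    intro x hx
    simp only [h1 hx, L, h2]
  refine ⟨L, D, ⟨hD₀.indicator hS, ⟨K, fun x => ?_⟩, hDz, fun x => ?_, fun x hx y z => ?_⟩,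
    hLA, hDe⟩
  · by_cases hx : x ∈ S
    · simp only [D, indicator_of_mem hx]
      exact hx.2
    · simp only [D, indicator_of_notMem hx, norm_zero]
      exact hK.le
  · rw [hLa]
  · rw [hLA x (Ioo_subset_Icc_self hx), actL_apply, actL_apply, inner_act_left,
      (h.hermitian x hx : (A x).conjTranspose = A x)]

/-- A weakly differentiable `A u` provides a graph function. -/
theorem exists_isGraphFunction (hab : a < b) (hL : ∀ x ∈ Icc a b, L x = actL (A x))
    (u : L2 a b r) {g : ℝ → Cr r} (hg : MemLp g 2 (volume.restrict (Ioo a b)))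
    (hw : IsWeakDeriv a b (fun x => act (A x) (u x)) g) :
    ∃ w G, IsGraphFunction a b L ((Ioo a b).indicator u) w G ∧
      G =ᵐ[volume.restrict (Ioo a b)] g := by
  obtain ⟨G₀, hG₀, hG₀e⟩ := hg.1
  let G : ℝ → Cr r := (Ioo a b).indicator G₀
  have hGe : G =ᵐ[volume.restrict (Ioo a b)] g := by
    filter_upwards [hG₀e, ae_restrict_mem measurableSet_Ioo] with x h1 h2
    rw [h1]
    exact indicator_of_mem h2 G₀
  obtain ⟨c, hc⟩ := (hw.congr ae_eq_rfl hGe.symm).exists_eq_primitive hab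
  refine ⟨fun x => c + ∫ t in a..x, G t, G, ⟨?_, ?_, ?_, ?_, ?_, ?_, ?_, ?_⟩, hGe⟩
  · exact (Lp.stronglyMeasurable u).indicator measurableSet_Ioo
  · exact (memLp_indicator_iff_restrict measurableSet_Ioo).2 (Lp.memLp u)
  · exact fun x hx => indicator_of_notMem hx _
  · exact hG₀.indicator measurableSet_Ioo
  · exact (memLp_indicator_iff_restrict measurableSet_Ioo).2 (hg.ae_eq hG₀e)
  · exact fun x hx => indicator_of_notMem hx _
  · intro x
    simp
  · filter_upwards [(ae_restrict_iff' measurableSet_Ioo).1 hc] with x h1 h2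
    rw [indicator_of_mem h2, hL x (Ioo_subset_Icc_self h2)]
    exact h1 h2

theorem IsFriedrichsCoeff.isWeakDeriv_of_mem (h : IsFriedrichsCoeff a b A A' B) {u : L2 a b r}
    (hu : u ∈ (opT' a b A A' B).adjoint.domain) :
    IsWeakDeriv a b (fun x => act (A x) (u x))
      (fun x => (opT' a b A A' B).adjoint ⟨u, hu⟩ x - act (B x) (u x)) :=
  (h.forall_inner_opT'_iff u _).1 fun x =>
    LinearPMap.adjoint_isFormalAdjoint h.isJointPair.dense' ⟨u, hu⟩ x

theorem IsFriedrichsCoeff.isWeakDeriv_of_mem' (h : IsFriedrichsCoeff a b A A' B) {u : L2 a b r}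
    (hu : u ∈ (opT a b A B).adjoint.domain) :
    IsWeakDeriv a b (fun x => act (A x) (u x))
      (fun x => act ((B x).conjTranspose + A' x) (u x) - (opT a b A B).adjoint ⟨u, hu⟩ x) :=
  (h.forall_inner_opT_iff u _).1 fun x =>
    LinearPMap.adjoint_isFormalAdjoint h.isJointPair.dense ⟨u, hu⟩ x

/-- `w` is a continuous representative of `A u` on `[a,b]`. -/
def IsFluxRep (a b : ℝ) (A : ℝ → Matrix (Fin r) (Fin r) ℂ) (u : ℝ → Cr r) (w : ℝ → Cr r) : Prop :=
  ContinuousOn w (Icc a b) ∧ (fun x => act (A x) (u x)) =ᵐ[volume.restrict (Ioo a b)] w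

theorem IsFluxRep.eqOn {u w w' : ℝ → Cr r} (hab : a < b) (h : IsFluxRep a b A u w)
    (h' : IsFluxRep a b A u w') : EqOn w w' (Icc a b) :=
  eqOn_Icc_of_ae_eq hab h.1 h'.1 (h.2.symm.trans h'.2)

theorem IsGraphFunction.isFluxRep (hL : ∀ x ∈ Icc a b, L x = actL (A x)) {u w G : ℝ → Cr r}
    (h : IsGraphFunction a b L ((Ioo a b).indicator u) w G) : IsFluxRep a b A u w := by
  refine ⟨h.continuous.continuousOn, (ae_restrict_iff' measurableSet_Ioo).2 ?_⟩
  filter_upwards [h.apply_eq] with x hx hxI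
  have := hx hxI
  rwa [indicator_of_mem hxI, hL x (Ioo_subset_Icc_self hxI)] at this

theorem IsFriedrichsCoeff.exists_graphFunction_of_mem (h : IsFriedrichsCoeff a b A A' B)
    (hab : a < b) (hL : ∀ x ∈ Icc a b, L x = actL (A x)) {u : L2 a b r}
    (hu : u ∈ graphSpace (opT a b A B) (opT' a b A A' B)) :
    ∃ w G, IsGraphFunction a b L ((Ioo a b).indicator u) w G ∧
      G =ᵐ[volume.restrict (Ioo a b)]
        fun x => (opT' a b A A' B).adjoint ⟨u, hu.1⟩ x - act (B x) (u x) :=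
  exists_isGraphFunction hab hL u
    ((Lp.memLp _).sub (memLp_act_of_memLp h.boundedB (Lp.memLp u))) (h.isWeakDeriv_of_mem hu.1)

/-- For `u` in the graph space, `A u` has a continuous representative, whose values at the
endpoints lie in the range of `A`. -/
theorem IsFriedrichsCoeff.exists_isFluxRep (h : IsFriedrichsCoeff a b A A' B)
    (hab : a < b) {u : L2 a b r} (hu : u ∈ graphSpace (opT a b A B) (opT' a b A A' B)) :
    ∃ w, IsFluxRep a b A u w ∧ ∀ x₀ ∈ ({a, b} : Set ℝ), ∃ t, act (A x₀) t = w x₀ := by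
  obtain ⟨L, D, hLD, hLA, -⟩ := h.exists_isLipschitzCoeff hab
  obtain ⟨w, G, hw, -⟩ := h.exists_graphFunction_of_mem hab hLA hu
  refine ⟨w, hw.isFluxRep hLA, fun x₀ hx₀ => ?_⟩
  obtain ⟨t, ht⟩ := hw.exists_trace hab hLD hx₀
  refine ⟨t, ?_⟩
  rw [← ht, hLA x₀]
  · rfl
  · rcases hx₀ with rfl | rfl
    · exact left_mem_Icc.2 hab.le
    · exact right_mem_Icc.2 hab.le

theorem integral_indicator_inner {f g f' g' : ℝ → Cr r}
    (hf : f =ᵐ[volume.restrict (Ioo a b)] f') (hg : g =ᵐ[volume.restrict (Ioo a b)] g')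
    (h0 : ∀ x, x ∉ Ioo a b → inner ℂ (f x) (g x) = 0) :
    ∫ x, inner ℂ (f x) (g x) = ∫ x in Ioo a b, inner ℂ (f' x) (g' x) := by
  rw [← setIntegral_eq_integral_of_forall_compl_eq_zero h0]
  refine integral_congr_ae ?_
  filter_upwards [hf, hg] with x h1 h2
  rw [h1, h2]

/-- The boundary form in terms of the endpoint values of `A u` and `A v`. -/
theorem IsFriedrichsCoeff.boundaryForm_eq (h : IsFriedrichsCoeff a b A A' B) (hab : a < b)
    (u v : graphSpace (opT a b A B) (opT' a b A A' B)) {w₁ w₂ : ℝ → Cr r}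
    (h₁ : IsFluxRep a b A (u : L2 a b r) w₁) (h₂ : IsFluxRep a b A (v : L2 a b r) w₂)
    {s t : Cr r} (hs : act (A b) s = w₁ b) (ht : act (A a) t = w₂ a) :
    boundaryForm (opT a b A B) (opT' a b A A' B) u v = inner ℂ (w₂ b) s - inner ℂ t (w₁ a) := by
  obtain ⟨L, D, hLD, hLA, hDA⟩ := h.exists_isLipschitzCoeff hab
  have ha : a ∈ Icc a b := left_mem_Icc.2 hab.le
  have hb : b ∈ Icc a b := right_mem_Icc.2 hab.le
  obtain ⟨w₁', G₁, hw₁, hG₁⟩ := h.exists_graphFunction_of_mem hab hLA u.2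
  obtain ⟨w₂', G₂, hw₂, hG₂⟩ := h.exists_graphFunction_of_mem hab hLA v.2
  have e₁ := h₁.eqOn hab (hw₁.isFluxRep hLA)
  have e₂ := h₂.eqOn hab (hw₂.isFluxRep hLA)
  -- (Av)' has one expression through T₁v and one through T̃₁v; the boundary form calls for the
  -- latter.
  have hG₂' := hG₂.trans ((h.isWeakDeriv_of_mem v.2.1).ae_unique
    (h.isWeakDeriv_of_mem' v.2.2) ae_eq_rfl)
  have key := integral_eq_boundary_terms hab hLD hw₁ hw₂ (s := s) (t := t)
    (by rw [hLA b hb, ← e₁ hb, ← hs]; rfl) (by rw [hLA a ha, ← e₂ ha, ← ht]; rfl)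
  rw [e₁ ha, e₂ hb, ← key, boundaryForm]
  have iu : (Ioo a b).indicator ((u : L2 a b r) : ℝ → Cr r) =ᵐ[volume.restrict (Ioo a b)]
      ((u : L2 a b r) : ℝ → Cr r) :=
    indicator_ae_eq_restrict measurableSet_Ioo
  have iv : (Ioo a b).indicator ((v : L2 a b r) : ℝ → Cr r) =ᵐ[volume.restrict (Ioo a b)]
      ((v : L2 a b r) : ℝ → Cr r) :=
    indicator_ae_eq_restrict measurableSet_Ioo
  have hu2 := Lp.memLp (u : L2 a b r)
  have hv2 := Lp.memLp (v : L2 a b r)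
  have hB := memLp_act_of_memLp h.boundedB hu2
  have hA' := memLp_act_of_memLp h.bounded' hv2
  have hC := memLp_act_of_memLp h.memLp_top_dual hv2
  have hT := Lp.memLp ((opT' a b A A' B).adjoint ⟨(u : L2 a b r), u.2.1⟩)
  have hT' := Lp.memLp ((opT a b A B).adjoint ⟨(v : L2 a b r), v.2.2⟩)
  have i1 := integral_indicator_inner iv hG₁ fun x hx => by
    rw [indicator_of_notMem hx, inner_zero_left]
  have i2 := integral_indicator_inner hG₂' iu fun x hx => by
    rw [indicator_of_notMem hx, inner_zero_right]
  have hDv : (fun x => D x ((Ioo a b).indicator ((v : L2 a b r) : ℝ → Cr r) x))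
      =ᵐ[volume.restrict (Ioo a b)] fun x => act (A' x) ((v : L2 a b r) x) := by
    filter_upwards [hDA, iv] with x h1 h2
    rw [h1, h2]
    rfl
  have i3 := integral_indicator_inner hDv iu fun x hx => by
    rw [indicator_of_notMem hx, map_zero, inner_zero_left]
  rw [i1, i2, i3, L2.inner_def, L2.inner_def,
    ← integral_sub (integrable_inner_of_memLp hv2 hT) (integrable_inner_of_memLp hT' hu2)]
  have j1 := integrable_inner_of_memLp hv2 (hT.sub hB)
  have j2 := integrable_inner_of_memLp (hC.sub hT') hu2
  have j3 := integrable_inner_of_memLp hA' hu2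
  simp only [Pi.sub_apply] at j1 j2
  rw [← integral_add j1 j2, ← integral_sub (Integrable.fun_add j1 j2) j3]
  -- Pointwise, the B terms cancel by adjointness and the A' terms cancel against the integral of
  -- `D`.
  refine integral_congr_ae (Eventually.of_forall fun x => ?_)
  simp only [inner_sub_right, inner_sub_left]
  have e3 : act ((B x).conjTranspose + A' x) ((v : L2 a b r) x)
      = act (B x).conjTranspose ((v : L2 a b r) x) + act (A' x) ((v : L2 a b r) x) := by
    simp only [act, map_add, LinearMap.add_apply]
  rw [e3, inner_add_left, inner_act_conjTranspose_left]
  ring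

/-- Affine functions lie in the graph space. -/
theorem IsFriedrichsCoeff.exists_affine (h : IsFriedrichsCoeff a b A A' B)
    (c d : ℝ) (z : Cr r) :
    ∃ v ∈ graphSpace (opT a b A B) (opT' a b A A' B),
      (v : ℝ → Cr r) =ᵐ[volume.restrict (Ioo a b)] (fun x => ((c + d * x : ℝ) : ℂ) • z) ∧
      IsFluxRep a b A v (fun x => ((c + d * x : ℝ) : ℂ) • act (A x) z) := by
  have hη : Continuous fun x : ℝ => ((c + d * x : ℝ) : ℂ) := by fun_prop
  have hm : MemLp (fun x => ((c + d * x : ℝ) : ℂ) • z) 2 (volume.restrict (Ioo a b)) := by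
    obtain ⟨K, hK⟩ := isCompact_Icc.exists_bound_of_continuousOn
      ((hη.smul continuous_const).continuousOn (s := Icc a b) (f := fun x => _ • z))
    exact MemLp.of_bound (hη.smul continuous_const).aestronglyMeasurable K
      ((ae_restrict_iff' measurableSet_Ioo).2
        (Eventually.of_forall fun x hx => hK x (Ioo_subset_Icc_self hx)))
  have hz : MemLp (fun _ : ℝ => z) 2 (volume.restrict (Ioo a b)) := memLp_const z
  have hw := (h.isWeakDeriv_actL.clm_apply
    (ContinuousLinearMap.apply ℂ (Cr r) z)).affine_smul c d
  simp only [ContinuousLinearMap.apply_apply, actL_apply] at hw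
  have hsm : ∀ (M : Matrix (Fin r) (Fin r) ℂ) (k : ℂ), act M (k • z) = k • act M z :=
    fun M k => map_smul _ _ _
  -- This function is (Av)' + Bv, the value that T₁v must have.
  have hg : MemLp (fun x => ((c + d * x : ℝ) : ℂ) • act (A' x) z + (d : ℂ) • act (A x) z
      + act (B x) (((c + d * x : ℝ) : ℂ) • z)) 2 (volume.restrict (Ioo a b)) := by
    refine MemLp.add (MemLp.add ?_ ?_) ?_
    · simp only [← hsm]
      exact memLp_act_of_memLp h.bounded' hm
    · exact (memLp_act_of_memLp h.memLp_top hz).const_smul (d : ℂ)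
    · exact memLp_act_of_memLp h.boundedB hm
  refine ⟨hm.toLp _, ?_, hm.coeFn_toLp, ?_⟩
  · rw [h.isJointPair.mem_graphSpace_iff]
    refine LinearPMap.mem_adjoint_domain_of_exists _ ⟨hg.toLp _, ?_⟩
    rw [h.forall_inner_opT'_iff]
    refine hw.congr ?_ ?_
    · filter_upwards [hm.coeFn_toLp] with x h1
      rw [h1, hsm]
    · filter_upwards [hm.coeFn_toLp, hg.coeFn_toLp] with x h1 h2
      rw [h1, h2, add_sub_cancel_right]
  · refine ⟨hη.continuousOn.smul (h.continuousOn_actL.clm_apply continuousOn_const), ?_⟩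
    filter_upwards [hm.coeFn_toLp] with x h1
    rw [h1, hsm]

end GraphSpace

/-! ### Spectral perturbation: total projections as continuous multiples of A. -/

section Projections

variable {r : ℕ} {a b : ℝ} {A A' B : ℝ → Matrix (Fin r) (Fin r) ℂ}
  {M N : Matrix (Fin r) (Fin r) ℂ}

theorem isSelfAdjoint_actL (hM : M.IsHermitian) : IsSelfAdjoint (actL M) :=
  (show IsSelfAdjoint M from hM).map (Matrix.toEuclideanCLM (𝕜 := ℂ))

theorem isSymmetric_toEuclideanLin (hM : M.IsHermitian) :
    (Matrix.toEuclideanLin M).IsSymmetric :=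
  Matrix.isSymmetric_toEuclideanLin_iff.2 hM

theorem exists_eigenbasis (hM : M.IsHermitian) :
    ∃ (e : OrthonormalBasis (Fin r) ℂ (Cr r)) (ν : Fin r → ℝ),
      ∀ i, act M (e i) = (ν i : ℂ) • e i ∧ IsEigenvalue M (ν i) := by
  have hn : Module.finrank ℂ (Cr r) = r := finrank_euclideanSpace_fin
  have hT := isSymmetric_toEuclideanLin hM
  exact ⟨hT.eigenvectorBasis hn, hT.eigenvalues hn,
    fun i => ⟨hT.apply_eigenvectorBasis hn i, hT.hasEigenvalue_eigenvalues hn i⟩⟩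

theorem finite_isEigenvalue (M : Matrix (Fin r) (Fin r) ℂ) : {μ : ℝ | IsEigenvalue M μ}.Finite :=
  (Module.End.finite_hasEigenvalue (Matrix.toEuclideanLin M)).preimage
    Complex.ofReal_injective.injOn

theorem starProjection_eigenspace_apply (hM : M.IsHermitian) {v : Cr r} {ν : ℝ}
    (hv : act M v = (ν : ℂ) • v) (μ : ℝ) :
    (Module.End.eigenspace (Matrix.toEuclideanLin M) (μ : ℂ)).starProjection v =
      if ν = μ then v else 0 := by
  have hv' : v ∈ Module.End.eigenspace (Matrix.toEuclideanLin M) (ν : ℂ) :=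
    Module.End.mem_eigenspace_iff.2 hv
  split_ifs with h
  · subst h
    exact Submodule.starProjection_eq_self_iff.2 hv'
  · rw [Submodule.starProjection_apply_eq_zero_iff, Submodule.mem_orthogonal]
    intro z hz
    exact (isSymmetric_toEuclideanLin hM).orthogonalFamily_eigenspaces
      (i := (μ : ℂ)) (j := (ν : ℂ)) (by exact_mod_cast Ne.symm h) ⟨z, hz⟩ ⟨v, hv'⟩

theorem finite_eigenGroup (A : ℝ → Matrix (Fin r) (Fin r) ℂ) (x₀ l x : ℝ) :
    (eigenGroup A x₀ l x).Finite :=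
  (finite_isEigenvalue (A x)).subset fun _ h => h.1

open scoped Classical in
theorem totalProj_apply {x : ℝ} (hM : (A x).IsHermitian) {v : Cr r} {ν : ℝ}
    (hv : act (A x) v = (ν : ℂ) • v) (x₀ l : ℝ) :
    totalProj A x₀ l x v = if ν ∈ eigenGroup A x₀ l x then v else 0 := by
  rw [totalProj, finsum_mem_eq_finite_toFinset_sum _ (finite_eigenGroup A x₀ l x), sum_apply]
  simp only [starProjection_eigenspace_apply hM hv, Finset.sum_ite_eq, Finite.mem_toFinset]

/-- At x₀ the λ-group is {l}: any other member would have to be nearer to l than to itself. -/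
theorem totalProj_self {x₀ l : ℝ} (hl : IsEigenvalue (A x₀) l) :
    totalProj A x₀ l x₀ =
      (Module.End.eigenspace (Matrix.toEuclideanLin (A x₀)) (l : ℂ)).starProjection := by
  have h : eigenGroup A x₀ l x₀ = {l} := by
    ext μ
    refine ⟨fun hμ => ?_, ?_⟩
    · by_contra hne
      have := hμ.2 μ hμ.1 hne
      rw [sub_self, abs_zero] at this
      exact this.not_ge (abs_nonneg _)
    · rintro rfl
      refine ⟨hl, fun l' _ hne => ?_⟩
      rw [sub_self, abs_zero, abs_pos]
      exact sub_ne_zero.2 (Ne.symm hne)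
  rw [totalProj, h, finsum_mem_singleton]

/-- Finiteness makes every real function continuous on the spectrum, so `cfc` may be applied to
quotients with no regularity. -/
theorem finite_spectrum_actL (M : Matrix (Fin r) (Fin r) ℂ) : (spectrum ℝ (actL M)).Finite := by
  have h1 : spectrum ℂ (actL M) = spectrum ℂ M :=
    AlgEquiv.spectrum_eq (Matrix.toEuclideanCLM (𝕜 := ℂ) (n := Fin r)) M
  have h2 : (spectrum ℂ (actL M)).Finite := by
    rw [h1]
    exact Matrix.finite_spectrum M
  rw [← spectrum.preimage_algebraMap ℂ]
  exact h2.preimage (algebraMap ℝ ℂ).injective.injOn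

/-- Functions of a Hermitian matrix act on eigenvectors by evaluation at the eigenvalue. -/
theorem cfc_actL_apply (hM : M.IsHermitian) (ρ : ℝ → ℝ) {v : Cr r} {ν : ℝ}
    (hv : act M v = (ν : ℂ) • v) : cfc ρ (actL M) v = (ρ ν : ℂ) • v := by
  have hc : ∀ f : ℝ → ℝ, ContinuousOn f (spectrum ℝ (actL M)) :=
    (finite_spectrum_actL M).continuousOn
  have hT := isSelfAdjoint_actL hM
  -- Factor ρ(t) − ρ(ν) = q(t)(t − ν); the second factor annihilates v. At t = ν the quotient has
  -- the default value 0, which is harmless because both sides vanish.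
  have e1 : cfc (fun t => ρ t - ρ ν) (actL M) =
      cfc (fun t => (ρ t - ρ ν) / (t - ν)) (actL M) * cfc (fun t => t - ν) (actL M) := by
    rw [← cfc_mul _ _ _ (hc _) (hc _)]
    congr 1
    ext1 t
    by_cases ht : t = ν
    · simp [ht]
    · rw [div_mul_cancel₀ _ (sub_ne_zero.2 ht)]
  have e2 : ∀ (f : ℝ → ℝ) (c : ℝ), cfc (fun t => f t - c) (actL M) v
      = cfc f (actL M) v - (c : ℂ) • v := by
    intro f c
    rw [cfc_sub f (fun _ => c) _ (hc _) (hc _), cfc_const c (actL M) hT, sub_apply]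
    congr 1
  have e3 : cfc (fun t : ℝ => t - ν) (actL M) v = 0 := by
    rw [e2 (fun t => t) ν, cfc_id' ℝ (actL M) hT, actL_apply, hv, sub_self]
  have e4 := congrArg (fun S : Cr r →L[ℂ] Cr r => S v) e1
  simp only [mul_apply_eq_comp, e3, map_zero] at e4
  rw [e2] at e4
  exact sub_eq_zero.1 e4

/-- Eigenvalues of `M` are close to eigenvalues of a nearby Hermitian matrix `N`. -/
theorem exists_isEigenvalue_near (hN : N.IsHermitian) {v : Cr r} {ν δ : ℝ} (hv0 : v ≠ 0)
    (hv : act M v = (ν : ℂ) • v) (hd : ‖actL M - actL N‖ ≤ δ) :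
    ∃ μ, IsEigenvalue N μ ∧ |ν - μ| ≤ δ := by
  obtain ⟨e, κ, he⟩ := exists_eigenbasis hN
  -- Were every eigenvalue of N farther than δ from ν, each coefficient of (M − N)v in an eigenbasis
  -- of N would be at least δ times that of v, strictly where the latter is nonzero, so ‖(M − N)v‖ >
  -- δ‖v‖.
  by_contra! hcon
  have hδ : 0 ≤ δ := (norm_nonneg _).trans hd
  have e1 : ∀ i, inner ℂ (e i) ((actL M - actL N) v) = ((ν - κ i : ℝ) : ℂ) * inner ℂ (e i) v := by
    intro i
    have h1 : inner ℂ (e i) (act N v) = (κ i : ℂ) * inner ℂ (e i) v := by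
      have h2 := inner_act_left N (e i) v
      rw [hN, (he i).1, inner_smul_left, Complex.conj_ofReal] at h2
      exact h2.symm
    rw [sub_apply, inner_sub_right, actL_apply, actL_apply, hv, h1, inner_smul_right]
    push_cast
    ring
  have h1 := e.sum_sq_norm_inner_right ((actL M - actL N) v)
  have h2 : ‖(actL M - actL N) v‖ ^ 2 ≤ δ ^ 2 * ‖v‖ ^ 2 := by
    rw [← mul_pow]
    gcongr
    exact (actL M - actL N).le_of_opNorm_le hd v
  have h3 : δ ^ 2 * ‖v‖ ^ 2 < ∑ i, ‖inner ℂ (e i) ((actL M - actL N) v)‖ ^ 2 := by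
    rw [← e.sum_sq_norm_inner_right v, Finset.mul_sum]
    have hle : ∀ i, δ ^ 2 ≤ |ν - κ i| ^ 2 := fun i =>
      pow_le_pow_left₀ hδ (hcon _ (he i).2).le 2
    obtain ⟨i, hi⟩ : ∃ i, inner ℂ (e i) v ≠ 0 := by
      by_contra! h0
      apply hv0
      rw [← norm_eq_zero, ← sq_eq_zero_iff, ← e.sum_sq_norm_inner_right v]
      simp [h0]
    refine Finset.sum_lt_sum (fun i _ => ?_) ⟨i, Finset.mem_univ i, ?_⟩
    · rw [e1, norm_mul, mul_pow, Complex.norm_real, Real.norm_eq_abs]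
      gcongr
      exact (hcon _ (he i).2).le
    · rw [e1, norm_mul, mul_pow, Complex.norm_real, Real.norm_eq_abs]
      have : 0 < ‖inner ℂ (e i) v‖ := norm_pos_iff.2 hi
      gcongr
      exact hcon _ (he i).2
  linarith

/-- With gap 4δ, an eigenvalue displaced by at most δ stays either within δ of l or at distance at
least 3δ from it, which leaves room for the cutoff between δ and 2δ. The bound 4δ ≤ |l| keeps the
δ-neighbourhood of l away from 0. -/
theorem exists_gap (M : Matrix (Fin r) (Fin r) ℂ) {l : ℝ} (hl : l ≠ 0) :
    ∃ δ, 0 < δ ∧ 4 * δ ≤ |l| ∧ ∀ l', IsEigenvalue M l' → l' ≠ l → 4 * δ ≤ |l - l'| := by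
  have hfin : ((fun l' => |l - l'|) '' ({μ : ℝ | IsEigenvalue M μ} \ {l})).Finite :=
    ((finite_isEigenvalue M).sdiff).image _
  have h0 : ∀ᶠ δ in 𝓝[>] (0 : ℝ), 4 * δ ≤ |l| :=
    ((tendsto_nhdsWithin_of_tendsto_nhds (by
      simpa using (continuous_const_mul (4 : ℝ)).tendsto 0)).eventually
        (ge_mem_nhds (abs_pos.2 hl)))
  have h1 : ∀ᶠ δ in 𝓝[>] (0 : ℝ), ∀ l' ∈ {μ : ℝ | IsEigenvalue M μ} \ {l}, 4 * δ ≤ |l - l'| := by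
    rw [Filter.eventually_all_finite (finite_isEigenvalue M).sdiff]
    intro l' hl'
    exact ((tendsto_nhdsWithin_of_tendsto_nhds (by
      simpa using (continuous_const_mul (4 : ℝ)).tendsto 0)).eventually
        (ge_mem_nhds (abs_pos.2 (sub_ne_zero.2 (Ne.symm hl'.2)))))
  obtain ⟨δ, ⟨h2, h3⟩, h4⟩ := ((h0.and h1).and self_mem_nhdsWithin).exists
  exact ⟨δ, h4, h2, fun l' h5 h6 => h3 l' ⟨h5, h6⟩⟩

/-- The reciprocal, cut off to the `2 δ`-neighbourhood of `l`. -/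
def cutoffInv (l δ t : ℝ) : ℝ := max 0 (min 1 (2 - |t - l| / δ)) * (t / max (t ^ 2) (δ ^ 2))

/-- The denominator max(t², δ²) removes the pole at 0 and leaves 1/t unchanged for |t| ≥ δ. -/
theorem continuous_cutoffInv {l δ : ℝ} (hδ : 0 < δ) : Continuous (cutoffInv l δ) := by
  unfold cutoffInv
  refine Continuous.mul (by fun_prop) (Continuous.div continuous_id (by fun_prop) fun t => ?_)
  have : 0 < δ ^ 2 := by positivity
  exact (this.trans_le (le_max_right _ _)).ne'

theorem cutoffInv_mul_self {l δ t : ℝ} (hδ : 0 < δ) (hl : 4 * δ ≤ |l|) (ht : |t - l| ≤ δ) :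
    cutoffInv l δ t * t = 1 := by
  have h1 : δ ≤ |t| := by
    have := abs_sub_abs_le_abs_sub l t
    rw [abs_sub_comm] at this
    linarith
  have h2 : δ ^ 2 ≤ t ^ 2 := by
    rw [← sq_abs t]
    gcongr
  have h3 : 0 < t ^ 2 := (by positivity : 0 < δ ^ 2).trans_le h2
  have h4 : 1 ≤ 2 - |t - l| / δ := by
    have : |t - l| / δ ≤ 1 := (div_le_one hδ).2 ht
    linarith
  rw [cutoffInv, max_eq_left h2, min_eq_left h4, max_eq_right zero_le_one]
  have : t ≠ 0 := fun h => by simp [h] at h3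
  field_simp

theorem cutoffInv_eq_zero {l δ t : ℝ} (hδ : 0 < δ) (ht : 2 * δ ≤ |t - l|) :
    cutoffInv l δ t = 0 := by
  have h4 : 2 - |t - l| / δ ≤ 0 := by
    have : 2 ≤ |t - l| / δ := (le_div_iff₀ hδ).2 ht
    linarith
  rw [cutoffInv, max_eq_left ((min_le_right _ _).trans h4), zero_mul]

theorem IsFriedrichsCoeff.isHermitian_Icc (h : IsFriedrichsCoeff a b A A' B) (hab : a < b)
    {x : ℝ} (hx : x ∈ Icc a b) : (A x).IsHermitian := by
  have h1 : EqOn (fun x => (A x).conjTranspose) A (Ioo a b) := fun x hx => h.hermitian x hx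
  exact h1.of_subset_closure
    (continuous_id.matrix_conjTranspose.comp_continuousOn h.continuousOn) h.continuousOn
    Ioo_subset_Icc_self (closure_Ioo hab.ne).ge hx

/-- Near `x₀`, the total projection of a nonzero eigenvalue is a continuous multiple of `A`. -/
theorem IsFriedrichsCoeff.exists_reducedInverse (h : IsFriedrichsCoeff a b A A' B) (hab : a < b)
    {x₀ l : ℝ} (hx₀ : x₀ ∈ Icc a b) (hl : l ≠ 0) :
    ∃ ε > 0, ∃ R : ℝ → Cr r →L[ℂ] Cr r, ContinuousOn R (Icc a b) ∧
      ∀ x ∈ Icc a b ∩ Icc (x₀ - ε) (x₀ + ε), ∀ v, totalProj A x₀ l x v = R x (act (A x) v) := by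
  classical
  obtain ⟨δ, hδ, hδl, hgap⟩ := exists_gap (A x₀) hl
  obtain ⟨ε, hε, hεδ⟩ : ∃ ε > 0, ∀ x ∈ Icc a b ∩ Icc (x₀ - ε) (x₀ + ε),
      ‖actL (A x) - actL (A x₀)‖ ≤ δ := by
    obtain ⟨η, hη, h1⟩ := Metric.continuousOn_iff.1 h.continuousOn_actL x₀ hx₀ δ hδ
    refine ⟨η / 2, half_pos hη, fun x hx => ?_⟩
    rw [← dist_eq_norm]
    refine (h1 x hx.1 ?_).le
    rw [Real.dist_eq, abs_lt]
    constructor <;> linarith [hx.2.1, hx.2.2]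
  obtain ⟨K, hK⟩ := isCompact_Icc.exists_bound_of_continuousOn h.continuousOn_actL
  refine ⟨ε, hε, fun x => cfc (cutoffInv l δ) (actL (A x)), ?_, ?_⟩
  -- Continuity of the functional calculus needs one compact set containing all the spectra. The
  -- factor ‖1‖ covers r = 0, where it is 0.
  · refine ContinuousOn.cfc' (p := IsSelfAdjoint)
      (isCompact_closedBall 0 (K * ‖(1 : Cr r →L[ℂ] Cr r)‖)) _ h.continuousOn_actL
      (fun x hx t ht => ?_) (fun x hx => isSelfAdjoint_actL (h.isHermitian_Icc hab hx))
      (continuous_cutoffInv hδ).continuousOn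
    rw [mem_closedBall_zero_iff]
    exact (spectrum.norm_le_norm_mul_of_mem ht).trans
      (mul_le_mul_of_nonneg_right (hK x hx) (norm_nonneg _))
  · intro x hx v
    have hM := h.isHermitian_Icc hab hx.1
    obtain ⟨e, κ, he⟩ := exists_eigenbasis hM
    have key : (totalProj A x₀ l x).toLinearMap =
        (cfc (cutoffInv l δ) (actL (A x)) ∘L actL (A x)).toLinearMap := by
      refine e.toBasis.ext fun i => ?_
      rw [e.coe_toBasis]
      change totalProj A x₀ l x (e i) = cfc (cutoffInv l δ) (actL (A x)) (act (A x) (e i))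
      obtain ⟨h1, h2⟩ := he i
      rw [totalProj_apply hM h1, h1, map_smul, cfc_actL_apply hM _ h1, smul_smul]
      -- κ i lies within δ of an eigenvalue μ of A(x₀). If μ = l, it belongs to the group and the
      -- cutoff reciprocal inverts it; otherwise it is nearer to μ than to l and the cutoff
      -- vanishes. Both sides thus agree on an eigenbasis of A(x).
      obtain ⟨μ, hμ, hμκ⟩ := exists_isEigenvalue_near (h.isHermitian_Icc hab hx₀)
        (e.toBasis.ne_zero i) (by rw [e.coe_toBasis]; exact h1) (hεδ x hx)
      by_cases hμl : μ = l
      · subst hμl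
        rw [if_pos, ← Complex.ofReal_mul, mul_comm, cutoffInv_mul_self hδ hδl hμκ,
          Complex.ofReal_one, one_smul]
        refine ⟨h2, fun l' hl' hne => ?_⟩
        have h3 := hgap l' hl' hne
        have h4 := abs_sub_le μ (κ i) l'
        rw [abs_sub_comm μ (κ i)] at h4
        linarith
      · have h3 := hgap μ hμ hμl
        have h4 := abs_sub_le l (κ i) μ
        rw [abs_sub_comm l (κ i)] at h4
        rw [if_neg, cutoffInv_eq_zero hδ (by linarith), Complex.ofReal_zero, mul_zero, zero_smul]
        intro hmem
        have := hmem.2 μ hμ hμl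
        linarith
    exact congrArg (fun S : Cr r →ₗ[ℂ] Cr r => S v) key

/-- The common neighbourhood of x₀ in [a, b] is a nondegenerate interval even when x₀ is an
endpoint, so almost everywhere equality of continuous functions there extends to x₀. -/
theorem HasProjValue.unique (hab : a < b) {x₀ l : ℝ} (hx₀ : x₀ ∈ Icc a b) {u : ℝ → Cr r}
    {w w' : Cr r} (h : HasProjValue a b A l x₀ u w) (h' : HasProjValue a b A l x₀ u w') :
    w = w' := by
  obtain ⟨ε, hε, g, hg, hgu, rfl⟩ := h
  obtain ⟨ε', hε', g', hg', hgu', rfl⟩ := h'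
  set η := min ε ε' with hη
  have hη0 : 0 < η := lt_min hε hε'
  have hη1 : η ≤ ε := min_le_left _ _
  have hη2 : η ≤ ε' := min_le_right _ _
  have s₁ : Icc a b ∩ Icc (x₀ - η) (x₀ + η) ⊆ Icc a b ∩ Icc (x₀ - ε) (x₀ + ε) :=
    inter_subset_inter_right _ (Icc_subset_Icc (by linarith) (by linarith))
  have s₂ : Icc a b ∩ Icc (x₀ - η) (x₀ + η) ⊆ Icc a b ∩ Icc (x₀ - ε') (x₀ + ε') :=
    inter_subset_inter_right _ (Icc_subset_Icc (by linarith) (by linarith))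
  have hgg : g =ᵐ[volume.restrict (Icc a b ∩ Icc (x₀ - η) (x₀ + η))] g' := by
    filter_upwards [ae_restrict_of_ae_restrict_of_subset s₁ hgu,
      ae_restrict_of_ae_restrict_of_subset s₂ hgu'] with x h1 h2
    rw [← h1, h2]
  have hgc := hg.mono s₁
  have hgc' := hg'.mono s₂
  have hmem : x₀ ∈ Icc a b ∩ Icc (x₀ - η) (x₀ + η) := ⟨hx₀, by linarith, by linarith⟩
  rw [Icc_inter_Icc] at hgg hgc hgc' hmem
  refine eqOn_Icc_of_ae_eq ?_ hgc hgc'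
    (ae_restrict_of_ae_restrict_of_subset Ioo_subset_Icc_self hgg) hmem
  rw [sup_lt_iff, lt_inf_iff, lt_inf_iff]
  refine ⟨⟨hab, ?_⟩, ?_, ?_⟩ <;> linarith [hx₀.1, hx₀.2]

/-- The value of `P_λ u` at `x₀`, in terms of a preimage of the value of `A u` there. -/
theorem IsFriedrichsCoeff.hasProjValue (h : IsFriedrichsCoeff a b A A' B) (hab : a < b)
    {x₀ l : ℝ} (hx₀ : x₀ ∈ Icc a b) (hl : l ≠ 0) (hle : IsEigenvalue (A x₀) l)
    {u w : ℝ → Cr r} (hw : IsFluxRep a b A u w) {t : Cr r} (ht : act (A x₀) t = w x₀) :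
    HasProjValue a b A l x₀ u
      ((Module.End.eigenspace (Matrix.toEuclideanLin (A x₀)) (l : ℂ)).starProjection t) := by
  obtain ⟨ε, hε, R, hR, hRP⟩ := h.exists_reducedInverse hab hx₀ hl
  refine ⟨ε, hε, fun x => R x (w x), (hR.clm_apply hw.1).mono inter_subset_left, ?_, ?_⟩
  · have h2 := hw.2
    rw [Measure.restrict_congr_set Ioo_ae_eq_Icc] at h2
    filter_upwards [ae_restrict_of_ae_restrict_of_subset inter_subset_left h2,
      ae_restrict_mem (measurableSet_Icc.inter measurableSet_Icc)] with x h3 h4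
    rw [hRP x h4, h3]
  · change R x₀ (w x₀) = _
    rw [← ht, ← hRP x₀ ⟨hx₀, by linarith, by linarith⟩, totalProj_self hle]

/-- `P_λ u` vanishes at `x₀` iff a preimage of the value of `A u` is orthogonal to the
eigenspace. -/
theorem IsFriedrichsCoeff.mem_vanishing_iff (h : IsFriedrichsCoeff a b A A' B) (hab : a < b)
    {x₀ l : ℝ} (hx₀ : x₀ ∈ Icc a b) (hl : l ≠ 0) (hle : IsEigenvalue (A x₀) l)
    {u : L2 a b r} {w : ℝ → Cr r} (hw : IsFluxRep a b A u w) {t : Cr r}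
    (ht : act (A x₀) t = w x₀) :
    u ∈ vanishing a b A l x₀ ↔ ∀ z, act (A x₀) z = (l : ℂ) • z → inner ℂ z t = 0 := by
  have h1 := h.hasProjValue hab hx₀ hl hle hw ht
  have h2 : u ∈ vanishing a b A l x₀ ↔
      (Module.End.eigenspace (Matrix.toEuclideanLin (A x₀)) (l : ℂ)).starProjection t = 0 := by
    refine ⟨fun hu => h1.unique hab hx₀ hu, fun h0 => ?_⟩
    rw [h0] at h1
    exact h1
  rw [h2, Submodule.starProjection_apply_eq_zero_iff, Submodule.mem_orthogonal]
  simp only [Module.End.mem_eigenspace_iff]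

end Projections

/-! ### The (V)-conditions as sign conditions on traces. -/

section BoundaryConditions

variable {r : ℕ} {a b : ℝ} {A A' B : ℝ → Matrix (Fin r) (Fin r) ℂ}
  {M : Matrix (Fin r) (Fin r) ℂ} {σ : ℝ} {s t z : Cr r}

/-- `t` is orthogonal to the eigenvectors of `M` whose eigenvalue has the sign of `σ`. -/
def PerpSign (σ : ℝ) (M : Matrix (Fin r) (Fin r) ℂ) (t : Cr r) : Prop :=
  ∀ l : ℝ, 0 < σ * l → ∀ z, act M z = (l : ℂ) • z → inner ℂ z t = 0

theorem exists_inner_act_eq_sum (hM : M.IsHermitian) :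
    ∃ (e : OrthonormalBasis (Fin r) ℂ (Cr r)) (ν : Fin r → ℝ),
      (∀ i, act M (e i) = (ν i : ℂ) • e i) ∧
      ∀ s t, inner ℂ s (act M t) = ∑ i, (ν i : ℂ) * (inner ℂ s (e i) * inner ℂ (e i) t) := by
  obtain ⟨e, ν, he⟩ := exists_eigenbasis hM
  refine ⟨e, ν, fun i => (he i).1, fun s t => ?_⟩
  rw [← e.sum_inner_mul_inner s (act M t)]
  refine Finset.sum_congr rfl fun i _ => ?_
  have h2 := inner_act_left M (e i) t
  rw [hM, (he i).1, inner_smul_left, Complex.conj_ofReal] at h2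
  rw [← h2]
  ring

/-- In an eigenbasis each term contains the eigenvalue and coefficients of s and t; one of the three
is zero, according to the sign of σν. -/
theorem PerpSign.inner_act_eq_zero (hM : M.IsHermitian) (ht : PerpSign σ M t)
    (hs : PerpSign (-σ) M s) (hσ : σ ≠ 0) : inner ℂ s (act M t) = 0 := by
  obtain ⟨e, ν, he, hsum⟩ := exists_inner_act_eq_sum hM
  rw [hsum]
  refine Finset.sum_eq_zero fun i _ => ?_
  rcases lt_trichotomy (σ * ν i) 0 with h | h | h
  · rw [inner_eq_zero_symm.1 (hs (ν i) (by linarith) _ (he i)), zero_mul, mul_zero]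
  · rw [(mul_eq_zero.1 h).resolve_left hσ, Complex.ofReal_zero, zero_mul]
  · rw [ht (ν i) h _ (he i), mul_zero, mul_zero]

open scoped ComplexOrder in
theorem PerpSign.mul_inner_act_nonpos (hM : M.IsHermitian) (ht : PerpSign σ M t) :
    (σ : ℂ) * inner ℂ t (act M t) ≤ 0 := by
  obtain ⟨e, ν, he, hsum⟩ := exists_inner_act_eq_sum hM
  rw [hsum, Finset.mul_sum]
  refine Finset.sum_nonpos fun i _ => ?_
  have h1 : (σ : ℂ) * ((ν i : ℂ) * (inner ℂ t (e i) * inner ℂ (e i) t)) =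
      ((σ * ν i * ‖inner ℂ (e i) t‖ ^ 2 : ℝ) : ℂ) := by
    rw [← inner_conj_symm t (e i), Complex.conj_mul']
    push_cast
    ring
  rw [h1, ← Complex.ofReal_zero, Complex.real_le_real]
  rcases le_or_gt (σ * ν i) 0 with h | h
  · exact mul_nonpos_of_nonpos_of_nonneg h (sq_nonneg _)
  · rw [ht (ν i) h _ (he i)]
    simp

/-- Eigenspaces of a Hermitian matrix are mutually orthogonal. This makes eigenvectors of the
forbidden sign admissible as traces for the dual space. -/
theorem perpSign_of_eigenvector (hM : M.IsHermitian) {l : ℝ} (hl : 0 < σ * l)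
    (hz : act M z = (l : ℂ) • z) : PerpSign (-σ) M z := by
  intro l' hl' z' hz'
  refine (isSymmetric_toEuclideanLin hM).orthogonalFamily_eigenspaces
    (i := (l' : ℂ)) (j := (l : ℂ)) ?_ ⟨z', Module.End.mem_eigenspace_iff.2 hz'⟩
    ⟨z, Module.End.mem_eigenspace_iff.2 hz⟩
  intro h
  rw [Complex.ofReal_inj.1 h] at hl'
  linarith

theorem perpSign_zero : PerpSign σ M (0 : Cr r) := fun _ _ _ _ => inner_zero_right _

theorem isEigenvalue_of_apply {l : ℝ} (hz : act M z = (l : ℂ) • z) (h0 : z ≠ 0) :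
    IsEigenvalue M l :=
  Module.End.hasEigenvalue_of_hasEigenvector ⟨Module.End.mem_eigenspace_iff.2 hz, h0⟩

/-- `A(a) t` and `A(b) s` are the boundary values of `A u`. -/
def IsTrace (a b : ℝ) (A : ℝ → Matrix (Fin r) (Fin r) ℂ) (u : ℝ → Cr r) (t s : Cr r) : Prop :=
  ∃ w, IsFluxRep a b A u w ∧ act (A a) t = w a ∧ act (A b) s = w b

theorem IsFriedrichsCoeff.exists_isTrace (h : IsFriedrichsCoeff a b A A' B) (hab : a < b)
    {u : L2 a b r} (hu : u ∈ graphSpace (opT a b A B) (opT' a b A A' B)) :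
    ∃ t s, IsTrace a b A u t s := by
  obtain ⟨w, hw, ht⟩ := h.exists_isFluxRep hab hu
  obtain ⟨t, ht'⟩ := ht a (by simp)
  obtain ⟨s, hs'⟩ := ht b (by simp)
  exact ⟨t, s, w, hw, ht', hs'⟩

/-- Traces are determined only modulo the kernels of A(a) and A(b). By symmetry of these matrices
the right side does not depend on the choice. -/
theorem IsFriedrichsCoeff.boundaryForm_eq_traces (h : IsFriedrichsCoeff a b A A' B) (hab : a < b)
    {u v : L2 a b r} (hu : u ∈ graphSpace (opT a b A B) (opT' a b A A' B))
    (hv : v ∈ graphSpace (opT a b A B) (opT' a b A A' B)) {t₁ s₁ t₂ s₂ : Cr r}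
    (h₁ : IsTrace a b A u t₁ s₁) (h₂ : IsTrace a b A v t₂ s₂) :
    boundaryForm (opT a b A B) (opT' a b A A' B) ⟨u, hu⟩ ⟨v, hv⟩ =
      inner ℂ s₂ (act (A b) s₁) - inner ℂ t₂ (act (A a) t₁) := by
  obtain ⟨w₁, hw₁, ht₁, hs₁⟩ := h₁
  obtain ⟨w₂, hw₂, ht₂, hs₂⟩ := h₂
  rw [h.boundaryForm_eq hab ⟨u, hu⟩ ⟨v, hv⟩ hw₁ hw₂ hs₁ ht₂, ← ht₁, ← hs₂]
  congr 1
  have := inner_act_left (A b) s₂ s₁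
  rwa [h.isHermitian_Icc hab (right_mem_Icc.2 hab.le)] at this

theorem IsFriedrichsCoeff.forall_mem_vanishing_iff (h : IsFriedrichsCoeff a b A A' B)
    (hab : a < b) {x₀ : ℝ} (hx₀ : x₀ ∈ Icc a b) {u : L2 a b r} {w : ℝ → Cr r}
    (hw : IsFluxRep a b A u w) (ht : act (A x₀) t = w x₀) :
    (∀ l, IsEigenvalue (A x₀) l → 0 < σ * l → u ∈ vanishing a b A l x₀) ↔
      PerpSign σ (A x₀) t := by
  have hne : ∀ l, 0 < σ * l → l ≠ 0 := by
    rintro l hl rfl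
    simp at hl
  refine ⟨fun hu l hl z hz => ?_, fun hp l hle hl => ?_⟩
  · rcases eq_or_ne z 0 with rfl | h0
    · exact inner_zero_left _
    · have hle := isEigenvalue_of_apply hz h0
      exact (h.mem_vanishing_iff hab hx₀ (hne l hl) hle hw ht).1 (hu l hle hl) z hz
  · exact (h.mem_vanishing_iff hab hx₀ (hne l hl) hle hw ht).2 (hp l hl)

theorem IsFriedrichsCoeff.mem_spaceV_iff (h : IsFriedrichsCoeff a b A A' B) (hab : a < b)
    {u : L2 a b r} (hu : u ∈ graphSpace (opT a b A B) (opT' a b A A' B))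
    (ht : IsTrace a b A u t s) :
    u ∈ spaceV a b A A' B ↔ PerpSign 1 (A a) t ∧ PerpSign (-1) (A b) s := by
  obtain ⟨w, hw, ht, hs⟩ := ht
  rw [← h.forall_mem_vanishing_iff hab (left_mem_Icc.2 hab.le) hw ht,
    ← h.forall_mem_vanishing_iff hab (right_mem_Icc.2 hab.le) hw hs]
  simp [spaceV, Submodule.mem_iInf, hu]

theorem IsFriedrichsCoeff.mem_spaceV'_iff (h : IsFriedrichsCoeff a b A A' B) (hab : a < b)
    {u : L2 a b r} (hu : u ∈ graphSpace (opT a b A B) (opT' a b A A' B))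
    (ht : IsTrace a b A u t s) :
    u ∈ spaceV' a b A A' B ↔ PerpSign (-1) (A a) t ∧ PerpSign 1 (A b) s := by
  obtain ⟨w, hw, ht, hs⟩ := ht
  rw [← h.forall_mem_vanishing_iff hab (left_mem_Icc.2 hab.le) hw ht,
    ← h.forall_mem_vanishing_iff hab (right_mem_Icc.2 hab.le) hw hs]
  simp [spaceV', Submodule.mem_iInf, hu]

/-- The affine function equal to z at a and 0 at b; it isolates the contribution of a to the
boundary form. -/
theorem IsFriedrichsCoeff.exists_isTrace_left (h : IsFriedrichsCoeff a b A A' B) (hab : a < b)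
    (z : Cr r) : ∃ v ∈ graphSpace (opT a b A B) (opT' a b A A' B), IsTrace a b A v z 0 := by
  have hne : b - a ≠ 0 := (sub_pos.2 hab).ne'
  obtain ⟨v, hv, -, hw⟩ := h.exists_affine (b / (b - a)) (-1 / (b - a)) z
  have e1 : b / (b - a) + -1 / (b - a) * a = 1 := by field_simp; ring
  have e2 : b / (b - a) + -1 / (b - a) * b = 0 := by field_simp; ring
  exact ⟨v, hv, _, hw, by simp only [e1, Complex.ofReal_one, one_smul],
    by simp only [e2, Complex.ofReal_zero, zero_smul, map_zero]⟩

theorem IsFriedrichsCoeff.exists_isTrace_right (h : IsFriedrichsCoeff a b A A' B) (hab : a < b)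
    (z : Cr r) : ∃ v ∈ graphSpace (opT a b A B) (opT' a b A A' B), IsTrace a b A v 0 z := by
  have hne : b - a ≠ 0 := (sub_pos.2 hab).ne'
  obtain ⟨v, hv, -, hw⟩ := h.exists_affine (-a / (b - a)) (1 / (b - a)) z
  have e1 : -a / (b - a) + 1 / (b - a) * a = 0 := by field_simp; ring
  have e2 : -a / (b - a) + 1 / (b - a) * b = 1 := by field_simp; ring
  exact ⟨v, hv, _, hw, by simp only [e1, Complex.ofReal_zero, zero_smul, map_zero],
    by simp only [e2, Complex.ofReal_one, one_smul]⟩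

theorem inner_eq_zero_of_inner_act (hM : M.IsHermitian) {l : ℝ} (hl : l ≠ 0)
    (hz : act M z = (l : ℂ) • z) (h0 : inner ℂ z (act M t) = 0) : inner ℂ z t = 0 := by
  have h1 := inner_act_left M z t
  rw [hM, hz, h0, inner_smul_left, Complex.conj_ofReal] at h1
  exact (mul_eq_zero.1 h1).resolve_left (by exact_mod_cast hl)

/-- Sign conditions on the traces are complementary with respect to the boundary form. -/
theorem IsFriedrichsCoeff.eq_boundaryPerp (h : IsFriedrichsCoeff a b A A' B) (hab : a < b)
    (hσ : σ ≠ 0) {S S' : Set (L2 a b r)}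
    (hS : S ⊆ graphSpace (opT a b A B) (opT' a b A A' B))
    (hS₁ : ∀ u ∈ graphSpace (opT a b A B) (opT' a b A A' B), ∀ t s, IsTrace a b A u t s →
      (u ∈ S ↔ PerpSign σ (A a) t ∧ PerpSign (-σ) (A b) s))
    (hS₂ : ∀ u ∈ graphSpace (opT a b A B) (opT' a b A A' B), ∀ t s, IsTrace a b A u t s →
      (u ∈ S' ↔ PerpSign (-σ) (A a) t ∧ PerpSign σ (A b) s)) :
    S = boundaryPerp (opT a b A B) (opT' a b A A' B) S' := by
  have hMa := h.isHermitian_Icc hab (left_mem_Icc.2 hab.le)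
  have hMb := h.isHermitian_Icc hab (right_mem_Icc.2 hab.le)
  have hne : ∀ {τ l : ℝ}, 0 < τ * l → l ≠ 0 := by
    rintro τ l hl rfl
    simp at hl
  ext u
  constructor
  · intro hu
    refine ⟨hS hu, fun v hv hvS => ?_⟩
    obtain ⟨t₁, s₁, h₁⟩ := h.exists_isTrace hab (hS hu)
    obtain ⟨t₂, s₂, h₂⟩ := h.exists_isTrace hab hv
    obtain ⟨p1, p2⟩ := (hS₁ u (hS hu) t₁ s₁ h₁).1 hu
    obtain ⟨q1, q2⟩ := (hS₂ v hv t₂ s₂ h₂).1 hvS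
    rw [h.boundaryForm_eq_traces hab (hS hu) hv h₁ h₂, p1.inner_act_eq_zero hMa q1 hσ,
      p2.inner_act_eq_zero hMb (by rwa [neg_neg]) (neg_ne_zero.2 hσ), sub_zero]
  · rintro ⟨hu, hperp⟩
    obtain ⟨t, s, ht⟩ := h.exists_isTrace hab hu
    refine (hS₁ u hu t s ht).2 ⟨fun l hl z hz => ?_, fun l hl z hz => ?_⟩
    -- Testing with trace z at a and 0 at b gives ⟨z, A(a)t⟩ = 0. As z is an eigenvector with
    -- nonzero eigenvalue, ⟨z, t⟩ = 0.
    · obtain ⟨v, hv, hvt⟩ := h.exists_isTrace_left hab z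
      have h1 := hperp v hv ((hS₂ v hv _ _ hvt).2
        ⟨perpSign_of_eigenvector hMa hl hz, perpSign_zero⟩)
      rw [h.boundaryForm_eq_traces hab hu hv ht hvt, inner_zero_left, zero_sub, neg_eq_zero] at h1
      exact inner_eq_zero_of_inner_act hMa (hne hl) hz h1
    · obtain ⟨v, hv, hvt⟩ := h.exists_isTrace_right hab z
      have h2 := perpSign_of_eigenvector hMb hl hz
      rw [neg_neg] at h2
      have h1 := hperp v hv ((hS₂ v hv _ _ hvt).2 ⟨perpSign_zero, h2⟩)
      rw [h.boundaryForm_eq_traces hab hu hv ht hvt, inner_zero_left, sub_zero] at h1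
      exact inner_eq_zero_of_inner_act hMb (hne hl) hz h1

open scoped ComplexOrder in
theorem IsFriedrichsCoeff.vBoundaryConditions (h : IsFriedrichsCoeff a b A A' B) (hab : a < b) :
    VBoundaryConditions (opT a b A B) (opT' a b A A' B) (spaceV a b A A' B)
      (spaceV' a b A A' B) := by
  have hMa := h.isHermitian_Icc hab (left_mem_Icc.2 hab.le)
  have hMb := h.isHermitian_Icc hab (right_mem_Icc.2 hab.le)
  have hV : spaceV a b A A' B ≤ graphSpace (opT a b A B) (opT' a b A A' B) :=
    inf_le_left.trans inf_le_left
  have hV' : spaceV' a b A A' B ≤ graphSpace (opT a b A B) (opT' a b A A' B) :=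
    inf_le_left.trans inf_le_left
  refine ⟨hV, hV', fun u hu huV => ?_, fun u hu huV => ?_, ?_, ?_⟩
  -- On V, t has no component in the positive eigenspaces of A(a) and s none in the negative ones of
  -- A(b), so ⟨A(a)t, t⟩ ≤ 0 ≤ ⟨A(b)s, s⟩.
  · obtain ⟨t, s, ht⟩ := h.exists_isTrace hab hu
    obtain ⟨p, q⟩ := (h.mem_spaceV_iff hab hu ht).1 huV
    have p1 := p.mul_inner_act_nonpos hMa
    have q1 := q.mul_inner_act_nonpos hMb
    rw [h.boundaryForm_eq_traces hab hu hu ht ht, sub_nonneg]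
    push_cast at p1 q1
    rw [one_mul] at p1
    rw [neg_one_mul, neg_nonpos] at q1
    exact p1.trans q1
  · obtain ⟨t, s, ht⟩ := h.exists_isTrace hab hu
    obtain ⟨p, q⟩ := (h.mem_spaceV'_iff hab hu ht).1 huV
    have p1 := p.mul_inner_act_nonpos hMa
    have q1 := q.mul_inner_act_nonpos hMb
    rw [h.boundaryForm_eq_traces hab hu hu ht ht, sub_nonpos]
    push_cast at p1 q1
    rw [one_mul] at q1
    rw [neg_one_mul, neg_nonpos] at p1
    exact q1.trans p1
  · exact h.eq_boundaryPerp hab one_ne_zero hV (fun u hu t s ht => h.mem_spaceV_iff hab hu ht)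
      fun u hu t s ht => h.mem_spaceV'_iff hab hu ht
  -- Taking σ = −1 exchanges the roles of V and Ṽ.
  · refine h.eq_boundaryPerp hab (neg_ne_zero.2 one_ne_zero) hV'
      (fun u hu t s ht => ?_) fun u hu t s ht => ?_
    · rw [neg_neg]
      exact h.mem_spaceV'_iff hab hu ht
    · rw [neg_neg]
      exact h.mem_spaceV_iff hab hu ht

theorem IsFriedrichsCoeff.existsUnique_hasProjValue (h : IsFriedrichsCoeff a b A A' B)
    (hab : a < b) {u : L2 a b r} (hu : u ∈ graphSpace (opT a b A B) (opT' a b A A' B)) {x₀ : ℝ}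
    (hx₀ : x₀ ∈ ({a, b} : Set ℝ)) {l : ℝ} (hl : l ≠ 0) (hle : IsEigenvalue (A x₀) l) :
    ∃! w, HasProjValue a b A l x₀ u w := by
  have hx₀' : x₀ ∈ Icc a b := by
    rcases hx₀ with rfl | rfl
    · exact left_mem_Icc.2 hab.le
    · exact right_mem_Icc.2 hab.le
  obtain ⟨w, hw, ht⟩ := h.exists_isFluxRep hab hu
  obtain ⟨t, ht⟩ := ht x₀ hx₀
  have h1 := h.hasProjValue hab hx₀' hl hle hw ht
  exact ⟨_, h1, fun w' hw' => hw'.unique hab hx₀' h1⟩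

end BoundaryConditions

end Friedrichs

end

theorem lemma4p1 {r : ℕ} {a b : ℝ} (hab : a < b) (A A' B : ℝ → Matrix (Fin r) (Fin r) ℂ)
    (hcoeff : Friedrichs.IsFriedrichsCoeff a b A A' B) :
    -- the objects are well defined: `(T, T̃)` is a joint pair, and the evaluations make sense
    Friedrichs.IsJointPair (Friedrichs.opT a b A B) (Friedrichs.opT' a b A A' B) ∧
    (∀ u ∈ Friedrichs.graphSpace (Friedrichs.opT a b A B) (Friedrichs.opT' a b A A' B),
      ∀ x₀ ∈ ({a, b} : Set ℝ), ∀ l : ℝ, l ≠ 0 → Friedrichs.IsEigenvalue (A x₀) l →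
        ∃! w, Friedrichs.HasProjValue a b A l x₀ u w) ∧
    -- the (V)-boundary conditions
    Friedrichs.VBoundaryConditions (Friedrichs.opT a b A B) (Friedrichs.opT' a b A A' B)
      (Friedrichs.spaceV a b A A' B) (Friedrichs.spaceV' a b A A' B) ∧
    -- mutually adjoint bijective realisations
    Friedrichs.IsBijectiveRealisationPair (Friedrichs.opT a b A B) (Friedrichs.opT' a b A A' B)
      (Friedrichs.spaceV a b A A' B) (Friedrichs.spaceV' a b A A' B) := by
  have hT := hcoeff.isJointPair
  have hV := hcoeff.vBoundaryConditions hab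
  exact ⟨hT, fun u hu x₀ hx₀ l hl hle => hcoeff.existsUnique_hasProjValue hab hu hx₀ hl hle, hV,
    hV.isBijectiveRealisationPair hT⟩
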